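/- **Setting.** Let $\mathcal X,\mathcal Y$ be finite alphabets, $P_X$ a probability distribution on $\mathcal X$ with rational probabilities, $R>0$, $T\in\mathbb R$, and let $\{W_\theta(y|x)\}_{\theta\in\Theta}$, $\Theta\ne\emptyset$, be a family of discrete memoryless channels from $\mathcal X$ to $\mathcal Y$. Logarithms are natural, $\log 0=-\infty$, $0\cdot(-\infty)=0$; an infimum over the empty set is $+\infty$. For a joint distribution $Q$ on $\mathcal X\times\mathcal Y$ let $Q_X,Q_Y$ be its marginals and $I(Q)$ its mutual information; $D(\cdot\|\cdot)$ is the divergence. Let $$\mathcal D=\{(Q,\tilde Q):\ Q_X=\tilde Q_X=P_X,\ Q_Y=\tilde Q_Y\}.$$ **The exponent.** For a channel $W$ put $E_1(R,T)=\min\{E_a,E_b\}$, where $$E_a=\min\{D(\tilde Q\|P_X\times W)+I(Q)-R:\ (Q,\tilde Q)\in\mathcal D,\ I(Q)\ge R,\ \mathbb E_{\tilde Q}\log W-\mathbb E_Q\log W-T\le 0\},$$ $$E_b=\min\Big\{D(\tilde Q\|P_X\times W):\ \mathbb E_{\tilde Q}\log W\le R+T+\max_{Q:(Q,\tilde Q)\in\mathcal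 D,\ I(Q)\le R}[\mathbb E_Q\log W-I(Q)]\Big\}.$$ Write $E_1(\theta)=E_1(R,T,\theta)$ for the value at $W=W_\theta$. **Codes and decoders.** For blocklength $n$ such that the type class $\mathcal T(P_X)\subset\mathcal X^n$ is non-empty, a random code $\mathcal C=(\mathbf x_1,\dots,\mathbf x_M)$, $M=\lceil e^{nR}\rceil$, has independent codewords, uniform in $\mathcal T(P_X)$. A list decoder is given by arbitrary regions $\mathcal R_1,\dots,\mathcal R_M\subseteq\mathcal Y^n$; it is an erasure decoder if they are disjoint. Let $$\Gamma_\theta(\mathcal C,\mathcal R)=\frac1M\sum_{m=1}^M\Big[\sum_{\mathbf y\in\mathcal R_m}\sum_{m'\ne m}W_\theta(\mathbf y|\mathbf x_{m'})+e^{-nT}\sum_{\mathbf y\in\mathcal R_m^c}W_\theta(\mathbf y|\mathbf x_m)\Big],$$ $$K_n(\mathcal C)=\min_{\mathcal R}\ \sup_{\theta\in\Theta}\ \frac{\Gamma_\theta(\mathcal C,\mathcal R)}{e^{-n(\xi E_1(\theta)+T)}}.$$ The number $\xi\in[0,1]$ is *achievable* if $\limsup_{n\to\infty}\frac1n\log\mathbb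 E[K_n(\mathcal C)]\le 0$, where $n$ runs through the blocklengths with $\mathcal T(P_X)\neq\emptyset$, and $\xi^*(R,T)$ is the supremum of the achievable $\xi$. The minimum is over all list decoders, or, if $T\ge0$, alternatively over all erasure decoders (the claims below hold in both modes). **Conditions.** Put $$G(\tilde Q)=\sup_{\theta\in\Theta}\{\xi E_1(\theta)+T+\mathbb E_{\tilde Q}\log W_\theta\},\qquad \Omega(Q,\tilde Q)=G(\tilde Q)-G(Q)-T,$$ $$\mathcal Q=\{(Q,\tilde Q)\in\mathcal D:\ I(Q)\ge R,\ \Omega(Q,\tilde Q)\le 0\},$$ $$\mathcal L=\Big\{\tilde Q:\ G(\tilde Q)\le R+T+\max_{Q:(Q,\tilde Q)\in\mathcal D,\ I(Q)\le R}[G(Q)-I(Q)]\Big\}.$$ **Assumptions.** (i) $\sup_\theta E_1(\theta)<\infty$. (ii) Either $T\ge 0$, or $-R\le T<0$ and some $W_\theta$ has only positive entries. (iii) For every $\theta$ and every $\varepsilon>0$ there is $\theta'\in\Theta$ such that every entry of $W_{\theta'}$ that vanishes is zero in all channels of the family, $|W_{\theta'}(y|x)-W_\theta(y|x)|<\varepsilon$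 for all $x,y$, and $E_1(\theta)\le E_1(\theta')+\varepsilon$. (Assumption (iii) holds with $\theta'=\theta$ if all $W_\theta(y|x)$ are positive, or if all channels have the same zero entries.) **Theorem.** The supremum $\xi^*(R,T)$ is itself achievable, and it equals the largest number $\xi\in[0,1]$ that satisfies simultaneously $$\sup_{\theta\in\Theta}\Big\{\xi E_1(\theta)-\min_{(Q,\tilde Q)\in\mathcal Q}\big[D(\tilde Q\|P_X\times W_\theta)+I(Q)-R\big]\Big\}\le 0$$ and $$\sup_{\theta\in\Theta}\Big\{\xi E_1(\theta)-\min_{\tilde Q\in\mathcal L}D(\tilde Q\|P_X\times W_\theta)\Big\}\le 0 .$$ Moreover $E_1(\theta)$ is the exact random coding exponent of Forney's optimal decoder: for each $\theta$ for which $t\mapsto E_1(R,t,\theta)$ is left-continuous at $t=T$, $$E_1(R,T,\theta)=-\liminf_{n\to\infty}\frac1n\log\overline{\Pr}\{\mathcal E_1\},$$ where $\overline{\Pr}\{\mathcal E_1\}$ is the ensemble average of $\frac1M\sum_m\sum_{\mathbf y\in\mathcal R_m^c}W_\theta(\mathbf y|\mathbf x_m)$ for the regions $\mathcal R_m=\{\mathbf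 y:\ W_\theta(\mathbf y|\mathbf x_m)\ge e^{nT}\sum_{m'\ne m}W_\theta(\mathbf y|\mathbf x_{m'})\}$ and $n$ runs through the same blocklengths. -/

import Mathlib

open scoped ENNReal

noncomputable section

namespace ErasureList

/-! ### Single-letter information quantities

A joint distribution on `X × Y` is a point `Q` of `stdSimplex ℝ (X × Y)`, and a channel is a map
`W : X → Y → ℝ` all of whose rows `W x` are points of `stdSimplex ℝ Y`. Logarithms are natural. -/

section SingleLetter

variable {X Y Θ : Type*} [Fintype X] [Fintype Y]

/-- The `X`-marginal of a joint distribution. -/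
def margX (Q : X × Y → ℝ) (x : X) : ℝ := ∑ y, Q (x, y)

/-- The `Y`-marginal of a joint distribution. -/
def margY (Q : X × Y → ℝ) (y : Y) : ℝ := ∑ x, Q (x, y)

/-- The joint distribution `P × W`. -/
def joint (P : X → ℝ) (W : X → Y → ℝ) (p : X × Y) : ℝ := P p.1 * W p.1 p.2

/-- The divergence `D(Q ‖ V)`, equal to `+∞` unless `Q` is absolutely continuous w.r.t. `V`. -/
def kl (Q V : X × Y → ℝ) : EReal :=
  open Classical in
  if ∀ p, V p = 0 → Q p = 0 then ((∑ p, Q p * Real.log (Q p / V p) : ℝ) : EReal) else ⊤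

/-- The mutual information `I(Q)`. -/
def mutualInfo (Q : X × Y → ℝ) : ℝ :=
  ∑ p, Q p * Real.log (Q p / (margX Q p.1 * margY Q p.2))

/-- The expectation `E_Q log W(Y|X)`, with `log 0 = -∞` and `0 * (-∞) = 0`. -/
def expLog (Q : X × Y → ℝ) (W : X → Y → ℝ) : EReal :=
  ∑ p : X × Y, (Q p : EReal) * ENNReal.log (ENNReal.ofReal (W p.1 p.2))

/-- The set `𝒟` of pairs `(Q, Q')` of joint distributions with `Q_X = Q'_X = P`, `Q_Y = Q'_Y`. -/
def pairs (P : X → ℝ) : Set ((X × Y → ℝ) × (X × Y → ℝ)) :=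
  {q | q.1 ∈ stdSimplex ℝ (X × Y) ∧ q.2 ∈ stdSimplex ℝ (X × Y) ∧
    margX q.1 = P ∧ margX q.2 = P ∧ margY q.1 = margY q.2}

/-! ### The exact random coding exponent of the known channel -/

/-- The exponent `E_a(R, T)` of the channel `W`. -/
def exponentA (P : X → ℝ) (W : X → Y → ℝ) (R T : ℝ) : EReal :=
  ⨅ q ∈ {q : (X × Y → ℝ) × (X × Y → ℝ) | q ∈ pairs P ∧ R ≤ mutualInfo q.1 ∧
      expLog q.2 W - expLog q.1 W - (T : EReal) ≤ 0},
    kl q.2 (joint P W) + (mutualInfo q.1 : EReal) - (R : EReal)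

/-- The exponent `E_b(R, T)` of the channel `W`. -/
def exponentB (P : X → ℝ) (W : X → Y → ℝ) (R T : ℝ) : EReal :=
  ⨅ q' ∈ {q' : X × Y → ℝ | q' ∈ stdSimplex ℝ (X × Y) ∧
      expLog q' W ≤ (R : EReal) + (T : EReal) +
        ⨆ q ∈ {q : X × Y → ℝ | (q, q') ∈ pairs P ∧ mutualInfo q ≤ R},
          (expLog q W - (mutualInfo q : EReal))},
    kl q' (joint P W)

/-- The exact exponent `E_1(R, T) = min {E_a(R, T), E_b(R, T)}` of the channel `W`. -/
def exponent (P : X → ℝ) (W : X → Y → ℝ) (R T : ℝ) : EReal :=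
  min (exponentA P W R T) (exponentB P W R T)

/-! ### The single-letter conditions on the fraction `ξ`

Here `W θ` is a family of channels and `E θ` stands for the exponent `E_1(R, T, θ)`. -/

/-- `G(Q) = max_θ {ξ E_1(θ) + T + E_Q log W_θ(Y|X)}`. -/
def metric (W : Θ → X → Y → ℝ) (E : Θ → EReal) (T ξ : ℝ) (Q : X × Y → ℝ) : EReal :=
  ⨆ θ, ((ξ : EReal) * E θ + (T : EReal) + expLog Q (W θ))

/-- `Ω(Q, Q') = G(Q') - G(Q) - T`. -/
def gap (W : Θ → X → Y → ℝ) (E : Θ → EReal) (T ξ : ℝ) (Q Q' : X × Y → ℝ) : EReal :=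
  metric W E T ξ Q' - metric W E T ξ Q - (T : EReal)

/-- The set `𝒬` of pairs `(Q, Q')`. -/
def setQ (P : X → ℝ) (W : Θ → X → Y → ℝ) (E : Θ → EReal) (R T ξ : ℝ) :
    Set ((X × Y → ℝ) × (X × Y → ℝ)) :=
  {q | q ∈ pairs P ∧ R ≤ mutualInfo q.1 ∧ gap W E T ξ q.1 q.2 ≤ 0}

/-- The set `ℒ` of joint distributions `Q'`. -/
def setL (P : X → ℝ) (W : Θ → X → Y → ℝ) (E : Θ → EReal) (R T ξ : ℝ) : Set (X × Y → ℝ) :=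
  {q' | q' ∈ stdSimplex ℝ (X × Y) ∧
    metric W E T ξ q' ≤ (R : EReal) + (T : EReal) +
      ⨆ q ∈ {q : X × Y → ℝ | (q, q') ∈ pairs P ∧ mutualInfo q ≤ R},
        (metric W E T ξ q - (mutualInfo q : EReal))}

/-- The first single-letter condition on `ξ`. -/
def condQ (P : X → ℝ) (W : Θ → X → Y → ℝ) (E : Θ → EReal) (R T ξ : ℝ) : Prop :=
  (⨆ θ, ((ξ : EReal) * E θ - ⨅ q ∈ setQ P W E R T ξ,
    (kl q.2 (joint P (W θ)) + (mutualInfo q.1 : EReal) - (R : EReal)))) ≤ 0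

/-- The second single-letter condition on `ξ`. -/
def condL (P : X → ℝ) (W : Θ → X → Y → ℝ) (E : Θ → EReal) (R T ξ : ℝ) : Prop :=
  (⨆ θ, ((ξ : EReal) * E θ - ⨅ q' ∈ setL P W E R T ξ, kl q' (joint P (W θ)))) ≤ 0

end SingleLetter

/-! ### Codes, decoders and error events -/

section Coding

variable {X Y Θ : Type*}

/-- The empirical distribution of a vector. -/
def empirical [DecidableEq X] {n : ℕ} (x : Fin n → X) (a : X) : ℝ :=
  ((Finset.univ.filter fun i => x i = a).card : ℝ) / (n : ℝ)

/-- The type class `𝒯(P)` of blocklength `n`. -/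
def typeClass [Fintype X] [DecidableEq X] (P : X → ℝ) (n : ℕ) : Finset (Fin n → X) :=
  open Classical in Finset.univ.filter fun x => empirical x = P

/-- The number `M = ⌈exp (n R)⌉` of messages. -/
def numMsg (R : ℝ) (n : ℕ) : ℕ := ⌈Real.exp ((n : ℝ) * R)⌉₊

/-- The memoryless extension `W(y|x)` to vectors of length `n`. -/
def channelN (W : X → Y → ℝ) {n : ℕ} (x : Fin n → X) (y : Fin n → Y) : ℝ :=
  ∏ i, W (x i) (y i)

/-- A decoder for `M` messages, given by its regions `ℛ_1, …, ℛ_M`; the region `ℛ_0` is the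
complement of their union. For a list decoder the regions are arbitrary. -/
abbrev Decoder (Y : Type*) (n M : ℕ) := Fin M → Finset (Fin n → Y)

/-- The two modes of operation. -/
inductive Mode
  | erasure
  | list

/-- In the erasure mode the regions of the decoder have to be disjoint. -/
def Mode.Admits {n M : ℕ} : Mode → Decoder Y n M → Prop
  | .erasure, D => Pairwise fun m m' => Disjoint (D m) (D m')
  | .list, _ => True

variable [Fintype Y]

/-- `Pr {ℰ_1}`: the transmitted message is not decided on (or is not on the list). -/
def probE1 [DecidableEq Y] (W : X → Y → ℝ) {n M : ℕ} (C : Fin M → Fin n → X)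
    (D : Decoder Y n M) : ℝ :=
  (1 / (M : ℝ)) * ∑ m, ∑ y ∈ (D m)ᶜ, channelN W (C m) y

/-- `Pr {ℰ_2}`: the undetected error probability (or the average number of wrong messages on the
list). -/
def probE2 (W : X → Y → ℝ) {n M : ℕ} (C : Fin M → Fin n → X) (D : Decoder Y n M) : ℝ :=
  (1 / (M : ℝ)) * ∑ m, ∑ y ∈ D m, ∑ m' ∈ Finset.univ.erase m, channelN W (C m') y

/-- The Lagrangian `Γ(𝒞, ℛ) = Pr {ℰ_2} + exp (-n T) Pr {ℰ_1}`. -/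
def lagrangian [DecidableEq Y] (W : X → Y → ℝ) (T : ℝ) {n M : ℕ} (C : Fin M → Fin n → X)
    (D : Decoder Y n M) : ℝ :=
  probE2 W C D + Real.exp (-((n : ℝ) * T)) * probE1 W C D

/-- The optimal (Forney) decision regions with threshold `T` for the known channel `W`. -/
def forneyDecoder (W : X → Y → ℝ) (T : ℝ) {n M : ℕ} (C : Fin M → Fin n → X) : Decoder Y n M :=
  fun m => open Classical in Finset.univ.filter fun y =>
    Real.exp ((n : ℝ) * T) * ∑ m' ∈ Finset.univ.erase m, channelN W (C m') y ≤ channelN W (C m) y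

/-- `K_n(ℛ, 𝒞) = max_θ Γ_θ(𝒞, ℛ) / exp (-n (ξ E_1(θ) + T))`, with `E θ` for `E_1(θ)`. -/
def regret [DecidableEq Y] (W : Θ → X → Y → ℝ) (E : Θ → EReal) (T ξ : ℝ) {n M : ℕ}
    (C : Fin M → Fin n → X) (D : Decoder Y n M) : ℝ≥0∞ :=
  ⨆ θ, ENNReal.ofReal (lagrangian (W θ) T C D) /
    EReal.exp (-((n : EReal) * ((ξ : EReal) * E θ + (T : EReal))))

/-- `K_n(𝒞) = min_ℛ K_n(ℛ, 𝒞)`, the value of the competitive minimax decoder. -/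
def minimaxRegret [DecidableEq Y] (W : Θ → X → Y → ℝ) (E : Θ → EReal) (T ξ : ℝ) (mode : Mode)
    {n M : ℕ} (C : Fin M → Fin n → X) : ℝ≥0∞ :=
  ⨅ D ∈ {D : Decoder Y n M | mode.Admits D}, regret W E T ξ C D

variable [Fintype X] [DecidableEq X] [DecidableEq Y]

/-- The codebooks of rate `R` all of whose codewords lie in the type class of `P`. In the fixed
composition ensemble the codewords are independent and uniform in the type class, that is, the
codebook is uniform in this set. -/
def codebooks (P : X → ℝ) (R : ℝ) (n : ℕ) : Finset (Fin (numMsg R n) → Fin n → X) :=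
  Fintype.piFinset fun _ => typeClass P n

/-- `n → ∞` along the blocklengths for which the type class of `P` is not empty. -/
def blocklengths (P : X → ℝ) : Filter ℕ :=
  Filter.atTop ⊓ Filter.principal {n | (typeClass P n).Nonempty}

/-- The ensemble average of `Pr {ℰ_1}` for Forney's decoder. -/
def avgForneyE1 (P : X → ℝ) (W : X → Y → ℝ) (R T : ℝ) (n : ℕ) : ℝ :=
  (∑ C ∈ codebooks P R n, probE1 W C (forneyDecoder W T C)) / ((codebooks P R n).card : ℝ)

/-- The operational exponent of Forney's decoder,
`-liminf (1/n) log (average of Pr {ℰ_1})`. -/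
def forneyExponent (P : X → ℝ) (W : X → Y → ℝ) (R T : ℝ) : EReal :=
  -Filter.liminf (fun n : ℕ => ENNReal.log (ENNReal.ofReal (avgForneyE1 P W R T n)) / (n : EReal))
    (blocklengths P)

/-- The ensemble average of `K_n(𝒞)`. -/
def avgRegret (P : X → ℝ) (W : Θ → X → Y → ℝ) (E : Θ → EReal) (R T ξ : ℝ) (mode : Mode)
    (n : ℕ) : ℝ≥0∞ :=
  (∑ C ∈ codebooks P R n, minimaxRegret W E T ξ mode C) / ((codebooks P R n).card : ℝ≥0∞)

/-- The fraction `ξ` of the exponents `E` is universally achievable: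
`limsup (1/n) log (average of K_n) ≤ 0`. -/
def Achievable (P : X → ℝ) (W : Θ → X → Y → ℝ) (E : Θ → EReal) (R T : ℝ) (mode : Mode)
    (ξ : ℝ) : Prop :=
  Filter.limsup (fun n : ℕ => ENNReal.log (avgRegret P W E R T ξ mode n) / (n : EReal))
    (blocklengths P) ≤ 0

/-- `ξ*(R, T)`: the maximal universally achievable fraction `0 ≤ ξ ≤ 1`. -/
def xiStar (P : X → ℝ) (W : Θ → X → Y → ℝ) (E : Θ → EReal) (R T : ℝ) (mode : Mode) : ℝ :=
  sSup {ξ | ξ ∈ Set.Icc (0 : ℝ) 1 ∧ Achievable P W E R T mode ξ}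

end Coding

end ErasureList

end

open ErasureList

/-!
The proof is a type-counting argument. Fix a channel output `y` and let `q'` and `q` be joint types
with `y`. The transmitted codeword has joint type `q'`, and the number `N` of other codewords of
joint type `q` is binomial with a mean of about `exp (n (R - I(q)))` (`expected_number_bounds`).

*Regret.* Since there are only polynomially many joint types, the minimax decoder may be replaced,
up to a polynomial factor, by the decoder that is optimal for the `envelope`, the function
`sup_θ exp (n (ξ E(θ) + T)) W_θ(y|x)` of the joint type of `(x, y)`
(`minimaxRegret_le`, `bestLagrangian_le_minimaxRegret`). For `T ≥ 0` this decoder has disjoint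
regions, which is why the two modes do not differ. Up to polynomial factors, its Lagrangian is a
sum of terms `min (N a) c`, and the average of such a term is `min (μ a) (min (μ c) c)` up to the
factor 2, where `μ` is the mean of `N` (`cavg_mul_min_le`, and `le_cavg_mul_min` by the second
moment). Hence `ξ` is achievable if and only if the exponent of this expression is nonpositive for
all pairs `(Q, Q')` of joint distributions. This is the pointwise condition `PairCond`
(`achievable_of_pairCond`, `pairCond_of_achievable`).

*Single-letter conditions.* `PairCond` is equivalent to the conjunction of `condQ` and `condL`. One
direction is a substitution (`cond_of_pairCond`). For the other one, the two conditions give the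
pointwise inequality at the pairs that satisfy the constraint of `setQ` or `setL`
(`ent_add_score_le`). For a violating pair outside of these sets, `Q'` is moved along a segment to
some distribution of larger entropy until the constraint holds with equality; the entropy is
concave and the violation persists, which is a contradiction (`crossing_absurd`,
`pairCond_of_cond`). The expected log-likelihood of some channels may be `-∞` inside the segment;
the assumption on the zeros of the channels makes these irrelevant for the supremum over `θ`
(`score_le_of_common_zeros`).
`PairCond` is closed in `ξ` and holds at `ξ = 0`, so that the largest `ξ` exists.

*Forney's decoder.* The exponent `E_1(R, T)` is the infimum of `cost` over the pairs with
`thresh ≤ T` (`exponent_le_cost`, `exists_cost_lt`). It is right-continuous in `T` by compactness,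
which gives the upper bound on the error probability; a joint type with a threshold above `T` would
need a number of codewords that exceeds its mean exponentially, an event of doubly exponentially
small probability (`avgForneyE1_le`). With left-continuity, pairs with a threshold strictly
below `T` approach the infimum, and they are approximated by joint types of all large blocklengths
(`eventually_exists_types_near`), which gives the lower bound (`le_avgForneyE1`).
-/

set_option linter.unusedSectionVars false

namespace ErasureList

/-! ### Entropy, information and divergence as continuous functions -/

section Information

variable {X Y ι : Type*} [Fintype X] [Fintype Y] [Fintype ι]

/-- The Shannon entropy `∑ -Q log Q`. -/
noncomputable def ent (Q : ι → ℝ) : ℝ := ∑ i, Real.negMulLog (Q i)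

/-- The real-valued version of `expLog`: with `Real.log 0 = 0` it is a continuous function of `Q`,
and it agrees with `expLog` as long as `Q` is supported where `W` is positive. -/
noncomputable def linLog (Q : X × Y → ℝ) (W : X → Y → ℝ) : ℝ := ∑ p, Q p * Real.log (W p.1 p.2)

/-- The joint distribution `Q` is supported on the transitions that `W` allows. -/
def SuppIn (Q : X × Y → ℝ) (W : X → Y → ℝ) : Prop := ∀ p, W p.1 p.2 = 0 → Q p = 0

lemma continuous_ent : Continuous (ent : (ι → ℝ) → ℝ) := by
  unfold ent; fun_prop

lemma continuous_margX : Continuous (margX : (X × Y → ℝ) → X → ℝ) := by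
  unfold margX; fun_prop

lemma continuous_margY : Continuous (margY : (X × Y → ℝ) → Y → ℝ) := by
  unfold margY; fun_prop

lemma continuous_linLog (W : X → Y → ℝ) : Continuous fun Q : X × Y → ℝ => linLog Q W := by
  unfold linLog; fun_prop

lemma sum_margX_mul (Q : X × Y → ℝ) (f : X → ℝ) : ∑ x, margX Q x * f x = ∑ p, Q p * f p.1 := by
  simp only [margX, Finset.sum_mul, Fintype.sum_prod_type]

lemma sum_margY_mul (Q : X × Y → ℝ) (f : Y → ℝ) : ∑ y, margY Q y * f y = ∑ p, Q p * f p.2 := by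
  simp only [margY, Finset.sum_mul, Fintype.sum_prod_type_right]

lemma ent_eq_neg_sum (Q : ι → ℝ) : ent Q = -∑ i, Q i * Real.log (Q i) := by
  simp [ent, Real.negMulLog]

lemma margX_nonneg {Q : X × Y → ℝ} (hQ : ∀ p, 0 ≤ Q p) (x : X) : 0 ≤ margX Q x :=
  Finset.sum_nonneg fun _ _ => hQ _

lemma margY_nonneg {Q : X × Y → ℝ} (hQ : ∀ p, 0 ≤ Q p) (y : Y) : 0 ≤ margY Q y :=
  Finset.sum_nonneg fun _ _ => hQ _

lemma le_margX {Q : X × Y → ℝ} (hQ : ∀ p, 0 ≤ Q p) (p : X × Y) : Q p ≤ margX Q p.1 :=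
  Finset.single_le_sum (f := fun y => Q (p.1, y)) (fun _ _ => hQ _) (Finset.mem_univ p.2)

lemma le_margY {Q : X × Y → ℝ} (hQ : ∀ p, 0 ≤ Q p) (p : X × Y) : Q p ≤ margY Q p.2 :=
  Finset.single_le_sum (f := fun x => Q (x, p.2)) (fun _ _ => hQ _) (Finset.mem_univ p.1)

lemma sum_margX (Q : X × Y → ℝ) : ∑ x, margX Q x = ∑ p, Q p := by
  simpa using sum_margX_mul Q fun _ => 1

lemma sum_margY (Q : X × Y → ℝ) : ∑ y, margY Q y = ∑ p, Q p := by
  simpa using sum_margY_mul Q fun _ => 1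

lemma margX_mem_stdSimplex {Q : X × Y → ℝ} (hQ : Q ∈ stdSimplex ℝ (X × Y)) :
    margX Q ∈ stdSimplex ℝ X :=
  ⟨margX_nonneg hQ.1, by rw [sum_margX, hQ.2]⟩

lemma margY_mem_stdSimplex {Q : X × Y → ℝ} (hQ : Q ∈ stdSimplex ℝ (X × Y)) :
    margY Q ∈ stdSimplex ℝ Y :=
  ⟨margY_nonneg hQ.1, by rw [sum_margY, hQ.2]⟩

/-- Gibbs' inequality. -/
lemma sum_mul_log_div_nonneg {Q V : ι → ℝ} (hQ : ∀ i, 0 ≤ Q i) (hV : ∀ i, 0 ≤ V i)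
    (hQV : ∀ i, V i = 0 → Q i = 0) (hsum : ∑ i, V i ≤ ∑ i, Q i) :
    0 ≤ ∑ i, Q i * Real.log (Q i / V i) := by
  have key : ∀ i, Q i - V i ≤ Q i * Real.log (Q i / V i) := by
    intro i
    rcases (hQ i).eq_or_lt with h | h
    · simp [← h, hV i]
    · have hv : 0 < V i := lt_of_le_of_ne (hV i) fun h0 => h.ne' (hQV i h0.symm)
      have h1 := Real.log_le_sub_one_of_pos (div_pos hv h)
      have h2 : Real.log (Q i / V i) = -Real.log (V i / Q i) := by
        rw [← Real.log_inv, inv_div]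
      rw [h2]
      have h3 : Q i * Real.log (V i / Q i) ≤ Q i * (V i / Q i - 1) :=
        mul_le_mul_of_nonneg_left h1 h.le
      have h4 : Q i * (V i / Q i - 1) = V i - Q i := by field_simp
      linarith
  have := Finset.sum_le_sum fun i (_ : i ∈ Finset.univ) => key i
  rw [Finset.sum_sub_distrib] at this
  linarith

lemma mutualInfo_eq {Q : X × Y → ℝ} (hQ : ∀ p, 0 ≤ Q p) :
    mutualInfo Q = ent (margX Q) + ent (margY Q) - ent Q := by
  have hterm : ∀ p : X × Y, Q p * Real.log (Q p / (margX Q p.1 * margY Q p.2)) =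
      Q p * Real.log (Q p) - Q p * Real.log (margX Q p.1) - Q p * Real.log (margY Q p.2) := by
    intro p
    rcases (hQ p).eq_or_lt with h | h
    · simp [← h]
    · have hx := h.trans_le (le_margX hQ p)
      have hy := h.trans_le (le_margY hQ p)
      rw [Real.log_div h.ne' (mul_pos hx hy).ne', Real.log_mul hx.ne' hy.ne']
      ring
  rw [mutualInfo, Finset.sum_congr rfl fun p _ => hterm p, Finset.sum_sub_distrib,
    Finset.sum_sub_distrib, ← sum_margX_mul Q fun x => Real.log (margX Q x),
    ← sum_margY_mul Q fun y => Real.log (margY Q y), ent_eq_neg_sum, ent_eq_neg_sum,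
    ent_eq_neg_sum]
  ring

lemma mutualInfo_nonneg {Q : X × Y → ℝ} (hQ : Q ∈ stdSimplex ℝ (X × Y)) : 0 ≤ mutualInfo Q := by
  refine sum_mul_log_div_nonneg (V := fun p : X × Y => margX Q p.1 * margY Q p.2) hQ.1
    (fun p => mul_nonneg (margX_nonneg hQ.1 _) (margY_nonneg hQ.1 _)) (fun p h => ?_) ?_
  · rcases mul_eq_zero.1 h with h | h
    · exact le_antisymm (h ▸ le_margX hQ.1 p) (hQ.1 p)
    · exact le_antisymm (h ▸ le_margY hQ.1 p) (hQ.1 p)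
  · rw [Fintype.sum_prod_type]
    simp only [← Finset.mul_sum, ← Finset.sum_mul]
    rw [sum_margX, sum_margY, hQ.2]
    norm_num

/-- On the set of nonnegative functions, the mutual information is this continuous function. -/
lemma continuous_mutualInfo_formula :
    Continuous fun Q : X × Y → ℝ => ent (margX Q) + ent (margY Q) - ent Q :=
  ((continuous_ent.comp continuous_margX).add (continuous_ent.comp continuous_margY)).sub
    continuous_ent

lemma coe_sum_ereal (s : Finset ι) (f : ι → ℝ) :
    ((∑ i ∈ s, f i : ℝ) : EReal) = ∑ i ∈ s, (f i : EReal) := by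
  classical
  induction s using Finset.induction_on with
  | empty => simp
  | insert a s ha ih => rw [Finset.sum_insert ha, Finset.sum_insert ha, EReal.coe_add, ih]

lemma sum_ereal_eq_bot {s : Finset ι} {f : ι → EReal} {i : ι} (hi : i ∈ s) (h : f i = ⊥) :
    ∑ i ∈ s, f i = ⊥ := by
  classical
  rw [← Finset.add_sum_erase s f hi, h, EReal.bot_add]

lemma expLog_eq {Q : X × Y → ℝ} {W : X → Y → ℝ} (hW : ∀ x y, 0 ≤ W x y) (h : SuppIn Q W) :
    expLog Q W = (linLog Q W : ℝ) := by
  rw [expLog, linLog, coe_sum_ereal]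
  refine Finset.sum_congr rfl fun p _ => ?_
  rcases (hW p.1 p.2).eq_or_lt with h0 | h0
  · simp [h p h0.symm]
  · rw [ENNReal.log_ofReal_of_pos h0, EReal.coe_mul]

lemma expLog_eq_bot {Q : X × Y → ℝ} {W : X → Y → ℝ} (hQ : ∀ p, 0 ≤ Q p) (h : ¬SuppIn Q W) :
    expLog Q W = ⊥ := by
  simp only [SuppIn, not_forall] at h
  obtain ⟨p, hW, hp⟩ := h
  refine sum_ereal_eq_bot (Finset.mem_univ p) ?_
  have : 0 < Q p := lt_of_le_of_ne (hQ p) (Ne.symm hp)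
  rw [hW]
  simp only [ENNReal.ofReal_zero, ENNReal.log_zero]
  exact EReal.coe_mul_bot_of_pos this

/-- The divergence `D(Q ‖ P × W)` of a joint distribution with first marginal `P`, supported where
`W` is positive. The formula only has the meaning of a divergence under these two assumptions, see
`kl_eq`. -/
noncomputable def div (P : X → ℝ) (W : X → Y → ℝ) (Q : X × Y → ℝ) : ℝ := ent P - ent Q - linLog Q W

lemma kl_eq {P : X → ℝ} {Q : X × Y → ℝ} {W : X → Y → ℝ} (hQ : ∀ p, 0 ≤ Q p)
    (hP : margX Q = P) (h : SuppIn Q W) :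
    kl Q (joint P W) = (div P W Q : ℝ) := by
  have hac : ∀ p, joint P W p = 0 → Q p = 0 := by
    intro p hp
    rcases mul_eq_zero.1 hp with h1 | h1
    · exact le_antisymm (h1 ▸ hP ▸ le_margX hQ p) (hQ p)
    · exact h p h1
  rw [kl, if_pos hac]
  congr 1
  have hterm : ∀ p : X × Y, Q p * Real.log (Q p / joint P W p) =
      Q p * Real.log (Q p) - Q p * Real.log (P p.1) - Q p * Real.log (W p.1 p.2) := by
    intro p
    rcases (hQ p).eq_or_lt with h0 | h0
    · simp [← h0]
    · have hj : joint P W p ≠ 0 := fun h' => h0.ne' (hac p h')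
      rw [Real.log_div h0.ne' hj, joint, Real.log_mul (left_ne_zero_of_mul hj)
        (right_ne_zero_of_mul hj)]
      ring
  rw [Finset.sum_congr rfl fun p _ => hterm p, Finset.sum_sub_distrib,
    Finset.sum_sub_distrib, ← sum_margX_mul Q fun x => Real.log (P x), hP, div, linLog,
    ent_eq_neg_sum, ent_eq_neg_sum]
  ring

lemma kl_eq_top {P : X → ℝ} {Q : X × Y → ℝ} {W : X → Y → ℝ} (h : ¬SuppIn Q W) :
    kl Q (joint P W) = ⊤ := by
  rw [kl, if_neg]
  intro h'
  exact h fun p hp => h' p (by simp [joint, hp])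

lemma sum_joint {P : X → ℝ} (hP : P ∈ stdSimplex ℝ X) {W : X → Y → ℝ}
    (hW : ∀ x, W x ∈ stdSimplex ℝ Y) : ∑ p, joint P W p = 1 := by
  simp only [joint, Fintype.sum_prod_type, ← Finset.mul_sum, (hW _).2, mul_one, hP.2]

lemma kl_nonneg {P : X → ℝ} {Q : X × Y → ℝ} {W : X → Y → ℝ} (hP : P ∈ stdSimplex ℝ X)
    (hQ : Q ∈ stdSimplex ℝ (X × Y)) (hW : ∀ x, W x ∈ stdSimplex ℝ Y) :
    0 ≤ kl Q (joint P W) := by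
  rw [kl]
  split_ifs with h
  · exact_mod_cast sum_mul_log_div_nonneg hQ.1
      (fun p => mul_nonneg (hP.1 p.1) ((hW p.1).1 p.2)) h ((sum_joint hP hW).le.trans hQ.2.ge)
  · exact le_top

lemma div_nonneg {P : X → ℝ} {Q : X × Y → ℝ} {W : X → Y → ℝ} (hQ : Q ∈ stdSimplex ℝ (X × Y))
    (hW : ∀ x, W x ∈ stdSimplex ℝ Y) (hP : margX Q = P) (h : SuppIn Q W) : 0 ≤ div P W Q := by
  have h1 := kl_nonneg (hP ▸ margX_mem_stdSimplex hQ) hQ hW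
  rw [kl_eq hQ.1 hP h] at h1
  exact_mod_cast h1

lemma continuous_div (P : X → ℝ) (W : X → Y → ℝ) : Continuous (div P W) :=
  (continuous_const.sub continuous_ent).sub (continuous_linLog W)

lemma linLog_nonpos {Q : X × Y → ℝ} {W : X → Y → ℝ} (hQ : ∀ p, 0 ≤ Q p)
    (hW : ∀ x, W x ∈ stdSimplex ℝ Y) : linLog Q W ≤ 0 :=
  Finset.sum_nonpos fun p _ => mul_nonpos_of_nonneg_of_nonpos (hQ p)
    (Real.log_nonpos ((hW p.1).1 p.2) ((mem_Icc_of_mem_stdSimplex (hW p.1) p.2).2))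

lemma concaveOn_ent : ConcaveOn ℝ {Q : ι → ℝ | ∀ i, 0 ≤ Q i} (ent : (ι → ℝ) → ℝ) := by
  refine ⟨fun Q hQ Q' hQ' a b ha hb _ i => ?_, fun Q hQ Q' hQ' a b ha hb hab => ?_⟩
  · exact add_nonneg (mul_nonneg ha (hQ i)) (mul_nonneg hb (hQ' i))
  · simp only [ent, smul_eq_mul, Finset.mul_sum, ← Finset.sum_add_distrib]
    exact Finset.sum_le_sum fun i _ => Real.concaveOn_negMulLog.2 (hQ i) (hQ' i) ha hb hab

lemma margX_prod {P : X → ℝ} {S : Y → ℝ} (hS : ∑ y, S y = 1) :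
    margX (fun p : X × Y => P p.1 * S p.2) = P := by
  funext x; simp [margX, ← Finset.mul_sum, hS]

lemma margY_prod {P : X → ℝ} {S : Y → ℝ} (hP : ∑ x, P x = 1) :
    margY (fun p : X × Y => P p.1 * S p.2) = S := by
  funext x; simp [margY, ← Finset.sum_mul, hP]

lemma prod_mem_stdSimplex {P : X → ℝ} {S : Y → ℝ} (hP : P ∈ stdSimplex ℝ X)
    (hS : S ∈ stdSimplex ℝ Y) : (fun p : X × Y => P p.1 * S p.2) ∈ stdSimplex ℝ (X × Y) :=
  ⟨fun p => mul_nonneg (hP.1 _) (hS.1 _), by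
    simp only [Fintype.sum_prod_type, ← Finset.mul_sum, hS.2, mul_one, hP.2]⟩

lemma ent_prod {P : X → ℝ} {S : Y → ℝ} (hP : P ∈ stdSimplex ℝ X) (hS : S ∈ stdSimplex ℝ Y) :
    ent (fun p : X × Y => P p.1 * S p.2) = ent P + ent S := by
  simp only [ent, Fintype.sum_prod_type, Real.negMulLog_mul, Finset.sum_add_distrib,
    ← Finset.mul_sum, ← Finset.sum_mul, hP.2, hS.2, one_mul]

end Information

/-! ### A pointwise form of the two single-letter conditions -/

section Conditions

variable {X Y Θ : Type*} [Fintype X] [Fintype Y]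

/-- The expression `ξ E(θ) + T + E_Q log W_θ`, of which `metric` is the supremum over `θ`. -/
noncomputable def score (W : Θ → X → Y → ℝ) (e : Θ → ℝ) (T ξ : ℝ) (θ : Θ) (Q : X × Y → ℝ) : ℝ :=
  ξ * e θ + T + linLog Q (W θ)

/-- The conjunction of `condQ` and `condL` without the side conditions that define `setQ` and
`setL`, and with the suprema in `metric` resolved. The left-hand side is the growth rate of the
contribution to the average regret of the codewords whose joint type with the channel output is
`Q'` (the transmitted one) and `Q` (its competitors). -/
def PairCond (P : X → ℝ) (W : Θ → X → Y → ℝ) (e : Θ → ℝ) (R T ξ : ℝ) : Prop :=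
  ∀ Q Q', (Q, Q') ∈ pairs P → ∀ θ₁ θ₂, SuppIn Q (W θ₁) → SuppIn Q' (W θ₂) →
    ent Q' - ent P + min (R - mutualInfo Q + score W e T ξ θ₁ Q)
      (score W e T ξ θ₂ Q' - T - max (mutualInfo Q - R) 0) ≤ 0

variable {P : X → ℝ} {W : Θ → X → Y → ℝ} {e : Θ → ℝ} {R T ξ : ℝ}

lemma coe_score_eq (hW : ∀ θ x, W θ x ∈ stdSimplex ℝ Y) {Q : X × Y → ℝ} {θ : Θ}
    (h : SuppIn Q (W θ)) : (score W e T ξ θ Q : EReal) =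
      (ξ : EReal) * (e θ : EReal) + (T : EReal) + expLog Q (W θ) := by
  rw [expLog_eq (fun x y => (hW θ x).1 y) h, score]
  push_cast
  rfl

lemma score_le_metric (hW : ∀ θ x, W θ x ∈ stdSimplex ℝ Y) {Q : X × Y → ℝ} {θ : Θ}
    (h : SuppIn Q (W θ)) :
    (score W e T ξ θ Q : EReal) ≤ metric W (fun θ => (e θ : EReal)) T ξ Q := by
  rw [coe_score_eq hW h]
  exact le_iSup (fun θ => (ξ : EReal) * (e θ : EReal) + (T : EReal) + expLog Q (W θ)) θ

lemma metric_le_iff (hW : ∀ θ x, W θ x ∈ stdSimplex ℝ Y) {Q : X × Y → ℝ} (hQ : ∀ p, 0 ≤ Q p)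
    {c : EReal} : metric W (fun θ => (e θ : EReal)) T ξ Q ≤ c ↔
      ∀ θ, SuppIn Q (W θ) → (score W e T ξ θ Q : EReal) ≤ c := by
  refine ⟨fun h θ hθ => (score_le_metric hW hθ).trans h, fun h => iSup_le fun θ => ?_⟩
  by_cases hθ : SuppIn Q (W θ)
  · rw [← coe_score_eq hW hθ]; exact h θ hθ
  · rw [expLog_eq_bot hQ hθ, EReal.add_bot]; exact bot_le

lemma lt_metric_iff (hW : ∀ θ x, W θ x ∈ stdSimplex ℝ Y) {Q : X × Y → ℝ} (hQ : ∀ p, 0 ≤ Q p)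
    {c : EReal} : c < metric W (fun θ => (e θ : EReal)) T ξ Q ↔
      ∃ θ, SuppIn Q (W θ) ∧ c < (score W e T ξ θ Q : EReal) := by
  rw [← not_le, metric_le_iff hW hQ]
  simp only [not_forall, not_le, exists_prop]

lemma exists_metric_eq_coe (hW : ∀ θ x, W θ x ∈ stdSimplex ℝ Y) {Q : X × Y → ℝ} {K : ℝ}
    (hK : ∀ θ, score W e T ξ θ Q ≤ K) (hQ : ∀ p, 0 ≤ Q p) {θ : Θ} (hθ : SuppIn Q (W θ)) :
    ∃ c : ℝ, metric W (fun θ => (e θ : EReal)) T ξ Q = c := by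
  refine ⟨_, (EReal.coe_toReal (fun h => ?_) fun h => ?_).symm⟩
  · have : metric W (fun θ => (e θ : EReal)) T ξ Q ≤ (K : EReal) :=
      (metric_le_iff hW hQ).2 fun θ _ => EReal.coe_le_coe_iff.2 (hK θ)
    rw [h] at this
    exact absurd this (not_le.2 (EReal.coe_lt_top K))
  · have := score_le_metric (e := e) (T := T) (ξ := ξ) hW hθ
    rw [h] at this
    exact absurd this (not_le.2 (EReal.bot_lt_coe _))

lemma iSup_sub_nonpos_iff {f g : Θ → EReal} (hf : ∀ θ, ∃ r : ℝ, f θ = r) :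
    (⨆ θ, (f θ - g θ)) ≤ 0 ↔ ∀ θ, f θ ≤ g θ := by
  rw [iSup_le_iff]
  refine forall_congr' fun θ => ?_
  obtain ⟨r, hr⟩ := hf θ
  rw [hr]
  exact EReal.sub_nonpos

lemma condQ_iff : condQ P W (fun θ => (e θ : EReal)) R T ξ ↔
    ∀ θ, ∀ q ∈ setQ P W (fun θ => (e θ : EReal)) R T ξ, ((ξ * e θ : ℝ) : EReal) ≤
      kl q.2 (joint P (W θ)) + (mutualInfo q.1 : EReal) - (R : EReal) := by
  rw [condQ, iSup_sub_nonpos_iff fun θ => ⟨ξ * e θ, (EReal.coe_mul _ _).symm⟩]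
  simp only [le_iInf_iff, EReal.coe_mul]

lemma condL_iff : condL P W (fun θ => (e θ : EReal)) R T ξ ↔
    ∀ θ, ∀ q ∈ setL P W (fun θ => (e θ : EReal)) R T ξ, ((ξ * e θ : ℝ) : EReal) ≤
      kl q (joint P (W θ)) := by
  rw [condL, iSup_sub_nonpos_iff fun θ => ⟨ξ * e θ, (EReal.coe_mul _ _).symm⟩]
  simp only [le_iInf_iff, EReal.coe_mul]

/-- Under the conditions, the pairs with a small enough metric of `Q'` satisfy the pointwise
inequality: they belong to `setQ` or `setL`. -/
lemma ent_add_score_le (hW : ∀ θ x, W θ x ∈ stdSimplex ℝ Y)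
    (hcQ : condQ P W (fun θ => (e θ : EReal)) R T ξ)
    (hcL : condL P W (fun θ => (e θ : EReal)) R T ξ) {Q Q' : X × Y → ℝ} (hp : (Q, Q') ∈ pairs P)
    {c : ℝ} (hc : (c : EReal) ≤ metric W (fun θ => (e θ : EReal)) T ξ Q)
    (h : ∀ θ, SuppIn Q' (W θ) →
      score W e T ξ θ Q' - T - max (mutualInfo Q - R) 0 ≤ R - mutualInfo Q + c)
    {θ : Θ} (hθ : SuppIn Q' (W θ)) :
    ent Q' - ent P + (score W e T ξ θ Q' - T - max (mutualInfo Q - R) 0) ≤ 0 := by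
  have hkl := kl_eq (P := P) hp.2.1.1 hp.2.2.2.1 hθ
  rcases le_total R (mutualInfo Q) with hI | hI
  · have hmem : (Q, Q') ∈ setQ P W (fun θ => (e θ : EReal)) R T ξ := by
      refine ⟨hp, hI, ?_⟩
      have h1 : metric W (fun θ => (e θ : EReal)) T ξ Q' ≤ ((c + T : ℝ) : EReal) := by
        rw [metric_le_iff hW hp.2.1.1]
        intro θ' hθ'
        have := h θ' hθ'
        rw [max_eq_left (by linarith)] at this
        exact_mod_cast (by linarith)
      calc gap W (fun θ => (e θ : EReal)) T ξ Q Q'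
          ≤ ((c + T : ℝ) : EReal) - (c : EReal) - (T : EReal) :=
            EReal.sub_le_sub (EReal.sub_le_sub h1 hc) le_rfl
        _ = ((c + T - c - T : ℝ) : EReal) := by push_cast; rfl
        _ ≤ 0 := by norm_num
    have h2 := condQ_iff.1 hcQ θ _ hmem
    simp only [hkl] at h2
    have h3 : ξ * e θ ≤ div P (W θ) Q' + mutualInfo Q - R := by exact_mod_cast h2
    rw [max_eq_left (by linarith)]
    unfold div at h3
    unfold score
    linarith
  · have hmem : Q' ∈ setL P W (fun θ => (e θ : EReal)) R T ξ := by
      refine ⟨hp.2.1, ?_⟩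
      have h1 : metric W (fun θ => (e θ : EReal)) T ξ Q' ≤
          ((R + T + (c - mutualInfo Q) : ℝ) : EReal) := by
        rw [metric_le_iff hW hp.2.1.1]
        intro θ' hθ'
        have := h θ' hθ'
        rw [max_eq_right (by linarith)] at this
        exact_mod_cast (by linarith)
      refine h1.trans ?_
      push_cast
      refine add_le_add le_rfl (le_trans (EReal.sub_le_sub hc le_rfl) ?_)
      exact le_iSup₂_of_le (f := fun (q : X × Y → ℝ)
        (_ : q ∈ {q : X × Y → ℝ | (q, Q') ∈ pairs P ∧ mutualInfo q ≤ R}) =>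
        metric W (fun θ => (e θ : EReal)) T ξ q - (mutualInfo q : EReal)) Q ⟨hp, hI⟩ le_rfl
    have h2 := condL_iff.1 hcL θ _ hmem
    rw [hkl] at h2
    have h3 : ξ * e θ ≤ div P (W θ) Q' := by exact_mod_cast h2
    rw [max_eq_right (by linarith)]
    unfold div at h3
    unfold score
    linarith

/-- In a family of affine functions on `[0, 1]` that are bounded above at `0`, all at most `w` at
`1`, and not all at most `w` at `0`, the supremum takes the value `w`, up to `ε`. The point is the
supremum of the zeros of the functions minus `w`. -/
lemma exists_crossing {ι : Type*} {a b : ι → ℝ} {K w ε : ℝ} (ha : ∀ i, a i ≤ K)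
    (hb : ∀ i, b i ≤ w) (h : ∃ i, w < a i) (hε : 0 < ε) :
    ∃ t : ℝ, 0 ≤ t ∧ t ≤ 1 ∧ (∀ i, (1 - t) * a i + t * b i ≤ w) ∧
      ∃ i, w - ε ≤ (1 - t) * a i + t * b i := by
  obtain ⟨i₀, hi₀⟩ := h
  let r : ι → ℝ := fun i => (a i - w) / (a i - b i)
  have hr : ∀ i, w < a i → 0 < r i ∧ r i ≤ 1 ∧ r i * (a i - b i) = a i - w := by
    intro i hi
    have h1 : 0 < a i - b i := by linarith [hb i]
    exact ⟨div_pos (by linarith) h1, (div_le_one h1).2 (by linarith [hb i]),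
      div_mul_cancel₀ _ h1.ne'⟩
  let S : Set ℝ := r '' {i | w < a i}
  have hS : BddAbove S := ⟨1, by rintro _ ⟨i, hi, rfl⟩; exact (hr i hi).2.1⟩
  have hmem : ∀ i, w < a i → r i ∈ S := fun i hi => ⟨i, hi, rfl⟩
  have hle : ∀ i, w < a i → r i ≤ sSup S := fun i hi => le_csSup hS (hmem i hi)
  have ht0 : 0 < sSup S := (hr i₀ hi₀).1.trans_le (hle i₀ hi₀)
  have ht1 : sSup S ≤ 1 := csSup_le ⟨_, hmem i₀ hi₀⟩ (by rintro _ ⟨i, hi, rfl⟩; exact (hr i hi).2.1)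
  refine ⟨sSup S, ht0.le, ht1, fun i => ?_, ?_⟩
  · rcases lt_or_ge w (a i) with hi | hi
    · have h1 := mul_le_mul_of_nonneg_right (hle i hi) (by linarith [hb i] : 0 ≤ a i - b i)
      rw [(hr i hi).2.2] at h1
      linarith
    · nlinarith [mul_nonneg (sub_nonneg.2 ht1) (sub_nonneg.2 hi),
        mul_nonneg ht0.le (sub_nonneg.2 (hb i))]
  · have hK : 0 < K - w := by linarith [ha i₀]
    set η : ℝ := ε * (sSup S / 2) / (K - w) with hη
    have hη0 : 0 < η := by positivity
    obtain ⟨_, ⟨i, hi, rfl⟩, hlt⟩ := exists_lt_of_lt_csSup ⟨_, hmem i₀ hi₀⟩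
      (max_lt (by linarith : sSup S - η < sSup S) (by linarith : sSup S / 2 < sSup S))
    have h1 : sSup S - η < r i := (le_max_left _ _).trans_lt hlt
    have h2 : sSup S / 2 < r i := (le_max_right _ _).trans_lt hlt
    obtain ⟨h3, -, h4⟩ := hr i hi
    have hi' : w < a i := hi
    refine ⟨i, ?_⟩
    have h5 : 0 < a i - b i := by linarith [hb i]
    have h6 : sSup S / 2 * (a i - b i) ≤ K - w := by
      calc sSup S / 2 * (a i - b i) ≤ r i * (a i - b i) :=
            mul_le_mul_of_nonneg_right h2.le h5.le
        _ ≤ K - w := by rw [h4]; linarith [ha i]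
    have h7 : (sSup S - r i) * (a i - b i) ≤ ε := by
      calc (sSup S - r i) * (a i - b i) ≤ η * (a i - b i) :=
            mul_le_mul_of_nonneg_right (by linarith) h5.le
        _ = ε / (K - w) * (sSup S / 2 * (a i - b i)) := by rw [hη]; ring
        _ ≤ ε / (K - w) * (K - w) := mul_le_mul_of_nonneg_left h6 (by positivity)
        _ = ε := div_mul_cancel₀ _ hK.ne'
    linarith

/-- Only the channels whose zeros are common to the whole family matter for the value of
`metric`. -/
lemma score_le_of_common_zeros
    (hsupp : ∀ θ, ∀ ε : ℝ, 0 < ε → ∃ θ', (∀ x y, W θ' x y = 0 → ∀ θ'', W θ'' x y = 0) ∧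
      (∀ x y, |W θ' x y - W θ x y| < ε) ∧ e θ ≤ e θ' + ε) (hξ : 0 ≤ ξ) {Q : X × Y → ℝ} {w : ℝ}
    (h : ∀ θ', (∀ x y, W θ' x y = 0 → ∀ θ'', W θ'' x y = 0) → score W e T ξ θ' Q ≤ w)
    {θ : Θ} (hθ : SuppIn Q (W θ)) : score W e T ξ θ Q ≤ w := by
  refine le_of_forall_pos_le_add fun δ hδ => ?_
  have hcont : ContinuousAt (fun V : X → Y → ℝ => linLog Q V) (W θ) := by
    refine tendsto_finsetSum _ fun p _ => ?_
    by_cases hp : Q p = 0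
    · simp only [hp, zero_mul]; exact tendsto_const_nhds
    · refine tendsto_const_nhds.mul ?_
      have h1 : W θ p.1 p.2 ≠ 0 := fun h0 => hp (hθ p h0)
      have h2 : ContinuousAt (fun V : X → Y → ℝ => V p.1 p.2) (W θ) :=
        ((continuous_apply p.2).comp (continuous_apply p.1)).continuousAt
      exact (Real.continuousAt_log h1).comp_of_eq h2 rfl
  obtain ⟨ε, hε, hdist⟩ := Metric.continuousAt_iff.1 hcont (δ / 2) (by positivity)
  set ε' : ℝ := min ε (δ / (2 * (ξ + 1))) with hε'
  have hξ1 : 0 < ξ + 1 := by linarith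
  have hε'0 : 0 < ε' := lt_min hε (by positivity)
  obtain ⟨θ', h0, h1, h2⟩ := hsupp θ ε' hε'0
  have h3 : dist (W θ') (W θ) < ε := by
    refine (dist_pi_lt_iff hε).2 fun x => (dist_pi_lt_iff hε).2 fun y => ?_
    exact (h1 x y).trans_le (min_le_left _ _)
  have h4 := (abs_lt.1 (hdist h3)).1
  have h5 := h θ' h0
  have h6 : ξ * e θ ≤ ξ * e θ' + δ / 2 := by
    have : ξ * ε' ≤ δ / 2 := by
      calc ξ * ε' ≤ (ξ + 1) * (δ / (2 * (ξ + 1))) :=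
            mul_le_mul (by linarith) (min_le_right _ _) hε'0.le hξ1.le
        _ = δ / 2 := by field_simp
    nlinarith [mul_le_mul_of_nonneg_left h2 hξ]
  unfold score at h5 ⊢
  linarith

lemma score_segment (θ : Θ) (Q Q' : X × Y → ℝ) (t : ℝ) :
    score W e T ξ θ ((1 - t) • Q + t • Q') =
      (1 - t) * score W e T ξ θ Q + t * score W e T ξ θ Q' := by
  have : linLog ((1 - t) • Q + t • Q') (W θ) =
      (1 - t) * linLog Q (W θ) + t * linLog Q' (W θ) := by
    simp only [linLog, Finset.mul_sum, ← Finset.sum_add_distrib, Pi.add_apply, Pi.smul_apply,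
      smul_eq_mul]
    exact Finset.sum_congr rfl fun p _ => by ring
  rw [score, this, score, score]
  ring

lemma pairs_segment {Q Q' S : X × Y → ℝ} (h : (Q, Q') ∈ pairs P) (h' : (Q, S) ∈ pairs P) {t : ℝ}
    (h0 : 0 ≤ t) (h1 : t ≤ 1) : (Q, (1 - t) • Q' + t • S) ∈ pairs P := by
  refine ⟨h.1, convex_stdSimplex ℝ _ h.2.1 h'.2.1 (by linarith) h0 (by ring), h.2.2.1, ?_, ?_⟩
  · have : margX ((1 - t) • Q' + t • S) = (1 - t) • margX Q' + t • margX S := by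
      funext x; simp [margX, Finset.sum_add_distrib, Finset.mul_sum]
    have e1 : margX Q' = P := h.2.2.2.1
    have e2 : margX S = P := h'.2.2.2.1
    simp only [this, e1, e2, ← add_smul]
    simp
  · have : margY ((1 - t) • Q' + t • S) = (1 - t) • margY Q' + t • margY S := by
      funext x; simp [margY, Finset.sum_add_distrib, Finset.mul_sum]
    have e1 : margY Q = margY Q' := h.2.2.2.2
    have e2 : margY Q = margY S := h'.2.2.2.2
    simp only [this, ← e1, ← e2, ← add_smul]
    simp

lemma pairs_self_right {Q Q' : X × Y → ℝ} (h : (Q, Q') ∈ pairs P) : (Q', Q') ∈ pairs P :=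
  ⟨h.2.1, h.2.1, h.2.2.2.1, h.2.2.2.1, rfl⟩

lemma pairs_self_left {Q Q' : X × Y → ℝ} (h : (Q, Q') ∈ pairs P) : (Q, Q) ∈ pairs P :=
  ⟨h.1, h.1, h.2.2.1, h.2.2.1, rfl⟩

lemma mutualInfo_pairs {Q Q' : X × Y → ℝ} (h : (Q, Q') ∈ pairs P) :
    mutualInfo Q = ent P + ent (margY Q') - ent Q ∧
      mutualInfo Q' = ent P + ent (margY Q') - ent Q' := by
  have e1 : margX Q = P := h.2.2.1
  have e2 : margX Q' = P := h.2.2.2.1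
  have e3 : margY Q = margY Q' := h.2.2.2.2
  exact ⟨by rw [mutualInfo_eq h.1.1, e1, e3], by rw [mutualInfo_eq h.2.1.1, e2]⟩

/-- The violation of the pointwise inequality is excluded if `Q'` can be joined with some `S` of
larger entropy and small metric: the conditions apply where the metric crosses the
critical value on the way from `Q'` to `S`. -/
lemma crossing_absurd (hW : ∀ θ x, W θ x ∈ stdSimplex ℝ Y)
    (hsupp : ∀ θ, ∀ ε : ℝ, 0 < ε → ∃ θ', (∀ x y, W θ' x y = 0 → ∀ θ'', W θ'' x y = 0) ∧
      (∀ x y, |W θ' x y - W θ x y| < ε) ∧ e θ ≤ e θ' + ε) (hξ : 0 ≤ ξ)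
    {K : ℝ} (hK : ∀ θ, ∀ Q : X × Y → ℝ, (∀ p, 0 ≤ Q p) → score W e T ξ θ Q ≤ K)
    (hcQ : condQ P W (fun θ => (e θ : EReal)) R T ξ)
    (hcL : condL P W (fun θ => (e θ : EReal)) R T ξ) {Q Q' S : X × Y → ℝ}
    (hp : (Q, Q') ∈ pairs P) (hpS : (Q, S) ∈ pairs P)
    (hQ' : ∀ p, (∀ θ, W θ p.1 p.2 = 0) → Q' p = 0) (hS : ∀ p, (∀ θ, W θ p.1 p.2 = 0) → S p = 0)
    {c : ℝ} (hc : (c : EReal) ≤ metric W (fun θ => (e θ : EReal)) T ξ Q)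
    (hpos : 0 < ent Q' - ent P + (R - mutualInfo Q + c)) (hent : ent Q' ≤ ent S)
    (hlow : ∀ θ, SuppIn S (W θ) →
      score W e T ξ θ S - T - max (mutualInfo Q - R) 0 ≤ R - mutualInfo Q + c)
    {θ : Θ} (hθ : SuppIn Q' (W θ))
    (hhigh : R - mutualInfo Q + c < score W e T ξ θ Q' - T - max (mutualInfo Q - R) 0) :
    False := by
  set w := R - mutualInfo Q + c + T + max (mutualInfo Q - R) 0 with hw
  -- All the channels in `Θ₀` have finite scores at `Q'` and `S`, so that these are affine on the
  -- whole segment.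
  let Θ₀ := {θ : Θ // ∀ x y, W θ x y = 0 → ∀ θ'', W θ'' x y = 0}
  have hsuppQ' : ∀ θ : Θ₀, SuppIn Q' (W θ.1) := fun θ p h0 => hQ' p (θ.2 _ _ h0)
  have hsuppS : ∀ θ : Θ₀, SuppIn S (W θ.1) := fun θ p h0 => hS p (θ.2 _ _ h0)
  have hex : ∃ i : Θ₀, w < score W e T ξ i.1 Q' := by
    by_contra hcon
    push Not at hcon
    have := score_le_of_common_zeros hsupp hξ (fun θ' h' => hcon ⟨θ', h'⟩) hθ
    linarith
  obtain ⟨t, ht0, ht1, hle, i, hi⟩ := exists_crossing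
    (a := fun i : Θ₀ => score W e T ξ i.1 Q') (b := fun i : Θ₀ => score W e T ξ i.1 S)
    (K := K) (fun i => hK _ _ hp.2.1.1) (fun i => by have := hlow i.1 (hsuppS i); linarith) hex
    (half_pos hpos)
  have hpt := pairs_segment hp hpS ht0 ht1
  have hsuppt : SuppIn ((1 - t) • Q' + t • S) (W i.1) := fun p h0 => by
    simp [hsuppQ' i p h0, hsuppS i p h0]
  have h1 := ent_add_score_le hW hcQ hcL hpt hc (fun θ hθ => by
    have := score_le_of_common_zeros hsupp hξ (w := w) (fun θ' h' => by
      rw [score_segment]; exact hle ⟨θ', h'⟩) hθ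
    linarith) hsuppt
  rw [score_segment] at h1
  have h2 : ent Q' ≤ ent ((1 - t) • Q' + t • S) := by
    have := concaveOn_ent.2 (x := Q') (y := S) hp.2.1.1 hpS.2.1.1 (sub_nonneg.2 ht1) ht0 (by ring)
    simp only [smul_eq_mul] at this
    nlinarith
  linarith

/-- The single-letter conditions imply the pointwise inequality. A pair that violates it must have
a metric of `Q'` above the critical value. For `T ≥ 0` one then moves `Q'` towards `Q`, or, if `Q`
has the larger mutual information, replaces `Q` by `Q'`. For `T < 0` one moves `Q'` towards the
product of its marginals. -/
theorem pairCond_of_cond (hW : ∀ θ x, W θ x ∈ stdSimplex ℝ Y)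
    (hT : 0 ≤ T ∨ (-R ≤ T ∧ ∃ θ, ∀ x y, 0 < W θ x y))
    (hsupp : ∀ θ, ∀ ε : ℝ, 0 < ε → ∃ θ', (∀ x y, W θ' x y = 0 → ∀ θ'', W θ'' x y = 0) ∧
      (∀ x y, |W θ' x y - W θ x y| < ε) ∧ e θ ≤ e θ' + ε) (hξ : 0 ≤ ξ)
    {B : ℝ} (hB : ∀ θ, e θ ≤ B) (hR : 0 < R)
    (hcQ : condQ P W (fun θ => (e θ : EReal)) R T ξ)
    (hcL : condL P W (fun θ => (e θ : EReal)) R T ξ) : PairCond P W e R T ξ := by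
  have hK : ∀ θ, ∀ Q : X × Y → ℝ, (∀ p, 0 ≤ Q p) → score W e T ξ θ Q ≤ ξ * B + T :=
    fun θ Q hQ => by
      have h1 := linLog_nonpos hQ (hW θ)
      have h2 := mul_le_mul_of_nonneg_left (hB θ) hξ
      unfold score
      linarith
  intro Q Q' hp θ₁ θ₂ h₁ h₂
  by_contra hcon
  push Not at hcon
  obtain ⟨c, hc⟩ := exists_metric_eq_coe hW (fun θ => hK θ Q hp.1.1) hp.1.1 h₁
  have hscoreQ : ∀ θ, SuppIn Q (W θ) → score W e T ξ θ Q ≤ c := fun θ hθ => by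
    have := score_le_metric (e := e) (T := T) (ξ := ξ) hW hθ
    rw [hc] at this
    exact_mod_cast this
  obtain ⟨hIQ, hIQ'⟩ := mutualInfo_pairs hp
  set I := mutualInfo Q with hI
  set J := max (I - R) 0 with hJ
  have hJ1 : I - R ≤ J := le_max_left _ _
  have hJ0 : 0 ≤ J := le_max_right _ _
  have hpos : 0 < ent Q' - ent P + (R - I + c) := by
    have := min_le_left (R - I + score W e T ξ θ₁ Q) (score W e T ξ θ₂ Q' - T - J)
    have := hscoreQ θ₁ h₁
    linarith
  have hpos2 : 0 < ent Q' - ent P + (score W e T ξ θ₂ Q' - T - J) := by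
    have := min_le_right (R - I + score W e T ξ θ₁ Q) (score W e T ξ θ₂ Q' - T - J)
    linarith
  by_cases hall : ∀ θ, SuppIn Q' (W θ) → score W e T ξ θ Q' - T - J ≤ R - I + c
  · have := ent_add_score_le hW hcQ hcL hp hc.ge hall h₂
    linarith
  · push Not at hall
    obtain ⟨θ, hθ, hhigh⟩ := hall
    have hzero : ∀ {S : X × Y → ℝ} {θ}, SuppIn S (W θ) →
        ∀ p, (∀ θ, W θ p.1 p.2 = 0) → S p = 0 := fun hS p h0 => hS p (h0 _)
    rcases hT with hT | ⟨hT, θ₀, hθ₀⟩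
    · rcases le_or_gt I (mutualInfo Q') with hle | hgt
      -- Here `Q` has the larger entropy, and `T ≥ 0` makes its own metric subcritical.
      · refine crossing_absurd hW hsupp hξ hK hcQ hcL hp (pairs_self_left hp) (hzero hθ)
          (hzero h₁) hc.ge hpos (by linarith) (fun θ' hθ' => ?_) hθ hhigh
        have := hscoreQ θ' hθ'
        linarith
      · obtain ⟨c', hc'⟩ := exists_metric_eq_coe hW (fun θ => hK θ Q' hp.2.1.1) hp.2.1.1 h₂
        have h1 := ent_add_score_le hW hcQ hcL (pairs_self_right hp) hc'.ge (fun θ' hθ' => by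
          have h2 := score_le_metric (e := e) (T := T) (ξ := ξ) hW hθ'
          rw [hc'] at h2
          have h3 := EReal.coe_le_coe_iff.1 h2
          have := le_max_left (mutualInfo Q' - R) 0
          linarith) h₂
        have : max (mutualInfo Q' - R) 0 ≤ J := max_le_max (by linarith) le_rfl
        linarith
    -- The product of the marginals has maximal entropy, and it is an admissible end point of the
    -- segment since some channel has no zeros.
    · set S : X × Y → ℝ := fun p => P p.1 * margY Q' p.2 with hS
      have hPs : P ∈ stdSimplex ℝ X := by
        have := margX_mem_stdSimplex hp.1
        rwa [show margX Q = P from hp.2.2.1] at this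
      have hYs := margY_mem_stdSimplex hp.2.1
      have hpS : (Q, S) ∈ pairs P :=
        ⟨hp.1, prod_mem_stdSimplex hPs hYs, hp.2.2.1, margX_prod hYs.2, by
          rw [show margY Q = margY Q' from hp.2.2.2.2]; exact (margY_prod hPs.2).symm⟩
      have hentS : ent S = ent P + ent (margY Q') := ent_prod hPs hYs
      have hIS : mutualInfo S = 0 := by
        rw [(mutualInfo_pairs hpS).2, hentS, show margY S = margY Q' from margY_prod hPs.2]
        ring
      have hI' := mutualInfo_nonneg hp.2.1
      by_cases hlow : ∀ θ, SuppIn S (W θ) → score W e T ξ θ S - T - J ≤ R - I + c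
      · exact crossing_absurd hW hsupp hξ hK hcQ hcL hp hpS (hzero hθ)
          (fun p h0 => absurd (h0 θ₀) (hθ₀ _ _).ne') hc.ge hpos (by linarith) hlow hθ hhigh
      -- If the metric of the product is supercritical, the pair `(S, S)` of mutual information
      -- `0` satisfies the constraint of `setL` because of `-R ≤ T`.
      · push Not at hlow
        obtain ⟨θ', hθ', hlow⟩ := hlow
        obtain ⟨c', hc'⟩ := exists_metric_eq_coe hW (fun θ => hK θ S hpS.2.1.1) hpS.2.1.1 hθ'
        have h1 := ent_add_score_le hW hcQ hcL (pairs_self_right hpS) hc'.ge (fun θ' hθ' => by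
          have h2 := score_le_metric (e := e) (T := T) (ξ := ξ) hW hθ'
          rw [hc'] at h2
          have h3 := EReal.coe_le_coe_iff.1 h2
          have := le_max_right (mutualInfo S - R) 0
          linarith) hθ'
        rw [hIS, max_eq_right (by linarith)] at h1
        linarith

/-- The pointwise inequality at pairs where the supremum in `metric` is attained up to `δ` gives
the bounds in the two conditions up to `δ`. -/
theorem cond_of_pairCond (hW : ∀ θ x, W θ x ∈ stdSimplex ℝ Y) (hg : PairCond P W e R T ξ) :
    condQ P W (fun θ => (e θ : EReal)) R T ξ ∧ condL P W (fun θ => (e θ : EReal)) R T ξ := by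
  refine ⟨condQ_iff.2 ?_, condL_iff.2 ?_⟩
  · rintro θ ⟨Q, Q'⟩ ⟨hp, hI, hgap⟩
    dsimp only at hI hgap ⊢
    by_cases hθ : SuppIn Q' (W θ)
    swap
    · rw [kl_eq_top hθ, EReal.top_add_coe, EReal.top_sub_coe]; exact le_top
    rw [kl_eq hp.2.1.1 hp.2.2.2.1 hθ]
    suffices h : ξ * e θ ≤ div P (W θ) Q' + mutualInfo Q - R by exact_mod_cast h
    refine le_of_forall_pos_le_add fun δ hδ => ?_
    obtain ⟨θ₁, h₁, hlt⟩ : ∃ θ₁, SuppIn Q (W θ₁) ∧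
        ((score W e T ξ θ Q' - T - δ : ℝ) : EReal) < (score W e T ξ θ₁ Q : EReal) := by
      rw [← lt_metric_iff hW hp.1.1]
      by_contra hcon
      have h1 : (((score W e T ξ θ Q') - (score W e T ξ θ Q' - T - δ) - T : ℝ) : EReal) ≤ 0 := by
        refine le_trans ?_ hgap
        push_cast
        refine EReal.sub_le_sub (EReal.sub_le_sub (score_le_metric hW hθ) ?_) le_rfl
        have := not_lt.1 hcon
        push_cast at this
        exact this
      have h2 : (score W e T ξ θ Q') - (score W e T ξ θ Q' - T - δ) - T ≤ 0 := by exact_mod_cast h1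
      linarith
    have hlt' := EReal.coe_lt_coe_iff.1 hlt
    have := hg Q Q' hp θ₁ θ h₁ hθ
    rw [max_eq_left (by linarith)] at this
    have h3 : score W e T ξ θ Q' - T - (mutualInfo Q - R) - δ ≤
        min (R - mutualInfo Q + score W e T ξ θ₁ Q)
          (score W e T ξ θ Q' - T - (mutualInfo Q - R)) := le_min (by linarith) (by linarith)
    unfold div
    unfold score at h3 this
    linarith
  · rintro θ Q' ⟨hQ', hL⟩
    by_cases hθ : SuppIn Q' (W θ)
    swap
    · rw [kl_eq_top hθ]; exact le_top
    have hex : ∀ δ : ℝ, 0 < δ → ∃ Q, ((Q, Q') ∈ pairs P ∧ mutualInfo Q ≤ R) ∧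
        ∃ θ₁, SuppIn Q (W θ₁) ∧ score W e T ξ θ Q' - δ - R - T + mutualInfo Q <
          score W e T ξ θ₁ Q := by
      intro δ hδ
      have h1 : ((score W e T ξ θ Q' - δ - R - T : ℝ) : EReal) <
          ⨆ q ∈ {q : X × Y → ℝ | (q, Q') ∈ pairs P ∧ mutualInfo q ≤ R},
            (metric W (fun θ => (e θ : EReal)) T ξ q - (mutualInfo q : EReal)) := by
        by_contra hcon
        have h2 := (score_le_metric (e := e) (T := T) (ξ := ξ) hW hθ).trans
          (hL.trans (add_le_add le_rfl (not_lt.1 hcon)))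
        have h3 : score W e T ξ θ Q' ≤ R + T + (score W e T ξ θ Q' - δ - R - T) := by
          exact_mod_cast h2
        linarith
      simp only [lt_iSup_iff] at h1
      obtain ⟨Q, hQ, h1⟩ := h1
      refine ⟨Q, hQ, ?_⟩
      have h4 : ((score W e T ξ θ Q' - δ - R - T + mutualInfo Q : ℝ) : EReal) <
          metric W (fun θ => (e θ : EReal)) T ξ Q := by
        by_contra hcon
        have h2 := h1.trans_le (EReal.sub_le_sub (not_lt.1 hcon) (le_refl (mutualInfo Q : EReal)))
        have h3 : score W e T ξ θ Q' - δ - R - T <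
            score W e T ξ θ Q' - δ - R - T + mutualInfo Q - mutualInfo Q := by exact_mod_cast h2
        linarith
      obtain ⟨θ₁, h₁, h5⟩ := (lt_metric_iff hW hQ.1.1.1).1 h4
      exact ⟨θ₁, h₁, EReal.coe_lt_coe_iff.1 h5⟩
    obtain ⟨Q₀, hQ₀, -⟩ := hex 1 one_pos
    rw [kl_eq hQ'.1 hQ₀.1.2.2.2.1 hθ, EReal.coe_le_coe_iff]
    refine le_of_forall_pos_le_add fun δ hδ => ?_
    obtain ⟨Q, ⟨hp, hI⟩, θ₁, h₁, hlt⟩ := hex δ hδ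
    have := hg Q Q' hp θ₁ θ h₁ hθ
    rw [max_eq_right (by linarith)] at this
    have h3 : score W e T ξ θ Q' - T - δ ≤ min (R - mutualInfo Q + score W e T ξ θ₁ Q)
          (score W e T ξ θ Q' - T - 0) := le_min (by linarith) (by linarith)
    unfold div
    unfold score at h3 this
    linarith

lemma pairCond_zero (hW : ∀ θ x, W θ x ∈ stdSimplex ℝ Y) : PairCond P W e R T 0 := by
  intro Q Q' hp θ₁ θ₂ _ h₂
  have h1 := min_le_right (R - mutualInfo Q + score W e T 0 θ₁ Q)
    (score W e T 0 θ₂ Q' - T - max (mutualInfo Q - R) 0)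
  have h2 := le_max_right (mutualInfo Q - R) 0
  have h3 := div_nonneg hp.2.1 (hW θ₂) hp.2.2.2.1 h₂
  unfold div at h3
  unfold score at h1 ⊢
  linarith

lemma isClosed_pairCond : IsClosed {ξ | PairCond P W e R T ξ} := by
  simp only [PairCond, Set.ofPred_forall]
  refine isClosed_iInter fun Q => isClosed_iInter fun Q' => isClosed_iInter fun _ =>
    isClosed_iInter fun θ₁ => isClosed_iInter fun θ₂ => isClosed_iInter fun _ =>
    isClosed_iInter fun _ => isClosed_le ?_ continuous_const
  unfold score
  fun_prop

end Conditions

/-! ### The exponent of the known channel as one constrained minimum -/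

section Exponent

open Filter Topology

variable {X Y : Type*} [Fintype X] [Fintype Y]

/-- The pairs of `pairs P` in which both joint distributions are supported where `W` is
positive. -/
def suppPairs (P : X → ℝ) (W : X → Y → ℝ) : Set ((X × Y → ℝ) × (X × Y → ℝ)) :=
  {q | q ∈ pairs P ∧ SuppIn q.1 W ∧ SuppIn q.2 W}

/-- The smallest threshold `T` at which codewords of joint type `q.1` with the channel output
compete with a transmitted codeword of joint type `q.2`. -/
noncomputable def thresh (W : X → Y → ℝ) (R : ℝ) (q : (X × Y → ℝ) × (X × Y → ℝ)) : ℝ :=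
  linLog q.2 W - linLog q.1 W - max (R - mutualInfo q.1) 0

/-- The exponent of the probability that the transmitted codeword has joint type `q.2` with the
channel output and some other codeword has joint type `q.1` with it. -/
noncomputable def cost (P : X → ℝ) (W : X → Y → ℝ) (R : ℝ)
    (q : (X × Y → ℝ) × (X × Y → ℝ)) : ℝ :=
  div P W q.2 + max (mutualInfo q.1 - R) 0

variable {P : X → ℝ} {W : X → Y → ℝ} {R T : ℝ}

lemma exponent_le_cost (hW : ∀ x, W x ∈ stdSimplex ℝ Y) {q : (X × Y → ℝ) × (X × Y → ℝ)}
    (hq : q ∈ suppPairs P W) (hT : thresh W R q ≤ T) :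
    exponent P W R T ≤ (cost P W R q : EReal) := by
  obtain ⟨hp, h1, h2⟩ := hq
  have hW0 : ∀ x y, 0 ≤ W x y := fun x => (hW x).1
  have hkl := kl_eq (P := P) hp.2.1.1 hp.2.2.2.1 h2
  unfold thresh at hT
  unfold cost
  rcases le_total R (mutualInfo q.1) with hI | hI
  · rw [max_eq_right (by linarith)] at hT
    rw [max_eq_left (by linarith)]
    refine (min_le_left _ _).trans ((iInf₂_le q ⟨hp, hI, ?_⟩).trans ?_)
    swap
    · rw [expLog_eq hW0 h1, expLog_eq hW0 h2]
      have : linLog q.2 W - linLog q.1 W - T ≤ 0 := by linarith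
      exact_mod_cast this
    · rw [hkl]
      have : div P W q.2 + mutualInfo q.1 - R ≤ div P W q.2 + (mutualInfo q.1 - R) := by linarith
      exact_mod_cast this
  · rw [max_eq_left (by linarith)] at hT
    rw [max_eq_right (by linarith)]
    refine (min_le_right _ _).trans ((iInf₂_le q.2 ⟨hp.2.1, ?_⟩).trans ?_)
    swap
    · have h3 : ((linLog q.1 W - mutualInfo q.1 : ℝ) : EReal) ≤
          ⨆ q' ∈ {q' : X × Y → ℝ | (q', q.2) ∈ pairs P ∧ mutualInfo q' ≤ R},
            (expLog q' W - (mutualInfo q' : EReal)) := by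
        refine le_iSup₂_of_le (f := fun (q' : X × Y → ℝ)
          (_ : q' ∈ {q' : X × Y → ℝ | (q', q.2) ∈ pairs P ∧ mutualInfo q' ≤ R}) =>
          expLog q' W - (mutualInfo q' : EReal)) q.1 ⟨hp, hI⟩ ?_
        rw [expLog_eq hW0 h1]
        push_cast
        exact le_rfl
      refine le_trans ?_ (add_le_add le_rfl h3)
      rw [expLog_eq hW0 h2]
      have : linLog q.2 W ≤ R + T + (linLog q.1 W - mutualInfo q.1) := by linarith
      exact_mod_cast this
    · rw [hkl, add_zero]

lemma exists_cost_lt (hW : ∀ x, W x ∈ stdSimplex ℝ Y) {c δ : ℝ} (hδ : 0 < δ)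
    (h : exponent P W R T < (c : EReal)) :
    ∃ q ∈ suppPairs P W, thresh W R q ≤ T + δ ∧ cost P W R q < c := by
  have hW0 : ∀ x y, 0 ≤ W x y := fun x => (hW x).1
  rcases min_lt_iff.1 h with h | h
  · simp only [exponentA, iInf_lt_iff] at h
    obtain ⟨q, ⟨hp, hI, hcons⟩, hlt⟩ := h
    have h2 : SuppIn q.2 W := by
      by_contra hcon
      rw [kl_eq_top hcon, EReal.top_add_coe, EReal.top_sub_coe] at hlt
      exact absurd hlt (not_lt.2 le_top)
    have h1 : SuppIn q.1 W := by
      by_contra hcon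
      rw [expLog_eq_bot hp.1.1 hcon, expLog_eq hW0 h2, EReal.coe_sub_bot,
        EReal.top_sub_coe] at hcons
      exact absurd hcons (by simp)
    rw [expLog_eq hW0 h1, expLog_eq hW0 h2] at hcons
    have hcons' : linLog q.2 W - linLog q.1 W - T ≤ 0 := by exact_mod_cast hcons
    rw [kl_eq hp.2.1.1 hp.2.2.2.1 h2] at hlt
    have hlt' : div P W q.2 + mutualInfo q.1 - R < c := by exact_mod_cast hlt
    refine ⟨q, ⟨hp, h1, h2⟩, ?_, ?_⟩
    · have := le_max_right (R - mutualInfo q.1) 0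
      unfold thresh
      linarith
    · unfold cost
      rw [max_eq_left (by linarith)]
      linarith
  · simp only [exponentB, iInf_lt_iff] at h
    obtain ⟨q', ⟨hq', hcons⟩, hlt⟩ := h
    have h2 : SuppIn q' W := by
      by_contra hcon
      rw [kl_eq_top hcon] at hlt
      exact absurd hlt (not_lt.2 le_top)
    have h3 : ((linLog q' W - δ - R - T : ℝ) : EReal) <
        ⨆ q ∈ {q : X × Y → ℝ | (q, q') ∈ pairs P ∧ mutualInfo q ≤ R},
          (expLog q W - (mutualInfo q : EReal)) := by
      by_contra hcon
      have h3 := hcons.trans (add_le_add le_rfl (not_lt.1 hcon))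
      rw [expLog_eq hW0 h2] at h3
      have h4 : linLog q' W ≤ R + T + (linLog q' W - δ - R - T) := by exact_mod_cast h3
      linarith
    simp only [lt_iSup_iff] at h3
    obtain ⟨q, ⟨hp, hI⟩, h3⟩ := h3
    have h1 : SuppIn q W := by
      by_contra hcon
      rw [expLog_eq_bot hp.1.1 hcon, EReal.bot_sub] at h3
      exact absurd h3 (by simp)
    rw [expLog_eq hW0 h1] at h3
    have h4 : linLog q' W - δ - R - T < linLog q W - mutualInfo q := by exact_mod_cast h3
    rw [kl_eq hp.2.1.1 hp.2.2.2.1 h2] at hlt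
    have hlt' : div P W q' < c := by exact_mod_cast hlt
    refine ⟨(q, q'), ⟨hp, h1, h2⟩, ?_, ?_⟩
    · have := le_max_left (R - mutualInfo q) 0
      simp only [thresh]
      linarith
    · simp only [cost]
      rw [max_eq_right (by linarith)]
      linarith

lemma continuousOn_mutualInfo :
    ContinuousOn (mutualInfo : (X × Y → ℝ) → ℝ) {Q | ∀ p, 0 ≤ Q p} :=
  continuous_mutualInfo_formula.continuousOn.congr fun _ hQ => mutualInfo_eq hQ

lemma continuousOn_mutualInfo_fst :
    ContinuousOn (fun q : (X × Y → ℝ) × (X × Y → ℝ) => mutualInfo q.1) {q | ∀ p, 0 ≤ q.1 p} :=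
  continuousOn_mutualInfo.comp continuousOn_fst fun _ h => h

lemma continuousOn_thresh :
    ContinuousOn (thresh W R) {q : (X × Y → ℝ) × (X × Y → ℝ) | ∀ p, 0 ≤ q.1 p} := by
  unfold thresh
  exact ((((continuous_linLog W).comp continuous_snd).sub
    ((continuous_linLog W).comp continuous_fst)).continuousOn).sub
    ((continuousOn_const.sub continuousOn_mutualInfo_fst).sup continuousOn_const)

lemma continuousOn_cost :
    ContinuousOn (cost P W R) {q : (X × Y → ℝ) × (X × Y → ℝ) | ∀ p, 0 ≤ q.1 p} := by
  unfold cost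
  exact ((continuous_div P W).comp continuous_snd).continuousOn.add
    ((continuousOn_mutualInfo_fst.sub continuousOn_const).sup continuousOn_const)

lemma isClosed_suppIn (W : X → Y → ℝ) : IsClosed {Q : X × Y → ℝ | SuppIn Q W} := by
  simp only [SuppIn, Set.ofPred_forall]
  exact isClosed_iInter fun p => isClosed_iInter fun _ =>
    isClosed_eq (continuous_apply p) continuous_const

lemma isCompact_suppPairs : IsCompact (suppPairs P W) := by
  have hK : IsCompact (stdSimplex ℝ (X × Y) ×ˢ stdSimplex ℝ (X × Y)) :=
    (isCompact_stdSimplex ℝ _).prod (isCompact_stdSimplex ℝ _)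
  refine hK.of_isClosed_subset ?_ fun q hq => ⟨hq.1.1, hq.1.2.1⟩
  have hS := isClosed_stdSimplex ℝ (X × Y)
  exact ((hS.preimage continuous_fst).inter ((hS.preimage continuous_snd).inter
    ((isClosed_eq (continuous_margX.comp continuous_fst) continuous_const).inter
    ((isClosed_eq (continuous_margX.comp continuous_snd) continuous_const).inter
    (isClosed_eq (continuous_margY.comp continuous_fst)
      (continuous_margY.comp continuous_snd)))))).inter
    (((isClosed_suppIn W).preimage continuous_fst).inter
      ((isClosed_suppIn W).preimage continuous_snd))

/-- The constrained minimum is right-continuous in the threshold, by compactness. -/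
lemma exists_forall_lt_cost (hW : ∀ x, W x ∈ stdSimplex ℝ Y) {c : ℝ}
    (h : (c : EReal) < exponent P W R T) :
    ∃ δ > 0, ∀ q ∈ suppPairs P W, thresh W R q ≤ T + δ → c < cost P W R q := by
  have hsub : suppPairs P W ⊆ {q : (X × Y → ℝ) × (X × Y → ℝ) | ∀ p, 0 ≤ q.1 p} :=
    fun q hq => hq.1.1.1
  set S := suppPairs P W ∩ {q | cost P W R q ≤ c} with hS
  have hcomp : IsCompact S := by
    have hcl : IsClosed S := (continuousOn_cost.mono hsub).preimage_isClosed_of_isClosed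
      isCompact_suppPairs.isClosed isClosed_Iic
    exact isCompact_suppPairs.of_isClosed_subset hcl Set.inter_subset_left
  rcases S.eq_empty_or_nonempty with hemp | hne
  · refine ⟨1, one_pos, fun q hq _ => ?_⟩
    by_contra hcon
    have : q ∈ S := ⟨hq, not_lt.1 hcon⟩
    rw [hemp] at this
    exact this
  · obtain ⟨q₀, hq₀, hmin⟩ := hcomp.exists_isMinOn hne
      (continuousOn_thresh.mono (Set.inter_subset_left.trans hsub))
    have hT : T < thresh W R q₀ := by
      by_contra hcon
      have := h.trans_le (exponent_le_cost hW hq₀.1 (not_lt.1 hcon))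
      exact absurd (EReal.coe_lt_coe_iff.1 this) (not_lt.2 hq₀.2)
    refine ⟨(thresh W R q₀ - T) / 2, by linarith, fun q hq hle => ?_⟩
    by_contra hcon
    have : thresh W R q₀ ≤ thresh W R q := hmin ⟨hq, not_lt.1 hcon⟩
    linarith

lemma exists_cost_lt_of_continuousWithinAt (hW : ∀ x, W x ∈ stdSimplex ℝ Y)
    (hcont : ContinuousWithinAt (fun t : ℝ => exponent P W R t) (Set.Iic T) T) {c : ℝ}
    (h : exponent P W R T < (c : EReal)) :
    ∃ q ∈ suppPairs P W, thresh W R q < T ∧ cost P W R q < c := by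
  have h1 : ∀ᶠ t in 𝓝[<] T, exponent P W R t < (c : EReal) :=
    (hcont.mono Set.Iio_subset_Iic_self).eventually_lt_const h
  obtain ⟨t, ht, htT⟩ := (h1.and self_mem_nhdsWithin).exists
  obtain ⟨q, hq, h2, h3⟩ := exists_cost_lt hW (half_pos (sub_pos.2 htT)) ht
  exact ⟨q, hq, by have : t < T := htT; linarith, h3⟩

lemma exponent_nonneg (hP : P ∈ stdSimplex ℝ X) (hW : ∀ x, W x ∈ stdSimplex ℝ Y) :
    0 ≤ exponent P W R T := by
  refine le_min (le_iInf₂ fun q hq => ?_) (le_iInf₂ fun q hq => kl_nonneg hP hq.1 hW)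
  have h1 : (0 : EReal) ≤ ((mutualInfo q.1 - R : ℝ) : EReal) := by
    exact_mod_cast sub_nonneg.2 hq.2.1
  have h2 := add_nonneg (kl_nonneg hP hq.1.2.1 hW) h1
  rwa [EReal.coe_sub, sub_eq_add_neg, ← add_assoc, ← sub_eq_add_neg] at h2

end Exponent

/-! ### The method of types -/

section Types

open Finset

variable {A : Type*} [Fintype A] [DecidableEq A] {n : ℕ}

/-- The number of occurrences of the letter `a` in the vector `z`. -/
def cnt (z : Fin n → A) (a : A) : ℕ := #{i | z i = a}

/-- The vectors with given numbers of occurrences. -/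
def seqs (n : ℕ) (k : A → ℕ) : Finset (Fin n → A) := {z | cnt z = k}

/-- The relative frequencies that belong to given numbers of occurrences. -/
noncomputable def frac (n : ℕ) (k : A → ℕ) (a : A) : ℝ := (k a : ℝ) / n

lemma mem_seqs {k : A → ℕ} {z : Fin n → A} : z ∈ seqs n k ↔ cnt z = k := by simp [seqs]

lemma sum_cnt (z : Fin n → A) : ∑ a, cnt z a = n := by
  have := card_eq_sum_card_fiberwise (f := z) (s := univ) (t := univ) (by simp)
  simpa [cnt] using this.symm

lemma cnt_le (z : Fin n → A) (a : A) : cnt z a ≤ n :=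
  (single_le_sum (f := cnt z) (fun _ _ => Nat.zero_le _) (mem_univ a)).trans (sum_cnt z).le

lemma cnt_comp_perm (z : Fin n → A) (σ : Equiv.Perm (Fin n)) : cnt (z ∘ σ) = cnt z := by
  funext a
  exact card_equiv σ (by simp)

lemma exists_perm_of_cnt_eq {z z' : Fin n → A} (h : cnt z = cnt z') :
    ∃ σ : Equiv.Perm (Fin n), z ∘ σ = z' := by
  have e : ∀ a, Nonempty ({i // z' i = a} ≃ {i // z i = a}) := fun a => by
    refine ⟨Fintype.equivOfCardEq ?_⟩
    rw [Fintype.card_subtype, Fintype.card_subtype]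
    exact (congrFun h a).symm
  let f : ∀ a, {i // z' i = a} ≃ {i // z i = a} := fun a => (e a).some
  refine ⟨(Equiv.sigmaFiberEquiv z').symm.trans
    ((Equiv.sigmaCongrRight f).trans (Equiv.sigmaFiberEquiv z)), ?_⟩
  funext i
  exact (f (z' i) ⟨i, rfl⟩).2

lemma seqs_nonempty {k : A → ℕ} (h : ∑ a, k a = n) : (seqs n k).Nonempty := by
  have e : Nonempty (Fin n ≃ Σ a, Fin (k a)) := ⟨Fintype.equivOfCardEq (by simp [h])⟩
  obtain ⟨e⟩ := e
  refine ⟨fun i => (e i).1, mem_seqs.2 ?_⟩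
  funext a
  have h1 : #{i | (e i).1 = a} = #{s : Σ a, Fin (k a) | s.1 = a} := card_equiv e (by simp)
  have h2 : Fintype.card {s : Σ a, Fin (k a) // s.1 = a} = Fintype.card (Fin (k a)) :=
    Fintype.card_congr (Equiv.sigmaSubtype a)
  rw [Fintype.card_subtype, Fintype.card_fin] at h2
  exact h1.trans h2

/-- The size of a type class is a multinomial coefficient: the permutations act transitively on
the class, and the stabilizers permute the positions of each letter. -/
lemma card_seqs_mul {k : A → ℕ} (h : ∑ a, k a = n) :
    #(seqs n k) * ∏ a, (k a).factorial = n.factorial := by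
  obtain ⟨z, hz⟩ := seqs_nonempty h
  have hz' := mem_seqs.1 hz
  have hst : #{σ : Equiv.Perm (Fin n) | z ∘ σ = z} = ∏ a, (k a).factorial := by
    rw [← Fintype.card_subtype, DomMulAct.stabilizer_card]
    refine prod_congr rfl fun a _ => ?_
    rw [Fintype.card_subtype, ← hz']
    rfl
  have hfib : ∀ z' ∈ seqs n k, #{σ : Equiv.Perm (Fin n) | z ∘ σ = z'} = ∏ a, (k a).factorial := by
    intro z' h'
    obtain ⟨τ, hτ⟩ := exists_perm_of_cnt_eq (hz'.trans (mem_seqs.1 h').symm)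
    rw [← hst]
    refine card_equiv (Equiv.mulRight τ⁻¹) fun σ => ?_
    simp only [mem_filter, mem_univ, true_and, Equiv.coe_mulRight, ← hτ]
    constructor
    · intro h1
      funext i
      have := congrFun h1 (τ⁻¹ i)
      simpa using this
    · intro h1
      funext i
      have := congrFun h1 (τ i)
      simpa using this
  have := card_eq_sum_card_fiberwise (f := fun σ : Equiv.Perm (Fin n) => z ∘ σ) (s := univ)
    (t := seqs n k) (fun σ _ => mem_seqs.2 ((cnt_comp_perm z σ).trans hz'))
  rw [sum_congr rfl hfib, sum_const, smul_eq_mul, card_univ, Fintype.card_perm,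
    Fintype.card_fin] at this
  exact this.symm

/-- A crude form of Stirling's formula; `1 + log (k + 1)` bounds the error also at `k = 0`. -/
lemma log_factorial_le (k : ℕ) :
    Real.log (k.factorial : ℝ) ≤ k * Real.log k - k + (1 + Real.log (k + 1)) := by
  rcases k with _ | k
  · simp
  · have h1 := Stirling.log_stirlingSeq'_antitone (Nat.zero_le k)
    simp only [Function.comp_apply, Stirling.log_stirlingSeq_formula] at h1
    have h2 : (0 : ℝ) < ((k + 1 : ℕ) : ℝ) := by positivity
    rw [Real.log_div h2.ne' (Real.exp_pos 1).ne', Real.log_mul two_ne_zero h2.ne',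
      Real.log_exp] at h1
    norm_num at h1
    have h3 : Real.log ((k : ℝ) + 1) ≤ Real.log (k + 1 + 1) :=
      Real.log_le_log (by positivity) (by linarith)
    have h4 : 0 ≤ Real.log ((k : ℝ) + 1) := Real.log_nonneg (by
      have : (0 : ℝ) ≤ k := Nat.cast_nonneg k
      linarith)
    push_cast
    linarith

lemma le_log_factorial (k : ℕ) : k * Real.log k - k ≤ Real.log (k.factorial : ℝ) := by
  rcases eq_or_ne k 0 with rfl | hk
  · simp
  · have := Stirling.le_log_factorial_stirling hk
    have h1 : 0 ≤ Real.log k := Real.log_natCast_nonneg k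
    have h2 : 0 ≤ Real.log (2 * Real.pi) := Real.log_nonneg (by linarith [Real.pi_gt_three])
    linarith

lemma mul_ent_frac {k : A → ℕ} (h : ∑ a, k a = n) :
    n * ent (frac n k) = n * Real.log n - ∑ a, k a * Real.log (k a) := by
  rcases eq_or_ne n 0 with rfl | hn
  · have : ∀ a, k a = 0 := fun a => by
      simpa using (sum_eq_zero_iff.1 h) a (mem_univ a)
    simp [this]
  · have hn' : (n : ℝ) ≠ 0 := Nat.cast_ne_zero.2 hn
    have hterm : ∀ a, n * Real.negMulLog (frac n k a) =
        k a * Real.log n - k a * Real.log (k a) := by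
      intro a
      rcases eq_or_ne (k a) 0 with h0 | h0
      · simp [frac, h0]
      · rw [frac, Real.negMulLog, Real.log_div (Nat.cast_ne_zero.2 h0) hn']
        field_simp
        ring
    rw [ent, mul_sum, sum_congr rfl fun a _ => hterm a, sum_sub_distrib, ← sum_mul]
    congr 2
    exact_mod_cast h

/-- The logarithm of the size of a type class is `n` times the entropy, up to `O(log n)`. -/
lemma abs_log_card_seqs_sub_le {k : A → ℕ} (h : ∑ a, k a = n) :
    |Real.log (#(seqs n k) : ℝ) - n * ent (frac n k)| ≤
      (Fintype.card A + 1) * (1 + Real.log (n + 1)) := by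
  have h0 : (0 : ℝ) ≤ 1 + Real.log (n + 1) := by
    have : (0 : ℝ) ≤ n := Nat.cast_nonneg n
    linarith [Real.log_nonneg (by linarith : (1 : ℝ) ≤ n + 1)]
  have hlog : Real.log (#(seqs n k) : ℝ) + ∑ a, Real.log ((k a).factorial : ℝ) =
      Real.log (n.factorial : ℝ) := by
    rw [← card_seqs_mul h, Nat.cast_mul, Nat.cast_prod, Real.log_mul, Real.log_prod]
    · exact fun a _ => Nat.cast_ne_zero.2 (Nat.factorial_ne_zero _)
    · exact Nat.cast_ne_zero.2 (card_pos.2 (seqs_nonempty h)).ne'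
    · exact prod_ne_zero_iff.2 fun a _ => Nat.cast_ne_zero.2 (Nat.factorial_ne_zero _)
  have hk : ∑ a, (k a : ℝ) = n := by exact_mod_cast h
  have h1 : ∑ a, ((k a : ℝ) * Real.log (k a) - k a) ≤ ∑ a, Real.log ((k a).factorial : ℝ) :=
    sum_le_sum fun a _ => le_log_factorial _
  have h2 : ∑ a, Real.log ((k a).factorial : ℝ) ≤
      ∑ a, ((k a : ℝ) * Real.log (k a) - k a + (1 + Real.log (n + 1))) := by
    refine sum_le_sum fun a _ => (log_factorial_le _).trans ?_
    have h3 : (k a : ℝ) ≤ n := by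
      exact_mod_cast (single_le_sum (fun _ _ => Nat.zero_le _) (mem_univ a)).trans h.le
    have : Real.log ((k a : ℝ) + 1) ≤ Real.log (n + 1) :=
      Real.log_le_log (by positivity) (by linarith)
    linarith
  simp only [sum_add_distrib, sum_sub_distrib, hk, sum_const, card_univ, nsmul_eq_mul] at h1 h2
  have h3 := log_factorial_le n
  have h4 := le_log_factorial n
  rw [mul_ent_frac h, abs_le]
  have h5 : (0 : ℝ) ≤ Fintype.card A * (1 + Real.log (n + 1)) :=
    mul_nonneg (Nat.cast_nonneg _) h0
  constructor <;> linarith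

lemma frac_mem_stdSimplex (hn : n ≠ 0) {k : A → ℕ} (h : ∑ a, k a = n) :
    frac n k ∈ stdSimplex ℝ A := by
  refine ⟨fun a => by unfold frac; positivity, ?_⟩
  simp only [frac, ← sum_div]
  rw [div_eq_one_iff_eq (Nat.cast_ne_zero.2 hn)]
  exact_mod_cast h

lemma sum_eq_of_frac_mem (hn : n ≠ 0) {k : A → ℕ} (h : frac n k ∈ stdSimplex ℝ A) :
    ∑ a, k a = n := by
  have := h.2
  simp only [frac, ← sum_div] at this
  rw [div_eq_one_iff_eq (Nat.cast_ne_zero.2 hn)] at this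
  exact_mod_cast this

lemma frac_injective (hn : n ≠ 0) : Function.Injective (frac n : (A → ℕ) → A → ℝ) := by
  intro k k' h
  funext a
  have := congrFun h a
  simp only [frac] at this
  rw [div_left_inj' (Nat.cast_ne_zero.2 hn)] at this
  exact_mod_cast this

end Types

section JointTypes

open Finset

variable {X Y : Type*} [Fintype X] [DecidableEq X] [Fintype Y] [DecidableEq Y] {n : ℕ}

/-- The numbers of occurrences of the pairs of letters in two vectors. -/
def jcnt (x : Fin n → X) (y : Fin n → Y) : X × Y → ℕ := cnt fun i => (x i, y i)

lemma sum_jcnt_fst (x : Fin n → X) (y : Fin n → Y) (a : X) : ∑ b, jcnt x y (a, b) = cnt x a := by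
  rw [cnt, card_eq_sum_card_fiberwise (f := y) (t := univ) (by simp)]
  refine sum_congr rfl fun b _ => ?_
  simp [jcnt, cnt, filter_filter]

lemma sum_jcnt_snd (x : Fin n → X) (y : Fin n → Y) (b : Y) : ∑ a, jcnt x y (a, b) = cnt y b := by
  rw [cnt, card_eq_sum_card_fiberwise (f := x) (t := univ) (by simp)]
  refine sum_congr rfl fun a _ => ?_
  simp [jcnt, cnt, filter_filter, and_comm]

lemma margX_frac (q : X × Y → ℕ) : margX (frac n q) = frac n fun a => ∑ b, q (a, b) := by
  funext a
  simp [margX, frac, sum_div]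

lemma margY_frac (q : X × Y → ℕ) : margY (frac n q) = frac n fun b => ∑ a, q (a, b) := by
  funext b
  simp [margY, frac, sum_div]

lemma margX_frac_jcnt (x : Fin n → X) (y : Fin n → Y) :
    margX (frac n (jcnt x y)) = empirical x := by
  rw [margX_frac]
  funext a
  simp only [sum_jcnt_fst]
  rfl

lemma margY_frac_jcnt (x : Fin n → X) (y : Fin n → Y) :
    margY (frac n (jcnt x y)) = frac n (cnt y) := by
  rw [margY_frac]
  simp only [sum_jcnt_snd]

lemma mem_typeClass {P : X → ℝ} {x : Fin n → X} : x ∈ typeClass P n ↔ empirical x = P := by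
  simp [typeClass]

lemma typeClass_eq_seqs (hn : n ≠ 0) {k : X → ℕ} :
    typeClass (frac n k) n = seqs n k := by
  ext x
  rw [mem_typeClass, mem_seqs]
  exact (frac_injective hn).eq_iff (a := cnt x)

/-- All the vectors `y` of the same type are in the joint type `q` with equally many `x`. -/
lemma card_jcnt_mul_card_seqs (q : X × Y → ℕ) (y : Fin n → Y)
    (hy : ∀ b, ∑ a, q (a, b) = cnt y b) :
    #{x : Fin n → X | jcnt x y = q} * #(seqs n (cnt y)) = #(seqs n q) := by
  have hfib : ∀ y' ∈ seqs n (cnt y),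
      #{z ∈ seqs n q | (fun i => (z i).2) = y'} = #{x : Fin n → X | jcnt x y = q} := by
    intro y' hy'
    obtain ⟨σ, hσ⟩ := exists_perm_of_cnt_eq (mem_seqs.1 hy')
    refine card_bij' (fun z _ => fun i => (z (σ i)).1) (fun x _ => fun i => (x (σ.symm i), y' i))
      ?_ ?_ ?_ ?_
    · intro z hz
      simp only [mem_filter, mem_seqs, mem_univ, true_and] at hz ⊢
      rw [jcnt, ← hz.1, ← cnt_comp_perm z σ, ← hσ, ← hz.2]
      rfl
    · intro x hx
      simp only [mem_filter, mem_seqs, mem_univ, true_and, and_true] at hx ⊢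
      rw [← hx, jcnt, ← cnt_comp_perm _ σ, ← hσ]
      congr 1
      funext i
      simp
    · intro z hz
      simp only [mem_filter] at hz
      funext i
      rw [← hz.2]
      simp
    · intro x _
      funext i
      simp
  have := card_eq_sum_card_fiberwise (f := fun (z : Fin n → X × Y) i => (z i).2) (s := seqs n q)
    (t := seqs n (cnt y)) (fun z hz => by
      simp only [mem_coe, mem_seqs] at hz ⊢
      funext b
      rw [← hy b, ← hz, ← sum_jcnt_snd (fun i => (z i).1)]
      rfl)
  rw [this, sum_congr rfl hfib, sum_const, smul_eq_mul, mul_comm]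

/-- The number of vectors in `X^n` of empirical distribution `P` and joint type `q` with `y`, as a
fraction of the type class. -/
noncomputable def typeProb (P : X → ℝ) (y : Fin n → Y) (q : X × Y → ℕ) : ℝ :=
  (#{x ∈ typeClass P n | jcnt x y = q} : ℝ) / #(typeClass P n)

lemma typeProb_nonneg (P : X → ℝ) (y : Fin n → Y) (q : X × Y → ℕ) : 0 ≤ typeProb P y q := by
  unfold typeProb; positivity

/-- The error term in the exponential estimates of the method of types. -/
noncomputable def typeErr (X Y : Type*) [Fintype X] [Fintype Y] (n : ℕ) : ℝ :=
  (Fintype.card (X × Y) + Fintype.card X + Fintype.card Y + 3) * (1 + Real.log (n + 1))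

lemma one_add_log_nonneg (n : ℕ) : (0 : ℝ) ≤ 1 + Real.log (n + 1) := by
  have : (0 : ℝ) ≤ n := Nat.cast_nonneg n
  linarith [Real.log_nonneg (by linarith : (1 : ℝ) ≤ n + 1)]

variable {P : X → ℝ} {q : X × Y → ℕ}

lemma filter_typeClass_eq (hqX : margX (frac n q) = P) (y : Fin n → Y) :
    ({x ∈ typeClass P n | jcnt x y = q} : Finset (Fin n → X)) =
      ({x | jcnt x y = q} : Finset (Fin n → X)) := by
  ext x
  simp only [mem_filter, mem_univ, true_and, and_iff_right_iff_imp, mem_typeClass]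
  rintro rfl
  rw [← hqX, margX_frac_jcnt]

/-- A uniform vector of the type class has joint type `q` with `y` with a probability of about
`exp (-n I)`. -/
lemma abs_log_typeProb_add_le (hn : n ≠ 0) (hq : frac n q ∈ stdSimplex ℝ (X × Y))
    (hqX : margX (frac n q) = P) (y : Fin n → Y) (hy : margY (frac n q) = frac n (cnt y)) :
    0 < typeProb P y q ∧
      |Real.log (typeProb P y q) + n * mutualInfo (frac n q)| ≤ typeErr X Y n := by
  have hqs := sum_eq_of_frac_mem hn hq
  have hPk := (margX_frac q).symm.trans hqX
  set k : X → ℕ := fun a => ∑ b, q (a, b) with hk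
  have hks : ∑ a, k a = n := by rw [← hqs, Fintype.sum_prod_type]
  have hy' : ∀ b, ∑ a, q (a, b) = cnt y b := fun b => by
    rw [margY_frac] at hy
    exact congrFun (frac_injective hn hy) b
  have hcard := card_jcnt_mul_card_seqs q y hy'
  rw [← filter_typeClass_eq hqX] at hcard
  have h0 : (0 : ℝ) < #(seqs n q) := by exact_mod_cast card_pos.2 (seqs_nonempty hqs)
  have h1 : (0 : ℝ) < #(typeClass P n) := by
    rw [← hPk, typeClass_eq_seqs hn]; exact_mod_cast card_pos.2 (seqs_nonempty hks)
  have h2 : (0 : ℝ) < #(seqs n (cnt y)) := by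
    exact_mod_cast card_pos.2 (seqs_nonempty (sum_cnt y))
  have hcard' : (#{x ∈ typeClass P n | jcnt x y = q} : ℝ) = #(seqs n q) / #(seqs n (cnt y)) := by
    rw [eq_div_iff h2.ne']; exact_mod_cast hcard
  have hp : typeProb P y q = #(seqs n q) / #(seqs n (cnt y)) / #(typeClass P n) := by
    rw [typeProb, hcard']
  refine ⟨by rw [hp]; positivity, ?_⟩
  rw [hp, Real.log_div (by positivity) h1.ne', Real.log_div h0.ne' h2.ne',
    mutualInfo_eq hq.1, hqX, hy]
  have e1 := abs_log_card_seqs_sub_le hqs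
  have e2 := abs_log_card_seqs_sub_le (sum_cnt y)
  have e3 := abs_log_card_seqs_sub_le hks
  rw [hPk, ← typeClass_eq_seqs hn, hPk] at e3
  rw [abs_le] at e1 e2 e3 ⊢
  unfold typeErr
  constructor <;> linarith

/-- The sum over the channel outputs `y` of the probabilities of the joint type `q` is about
`exp (n (H(Q) - H(P)))`. -/
lemma sum_typeProb (hn : n ≠ 0) (hq : frac n q ∈ stdSimplex ℝ (X × Y))
    (hqX : margX (frac n q) = P) :
    0 < (#(seqs n q) : ℝ) / #(typeClass P n) ∧
    ∑ y ∈ seqs n (fun b => ∑ a, q (a, b)), typeProb P y q = #(seqs n q) / #(typeClass P n) ∧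
    |Real.log ((#(seqs n q) : ℝ) / #(typeClass P n)) - n * (ent (frac n q) - ent P)| ≤
      typeErr X Y n := by
  have hqs := sum_eq_of_frac_mem hn hq
  have hPk := (margX_frac q).symm.trans hqX
  set k : X → ℕ := fun a => ∑ b, q (a, b) with hk
  have hks : ∑ a, k a = n := by rw [← hqs, Fintype.sum_prod_type]
  have hls : ∑ b, ∑ a, q (a, b) = n := by rw [← hqs, Fintype.sum_prod_type_right]
  have h0 : (0 : ℝ) < #(seqs n q) := by exact_mod_cast card_pos.2 (seqs_nonempty hqs)
  have h1 : (0 : ℝ) < #(typeClass P n) := by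
    rw [← hPk, typeClass_eq_seqs hn]; exact_mod_cast card_pos.2 (seqs_nonempty hks)
  have h2 : (0 : ℝ) < #(seqs n fun b => ∑ a, q (a, b)) := by
    exact_mod_cast card_pos.2 (seqs_nonempty hls)
  refine ⟨by positivity, ?_, ?_⟩
  · have hterm : ∀ y ∈ seqs n (fun b => ∑ a, q (a, b)), typeProb P y q =
        #(seqs n q) / #(seqs n fun b => ∑ a, q (a, b)) / #(typeClass P n) := by
      intro y hy
      have hcy := mem_seqs.1 hy
      have hcard := card_jcnt_mul_card_seqs q y fun b => (congrFun hcy b).symm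
      rw [← filter_typeClass_eq hqX, hcy] at hcard
      have hcard' : (#{x ∈ typeClass P n | jcnt x y = q} : ℝ) =
          #(seqs n q) / #(seqs n fun b => ∑ a, q (a, b)) := by
        rw [eq_div_iff h2.ne']; exact_mod_cast hcard
      rw [typeProb, hcard']
    rw [sum_congr rfl hterm, sum_const, nsmul_eq_mul]
    field_simp
  · rw [Real.log_div h0.ne' h1.ne']
    have e1 := abs_log_card_seqs_sub_le hqs
    have e3 := abs_log_card_seqs_sub_le hks
    rw [hPk, ← typeClass_eq_seqs hn, hPk] at e3
    have e4 : (0 : ℝ) ≤ (Fintype.card Y + 1) * (1 + Real.log (n + 1)) :=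
      mul_nonneg (by positivity) (one_add_log_nonneg n)
    rw [abs_le] at e1 e3 ⊢
    unfold typeErr
    constructor <;> linarith

end JointTypes

section Approximation

open Finset

/-- Dirichlet's simultaneous approximation, without a rate. -/
lemma exists_abs_mul_sub_round_lt {ι : Type*} [Fintype ι] (v : ι → ℝ) {η : ℝ} (hη : 0 < η) :
    ∃ m : ℕ, 0 < m ∧ ∀ i, |m * v i - round (m * v i)| < η := by
  let u : ℕ → ι → ℝ := fun m i => Int.fract (m * v i)
  have hu : ∀ m, u m ∈ Set.pi Set.univ fun _ : ι => Set.Icc (0 : ℝ) 1 := fun m i _ =>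
    ⟨Int.fract_nonneg _, (Int.fract_lt_one _).le⟩
  -- Two far members of a convergent subsequence of the fractional parts differ by little.
  obtain ⟨a, -, φ, hφ, hlim⟩ := (isCompact_univ_pi fun _ : ι =>
    isCompact_Icc (a := (0 : ℝ)) (b := 1)).tendsto_subseq hu
  obtain ⟨N, hN⟩ := Metric.cauchySeq_iff.1 hlim.cauchySeq η hη
  have h1 := hN (N + 1) (Nat.le_succ N) N le_rfl
  have hlt : φ N < φ (N + 1) := hφ (Nat.lt_succ_self N)
  refine ⟨φ (N + 1) - φ N, Nat.sub_pos_of_lt hlt, fun i => ?_⟩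
  have h2 := (dist_pi_lt_iff hη).1 h1 i
  refine (round_le _ (⌊(φ (N + 1) : ℝ) * v i⌋ - ⌊(φ N : ℝ) * v i⌋)).trans_lt ?_
  rw [Real.dist_eq] at h2
  simp only [Function.comp_apply, u, Int.fract] at h2
  rw [Nat.cast_sub hlt.le]
  push_cast
  exact lt_of_eq_of_lt (congrArg abs (by ring)) h2

variable {X Y : Type*} [Fintype X] [Fintype Y]

lemma int_eq_of_abs_sub_lt_one {a b : ℤ} (h : |(a : ℝ) - b| < 1) : a = b := by
  have h1 : |a - b| < 1 := by exact_mod_cast h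
  exact sub_eq_zero.1 (Int.abs_lt_one_iff.1 h1)

/-- Every pair of joint distributions in `pairs P` can be approximated by pairs of types in
`pairs P` with no larger supports: rounding a good simultaneous approximation keeps the integer
linear relations between the entries. -/
lemma exists_types_near {P : X → ℝ} {N₀ : ℕ} (hN₀ : 0 < N₀) {k : X → ℕ}
    (hP : ∀ x, N₀ * P x = k x) {Q Q' : X × Y → ℝ} (hp : (Q, Q') ∈ pairs P) {δ : ℝ} (hδ : 0 < δ) :
    ∃ N : ℕ, 0 < N ∧ ∃ q q' : X × Y → ℕ, (frac N q, frac N q') ∈ pairs P ∧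
      (∀ p, Q p = 0 → q p = 0) ∧ (∀ p, Q' p = 0 → q' p = 0) ∧
      (∀ p, |frac N q p - Q p| < δ) ∧ ∀ p, |frac N q' p - Q' p| < δ := by
  set C : ℝ := 2 * (Fintype.card X + Fintype.card Y + 1) with hC
  have hC0 : 0 < C := by positivity
  set η : ℝ := min δ (1 / C) with hη
  have hη0 : 0 < η := lt_min hδ (by positivity)
  have hηC : C * η ≤ 1 := by
    calc C * η ≤ C * (1 / C) := mul_le_mul_of_nonneg_left (min_le_right _ _) hC0.le
      _ = 1 := by field_simp
  obtain ⟨m, hm, happ⟩ := exists_abs_mul_sub_round_lt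
    (Sum.elim (fun p => N₀ * Q p) fun p => N₀ * Q' p) hη0
  set N : ℕ := m * N₀ with hN
  have hNpos : 0 < N := Nat.mul_pos hm hN₀
  have hNr : (0 : ℝ) < N := by exact_mod_cast hNpos
  have hN1 : (1 : ℝ) ≤ N := by exact_mod_cast hNpos
  have happ1 : ∀ p, |N * Q p - round (N * Q p)| < η := fun p => by
    have := happ (Sum.inl p)
    simp only [Sum.elim_inl, ← mul_assoc] at this
    rw [hN]; push_cast; exact this
  have happ2 : ∀ p, |N * Q' p - round (N * Q' p)| < η := fun p => by
    have := happ (Sum.inr p)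
    simp only [Sum.elim_inr, ← mul_assoc] at this
    rw [hN]; push_cast; exact this
  have hround : ∀ {Q : X × Y → ℝ}, (∀ p, 0 ≤ Q p) → ∀ p,
      ((round (N * Q p)).toNat : ℤ) = round (N * Q p) := fun hQ p => by
    refine Int.toNat_of_nonneg ?_
    rw [round_eq]
    exact Int.floor_nonneg.2 (by have := hQ p; positivity)
  have hX : ∀ {Q : X × Y → ℝ}, (∀ p, 0 ≤ Q p) → margX Q = P →
      (∀ p, |N * Q p - round (N * Q p)| < η) → ∀ x,
      margX (frac N fun p => (round (N * Q p)).toNat) x = P x := by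
    intro Q hQ hQP happ x
    have h1 : ∑ y, round (N * Q (x, y)) = ((m * k x : ℕ) : ℤ) := by
      apply int_eq_of_abs_sub_lt_one
      have h2 : (((m * k x : ℕ) : ℤ) : ℝ) = ∑ y, N * Q (x, y) := by
        rw [← mul_sum, show ∑ y, Q (x, y) = P x from congrFun hQP x, hN]
        push_cast
        rw [mul_assoc, hP]
      rw [h2]
      push_cast
      rw [← sum_sub_distrib]
      calc |∑ y, ((round (N * Q (x, y)) : ℝ) - N * Q (x, y))|
          ≤ ∑ y, |(round (N * Q (x, y)) : ℝ) - N * Q (x, y)| := abs_sum_le_sum_abs _ _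
        _ ≤ ∑ _y : Y, η := sum_le_sum fun y _ => by rw [abs_sub_comm]; exact (happ _).le
        _ = Fintype.card Y * η := by simp
        _ < C * η := mul_lt_mul_of_pos_right (by
            have h4 : (0 : ℝ) ≤ Fintype.card X := Nat.cast_nonneg _
            have h5 : (0 : ℝ) ≤ Fintype.card Y := Nat.cast_nonneg _
            rw [hC]; linarith) hη0
        _ ≤ 1 := hηC
    have h3 : ∑ y, ((round (N * Q (x, y))).toNat : ℝ) = N * P x := by
      have : ∑ y, ((round (N * Q (x, y))).toNat : ℤ) = ((m * k x : ℕ) : ℤ) := by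
        rw [← h1]; exact sum_congr rfl fun y _ => hround hQ _
      have h4 : ∑ y, ((round (N * Q (x, y))).toNat : ℝ) = ((m * k x : ℕ) : ℝ) := by
        exact_mod_cast this
      rw [h4, hN]
      push_cast
      rw [mul_assoc, hP]
    simp only [margX, frac, ← sum_div]
    rw [h3]
    field_simp
  have hnear : ∀ {Q : X × Y → ℝ}, (∀ p, 0 ≤ Q p) →
      (∀ p, |N * Q p - round (N * Q p)| < η) → ∀ p,
      |frac N (fun p => (round (N * Q p)).toNat) p - Q p| < δ := by
    intro Q hQ happ p
    have h1 : ((round (N * Q p)).toNat : ℝ) = (round (N * Q p) : ℝ) := by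
      exact_mod_cast hround hQ p
    have h2 : frac N (fun p => (round (N * Q p)).toNat) p - Q p =
        (round (N * Q p) - N * Q p) / N := by
      rw [frac, h1]; field_simp
    rw [h2, abs_div, abs_of_pos hNr, div_lt_iff₀ hNr, abs_sub_comm]
    calc |N * Q p - round (N * Q p)| < η := happ p
      _ ≤ δ := min_le_left _ _
      _ ≤ δ * N := le_mul_of_one_le_right hδ.le hN1
  have hmem : ∀ {Q : X × Y → ℝ}, Q ∈ stdSimplex ℝ (X × Y) →
      margX (frac N fun p => (round (N * Q p)).toNat) = P → margX Q = P →
      frac N (fun p => (round (N * Q p)).toNat) ∈ stdSimplex ℝ (X × Y) := by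
    intro Q hQ h1 h2
    exact ⟨fun p => by unfold frac; positivity, by rw [← sum_margX, h1, ← h2, sum_margX, hQ.2]⟩
  have hX1 : margX (frac N fun p => (round (N * Q p)).toNat) = P :=
    funext (hX hp.1.1 hp.2.2.1 happ1)
  have hX2 : margX (frac N fun p => (round (N * Q' p)).toNat) = P :=
    funext (hX hp.2.1.1 hp.2.2.2.1 happ2)
  refine ⟨N, hNpos, fun p => (round (N * Q p)).toNat, fun p => (round (N * Q' p)).toNat,
    ⟨hmem hp.1 hX1 hp.2.2.1, hmem hp.2.1 hX2 hp.2.2.2.1, hX1, hX2, ?_⟩,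
    fun p h => by simp [h], fun p h => by simp [h], hnear hp.1.1 happ1, hnear hp.2.1.1 happ2⟩
  funext y
  have h1 : ∑ x, round (N * Q (x, y)) = ∑ x, round (N * Q' (x, y)) := by
    apply int_eq_of_abs_sub_lt_one
    have h2 : ∑ x, N * Q (x, y) = ∑ x, N * Q' (x, y) := by
      rw [← mul_sum, ← mul_sum]
      congr 1
      exact congrFun hp.2.2.2.2 y
    push_cast
    have h3 : ∑ x, (round (N * Q (x, y)) : ℝ) - ∑ x, (round (N * Q' (x, y)) : ℝ) =
        ∑ x, ((round (N * Q (x, y)) - N * Q (x, y)) + (N * Q' (x, y) - round (N * Q' (x, y)))) := by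
      rw [sum_add_distrib, sum_sub_distrib, sum_sub_distrib, h2]; ring
    rw [h3]
    calc |∑ x, ((round (N * Q (x, y)) - N * Q (x, y)) + (N * Q' (x, y) - round (N * Q' (x, y))))|
        ≤ ∑ x, |(round (N * Q (x, y)) - N * Q (x, y)) + (N * Q' (x, y) - round (N * Q' (x, y)))| :=
          abs_sum_le_sum_abs _ _
      _ ≤ ∑ _x : X, (η + η) := sum_le_sum fun x _ => (abs_add_le _ _).trans
          (add_le_add (by rw [abs_sub_comm]; exact (happ1 _).le) (happ2 _).le)
      _ = 2 * Fintype.card X * η := by simp; ring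
      _ < C * η := mul_lt_mul_of_pos_right (by
          have h4 : (0 : ℝ) ≤ Fintype.card X := Nat.cast_nonneg _
          have h5 : (0 : ℝ) ≤ Fintype.card Y := Nat.cast_nonneg _
          rw [hC]; linarith) hη0
      _ ≤ 1 := hηC
  have h3 : ∑ x, ((round (N * Q (x, y))).toNat : ℤ) = ∑ x, ((round (N * Q' (x, y))).toNat : ℤ) := by
    rw [sum_congr rfl fun x _ => hround hp.1.1 (x, y),
      sum_congr rfl fun x _ => hround hp.2.1.1 (x, y), h1]
  have h4 : ∑ x, ((round (N * Q (x, y))).toNat : ℝ) = ∑ x, ((round (N * Q' (x, y))).toNat : ℝ) := by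
    exact_mod_cast h3
  simp only [margY, frac, ← sum_div]
  rw [h4]

end Approximation

/-! ### Averages over random codebooks -/

section Codebooks

open Finset

variable {α : Type*} {A : Finset α} {M : ℕ}

/-- The average of a function over a finite set. -/
noncomputable def mean (A : Finset α) (f : α → ℝ) : ℝ := (∑ x ∈ A, f x) / #A

/-- The average over the codebooks of `M` independent codewords, uniform in `A`. -/
noncomputable def cavg (A : Finset α) (M : ℕ) (F : (Fin M → α) → ℝ) : ℝ :=
  mean (Fintype.piFinset fun _ => A) F

lemma mean_mono {f g : α → ℝ} (h : ∀ x, f x ≤ g x) : mean A f ≤ mean A g := by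
  unfold mean
  gcongr with x
  exact h x

lemma mean_nonneg {f : α → ℝ} (h : ∀ x, 0 ≤ f x) : 0 ≤ mean A f :=
  _root_.div_nonneg (sum_nonneg fun x _ => h x) (Nat.cast_nonneg _)

lemma mean_add (f g : α → ℝ) : mean A (fun x => f x + g x) = mean A f + mean A g := by
  simp only [mean, sum_add_distrib, add_div]

lemma mean_sub (f g : α → ℝ) : mean A (fun x => f x - g x) = mean A f - mean A g := by
  simp only [mean, sum_sub_distrib, sub_div]

lemma mean_const_mul (c : ℝ) (f : α → ℝ) : mean A (fun x => c * f x) = c * mean A f := by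
  simp only [mean, ← mul_sum, mul_div_assoc]

lemma mean_sum {ι : Type*} (s : Finset ι) (f : ι → α → ℝ) :
    mean A (fun x => ∑ i ∈ s, f i x) = ∑ i ∈ s, mean A (f i) := by
  simp only [mean]
  rw [sum_comm, sum_div]

lemma mean_one (hA : A.Nonempty) : mean A (fun _ => 1) = 1 := by
  have : (#A : ℝ) ≠ 0 := Nat.cast_ne_zero.2 (card_pos.2 hA).ne'
  simp [mean, this]

lemma cavg_prod (φ : Fin M → α → ℝ) :
    cavg A M (fun C => ∏ i, φ i (C i)) = ∏ i, mean A (φ i) := by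
  rw [cavg, mean, ← prod_univ_sum, Fintype.card_piFinset]
  simp only [mean, prod_div_distrib, Nat.cast_prod]

/-- The average of a product over the codewords factorizes: the codewords are independent. -/
lemma cavg_mul_prod_erase (m : Fin M) (u : α → ℝ) (ψ : Fin M → α → ℝ) :
    cavg A M (fun C => u (C m) * ∏ j ∈ univ.erase m, ψ j (C j)) =
      mean A u * ∏ j ∈ univ.erase m, mean A (ψ j) := by
  have h := cavg_prod (A := A) (Function.update ψ m u)
  rw [← mul_prod_erase univ _ (mem_univ m)] at h
  simp only [Function.update_self] at h
  rw [prod_congr rfl fun j hj => by rw [Function.update_of_ne (ne_of_mem_erase hj)]] at h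
  rw [← h]
  congr 1
  funext C
  rw [← mul_prod_erase univ _ (mem_univ m)]
  simp only [Function.update_self]
  congr 1
  exact prod_congr rfl fun j hj => by rw [Function.update_of_ne (ne_of_mem_erase hj)]

lemma cavg_mul_prod_subset (hA : A.Nonempty) (m : Fin M) (u b : α → ℝ) {s : Finset (Fin M)}
    (hs : s ⊆ univ.erase m) :
    cavg A M (fun C => u (C m) * ∏ j ∈ s, b (C j)) = mean A u * mean A b ^ #s := by
  classical
  have h := cavg_mul_prod_erase (A := A) m u fun j => if j ∈ s then b else fun _ => 1
  have h1 : ∀ C : Fin M → α, ∏ j ∈ univ.erase m, (if j ∈ s then b else fun _ => 1) (C j) =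
      ∏ j ∈ s, b (C j) := fun C => by
    rw [← prod_subset hs (f := fun j => (if j ∈ s then b else fun _ => 1) (C j))]
    · exact prod_congr rfl fun j hj => by rw [if_pos hj]
    · exact fun j _ hj => by rw [if_neg hj]
  have h2 : ∏ j ∈ univ.erase m, mean A (if j ∈ s then b else fun _ => 1) = mean A b ^ #s := by
    rw [← prod_subset hs, prod_congr rfl fun j hj => by rw [if_pos hj], prod_const]
    exact fun j _ hj => by rw [if_neg hj, mean_one hA]
  simpa only [h1, h2] using h

/-- The total weight `b` of the codewords other than the `m`-th. -/
noncomputable def others (b : α → ℝ) (m : Fin M) (C : Fin M → α) : ℝ :=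
  ∑ j ∈ univ.erase m, b (C j)

section Indicator

variable {b u : α → ℝ}

lemma others_eq_zero_or_one_le (hb : ∀ x, b x = 0 ∨ b x = 1) (m : Fin M) (C : Fin M → α) :
    others b m C = 0 ∨ 1 ≤ others b m C := by
  have hb0 : ∀ x, 0 ≤ b x := fun x => by rcases hb x with h | h <;> simp [h]
  by_cases h : ∀ j ∈ univ.erase m, b (C j) = 0
  · exact Or.inl (sum_eq_zero h)
  · push Not at h
    obtain ⟨j, hj, h⟩ := h
    refine Or.inr ?_
    rw [← (hb (C j)).resolve_left h]
    exact single_le_sum (f := fun j => b (C j)) (fun j _ => hb0 _) hj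

lemma others_nonneg (hb : ∀ x, b x = 0 ∨ b x = 1) (m : Fin M) (C : Fin M → α) :
    0 ≤ others b m C := by
  rcases others_eq_zero_or_one_le hb m C with h | h <;> linarith

lemma cavg_fst (hA : A.Nonempty) (m : Fin M) : cavg A M (fun C => u (C m)) = mean A u := by
  simpa using cavg_mul_prod_subset hA m u (fun _ => 1) (empty_subset _)

lemma cavg_mul_others (hA : A.Nonempty) (m : Fin M) :
    cavg A M (fun C => u (C m) * others b m C) = mean A u * (((M : ℝ) - 1) * mean A b) := by
  have hM : 1 ≤ M := Nat.one_le_of_lt m.2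
  simp only [others, mul_sum]
  rw [cavg, mean_sum, sum_congr rfl fun j hj => ?_]
  rotate_left
  · exact fun _ => mean A u * mean A b
  · have := cavg_mul_prod_subset (A := A) hA m u b (s := {j}) (by simpa using hj)
    simp only [prod_singleton, card_singleton, pow_one] at this
    exact this
  · rw [sum_const, card_erase_of_mem (mem_univ m), card_univ, Fintype.card_fin, nsmul_eq_mul,
      Nat.cast_sub hM]
    push_cast
    ring

lemma cavg_mul_others_sq_le (hA : A.Nonempty) (hu : ∀ x, 0 ≤ u x) (hb : ∀ x, b x = 0 ∨ b x = 1)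
    (m : Fin M) :
    cavg A M (fun C => u (C m) * others b m C ^ 2) ≤ mean A u *
      (((M : ℝ) - 1) * mean A b + (((M : ℝ) - 1) * mean A b) ^ 2) := by
  classical
  have hM : 1 ≤ M := Nat.one_le_of_lt m.2
  have hb0 : ∀ x, 0 ≤ b x := fun x => by rcases hb x with h | h <;> simp [h]
  have hu' := mean_nonneg (A := A) hu
  have hb' := mean_nonneg (A := A) hb0
  have hterm : ∀ j ∈ univ.erase m, ∀ k ∈ univ.erase m,
      cavg A M (fun C => u (C m) * (b (C j) * b (C k))) ≤
        mean A u * ((if j = k then mean A b else 0) + mean A b ^ 2) := by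
    intro j hj k hk
    split_ifs with hjk
    · subst hjk
      have := cavg_mul_prod_subset (A := A) hA m u b (s := {j}) (by simpa using hj)
      simp only [prod_singleton, card_singleton, pow_one] at this
      have hbb : ∀ x, b x * b x = b x := fun x => by rcases hb x with h | h <;> simp [h]
      simp only [hbb, this]
      nlinarith [mul_nonneg hu' (sq_nonneg (mean A b))]
    · have := cavg_mul_prod_subset (A := A) hA m u b (s := {j, k}) (by
        intro i hi
        rcases mem_insert.1 hi with rfl | hi
        · exact hj
        · rw [mem_singleton.1 hi]; exact hk)
      simp only [prod_pair hjk, card_pair hjk] at this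
      rw [this, zero_add]
  have hexp : (fun C : Fin M → α => u (C m) * others b m C ^ 2) = fun C =>
      ∑ j ∈ univ.erase m, ∑ k ∈ univ.erase m, u (C m) * (b (C j) * b (C k)) := by
    funext C
    rw [others, sq, sum_mul_sum, mul_sum]
    exact sum_congr rfl fun j _ => mul_sum _ _ _
  rw [hexp, cavg, mean_sum]
  calc ∑ j ∈ univ.erase m, mean (Fintype.piFinset fun _ : Fin M => A)
        (fun C => ∑ k ∈ univ.erase m, u (C m) * (b (C j) * b (C k)))
      ≤ ∑ j ∈ univ.erase m, ∑ k ∈ univ.erase m,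
          mean A u * ((if j = k then mean A b else 0) + mean A b ^ 2) := by
        refine sum_le_sum fun j hj => ?_
        rw [mean_sum]
        exact sum_le_sum fun k hk => hterm j hj k hk
    _ = mean A u * (((M : ℝ) - 1) * mean A b + (((M : ℝ) - 1) * mean A b) ^ 2) := by
        simp only [← mul_sum, sum_add_distrib, sum_const, card_erase_of_mem (mem_univ m),
          card_univ, Fintype.card_fin, nsmul_eq_mul, Nat.cast_sub hM]
        rw [sum_congr rfl fun j hj => by rw [sum_ite_eq, if_pos hj]]
        simp only [sum_const, card_erase_of_mem (mem_univ m), card_univ, Fintype.card_fin,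
          nsmul_eq_mul, Nat.cast_sub hM]
        push_cast
        ring

/-- The moment generating function of a binomial variable at `log 2`, bounded by that of a Poisson
variable of the same mean. -/
lemma cavg_mul_exp_others_le (hu : ∀ x, 0 ≤ u x) (hb : ∀ x, b x = 0 ∨ b x = 1)
    (hA : A.Nonempty) (m : Fin M) :
    cavg A M (fun C => u (C m) * Real.exp (others b m C * Real.log 2)) ≤
      mean A u * Real.exp (((M : ℝ) - 1) * mean A b) := by
  have hM : 1 ≤ M := Nat.one_le_of_lt m.2
  have hb0 : ∀ x, 0 ≤ b x := fun x => by rcases hb x with h | h <;> simp [h]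
  have hb' := mean_nonneg (A := A) hb0
  have hexp : (fun C : Fin M → α => u (C m) * Real.exp (others b m C * Real.log 2)) =
      fun C => u (C m) * ∏ j ∈ univ.erase m, (fun x => 1 + b x) (C j) := by
    funext C
    rw [others, sum_mul, Real.exp_sum]
    congr 1
    refine prod_congr rfl fun j _ => ?_
    rcases hb (C j) with h | h
    · simp [h]
    · simp only [h, one_mul, Real.exp_log two_pos]
      norm_num
  rw [hexp, cavg_mul_prod_erase m u fun _ x => 1 + b x, prod_const,
    card_erase_of_mem (mem_univ m), card_univ, Fintype.card_fin, mean_add, mean_one hA]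
  refine mul_le_mul_of_nonneg_left ?_ (mean_nonneg hu)
  calc (1 + mean A b) ^ (M - 1) ≤ Real.exp (mean A b) ^ (M - 1) := by
        refine pow_le_pow_left₀ (by linarith) ?_ _
        linarith [Real.add_one_le_exp (mean A b)]
    _ = Real.exp (((M : ℝ) - 1) * mean A b) := by
        rw [← Real.exp_nat_mul, Nat.cast_sub hM, Nat.cast_one]

/-- The average of `min (N a) c`, where `N` is the number of the other codewords that satisfy `b`,
is at most what Jensen's inequality and `min (N a) c ≤ N min a c` give. -/
lemma cavg_mul_min_le (hA : A.Nonempty) (hu : ∀ x, 0 ≤ u x) (hb : ∀ x, b x = 0 ∨ b x = 1)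
    (m : Fin M) {a c : ℝ} (hc : 0 ≤ c) :
    cavg A M (fun C => u (C m) * min (others b m C * a) c) ≤ mean A u *
      min (((M : ℝ) - 1) * mean A b * a) (min (((M : ℝ) - 1) * mean A b * c) c) := by
  have h : ∀ d, (∀ C : Fin M → α, min (others b m C * a) c ≤ others b m C * d) →
      cavg A M (fun C => u (C m) * min (others b m C * a) c) ≤
        mean A u * (((M : ℝ) - 1) * mean A b * d) := by
    intro d hd
    calc cavg A M (fun C => u (C m) * min (others b m C * a) c)
        ≤ cavg A M (fun C => d * (u (C m) * others b m C)) := mean_mono fun C => by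
          have := mul_le_mul_of_nonneg_left (hd C) (hu (C m))
          linarith
      _ = mean A u * (((M : ℝ) - 1) * mean A b * d) := by
          rw [cavg, mean_const_mul, ← cavg, cavg_mul_others hA]; ring
  rw [mul_min_of_nonneg _ _ (mean_nonneg hu), mul_min_of_nonneg _ _ (mean_nonneg hu)]
  refine le_min (h a fun C => min_le_left _ _) (le_min (h c fun C => ?_) ?_)
  · rcases others_eq_zero_or_one_le hb m C with h0 | h0
    · simp [h0]
    · exact (min_le_right _ _).trans (le_mul_of_one_le_left hc h0)
  · calc cavg A M (fun C => u (C m) * min (others b m C * a) c)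
        ≤ cavg A M (fun C => c * u (C m)) := mean_mono fun C => by
          have := mul_le_mul_of_nonneg_left (min_le_right (others b m C * a) c) (hu (C m))
          linarith
      _ = mean A u * c := by rw [cavg, mean_const_mul, ← cavg, cavg_fst hA, mul_comm]

/-- The upper bound of `cavg_mul_min_le` is tight up to the factor 2, by the second moment: the
bound is attained by the lower estimate `s N - (s N)² / (4 c)` of `min (N a) c` for the best
`s ≤ a`. -/
lemma le_cavg_mul_min (hA : A.Nonempty) (hu : ∀ x, 0 ≤ u x) (hb : ∀ x, b x = 0 ∨ b x = 1)
    (m : Fin M) {a c : ℝ} (ha : 0 ≤ a) (hc : 0 ≤ c) :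
    mean A u * (min (((M : ℝ) - 1) * mean A b * a) (min (((M : ℝ) - 1) * mean A b * c) c) / 2) ≤
      cavg A M (fun C => u (C m) * min (others b m C * a) c) := by
  have hM : (1 : ℝ) ≤ M := by exact_mod_cast Nat.one_le_of_lt m.2
  have hb0 : ∀ x, 0 ≤ b x := fun x => by rcases hb x with h | h <;> simp [h]
  set μ := ((M : ℝ) - 1) * mean A b with hμ
  have hμ0 : 0 ≤ μ := mul_nonneg (by linarith) (mean_nonneg hb0)
  have hu' := mean_nonneg (A := A) hu
  have hpos : 0 ≤ cavg A M (fun C => u (C m) * min (others b m C * a) c) :=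
    mean_nonneg fun C => mul_nonneg (hu _) (le_min (mul_nonneg (others_nonneg hb m C) ha) hc)
  rcases hμ0.eq_or_lt with h0 | h0
  · refine le_trans (le_of_eq ?_) hpos
    rw [← h0, zero_mul, zero_mul, min_eq_left hc, min_self]
    simp
  rcases hc.eq_or_lt with hc0 | hc0
  · refine le_trans (le_of_eq ?_) hpos
    rw [← hc0, mul_zero, min_self, min_eq_right (by positivity)]
    simp
  set s := min a (min c (c / μ)) with hs
  have hs0 : 0 ≤ s := le_min ha (le_min hc (by positivity))
  have hsa : s ≤ a := min_le_left _ _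
  have hsc : s ≤ c := (min_le_right _ _).trans (min_le_left _ _)
  have hsμ : s * μ ≤ c := by
    rw [← le_div_iff₀ h0]; exact (min_le_right _ _).trans (min_le_right _ _)
  have hmin : min (μ * a) (min (μ * c) c) = s * μ := by
    rw [hs, mul_comm _ μ, mul_min_of_nonneg _ _ hμ0, mul_min_of_nonneg _ _ hμ0,
      mul_div_cancel₀ _ h0.ne']
  rw [hmin]
  have hpt : ∀ C : Fin M → α, s * others b m C - s ^ 2 / (4 * c) * others b m C ^ 2 ≤
      min (others b m C * a) c := by
    intro C
    have hN := others_nonneg hb m C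
    refine le_min ?_ ?_
    · have h1 : s * others b m C ≤ others b m C * a := by
        rw [mul_comm]; exact mul_le_mul_of_nonneg_left hsa hN
      have h2 : 0 ≤ s ^ 2 / (4 * c) * others b m C ^ 2 := by positivity
      linarith
    · have : c - (s * others b m C - s ^ 2 / (4 * c) * others b m C ^ 2) =
          (s * others b m C - 2 * c) ^ 2 / (4 * c) := by
        field_simp
        ring
      have h2 : 0 ≤ (s * others b m C - 2 * c) ^ 2 / (4 * c) := by positivity
      linarith
  have h1 := cavg_mul_others_sq_le hA hu hb m
  calc mean A u * (s * μ / 2)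
      ≤ s * (mean A u * μ) - s ^ 2 / (4 * c) * (mean A u * (μ + μ ^ 2)) := by
        have h3 : s ^ 2 / (4 * c) * (mean A u * (μ + μ ^ 2)) =
            mean A u * (s * μ) * ((s + s * μ) / (4 * c)) := by
          field_simp
        have h4 : (s + s * μ) / (4 * c) ≤ 1 / 2 := by
          rw [div_le_iff₀ (by positivity)]; linarith
        have h5 := mul_le_mul_of_nonneg_left h4
          (mul_nonneg hu' (mul_nonneg hs0 hμ0))
        rw [h3]
        linarith
    _ ≤ s * (mean A u * μ) -
          s ^ 2 / (4 * c) * cavg A M (fun C => u (C m) * others b m C ^ 2) := by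
        have := mul_le_mul_of_nonneg_left h1 (by positivity : 0 ≤ s ^ 2 / (4 * c))
        linarith
    _ = cavg A M (fun C => s * (u (C m) * others b m C) -
          s ^ 2 / (4 * c) * (u (C m) * others b m C ^ 2)) := by
        rw [show mean A u * μ = _ from (cavg_mul_others hA m).symm]
        simp only [cavg, mean_sub, mean_const_mul]
    _ ≤ _ := mean_mono fun C => by
        have := mul_le_mul_of_nonneg_left (hpt C) (hu (C m))
        linarith

lemma cavg_ite_one_le (hA : A.Nonempty) (hu : ∀ x, 0 ≤ u x) (hb : ∀ x, b x = 0 ∨ b x = 1)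
    (m : Fin M) :
    cavg A M (fun C => u (C m) * if 1 ≤ others b m C then 1 else 0) ≤
      mean A u * min (((M : ℝ) - 1) * mean A b) 1 := by
  have h := cavg_mul_min_le hA hu hb m (a := 1) zero_le_one
  simp only [mul_one] at h
  rw [← min_assoc, min_self] at h
  refine le_trans (mean_mono fun C => mul_le_mul_of_nonneg_left ?_ (hu _)) h
  split_ifs with h1
  · rw [min_eq_right h1]
  · exact le_min (others_nonneg hb m C) zero_le_one

/-- The number of the other codewords that satisfy `b` exceeds a quarter of `max 1 μ` with a
probability of order `min μ 1`, where `μ` is its mean. This follows from the two-sided bound on the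
average of `min (N / max 1 μ) 1`. -/
lemma le_cavg_ite_lt (hA : A.Nonempty) (hu : ∀ x, 0 ≤ u x) (hb : ∀ x, b x = 0 ∨ b x = 1)
    (m : Fin M) :
    mean A u * (min (((M : ℝ) - 1) * mean A b) 1 / 4) ≤
      cavg A M (fun C => u (C m) *
        if max 1 (((M : ℝ) - 1) * mean A b) / 4 < others b m C then 1 else 0) := by
  have hM : (1 : ℝ) ≤ M := by exact_mod_cast Nat.one_le_of_lt m.2
  have hb0 : ∀ x, 0 ≤ b x := fun x => by rcases hb x with h | h <;> simp [h]
  set μ := ((M : ℝ) - 1) * mean A b with hμ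
  have hμ0 : 0 ≤ μ := mul_nonneg (by linarith) (mean_nonneg hb0)
  have hmax : 0 < max 1 μ := lt_max_of_lt_left one_pos
  have h1 := cavg_mul_min_le hA hu hb m (a := 1) zero_le_one
  have h2 := le_cavg_mul_min hA hu hb m (a := 1 / max 1 μ) (c := 1) (by positivity) zero_le_one
  rw [← hμ] at h1 h2
  simp only [mul_one] at h1 h2
  rw [← min_assoc, min_self] at h1
  have h3 : min (μ * (1 / max 1 μ)) (min μ 1) = min μ 1 := by
    refine min_eq_right ?_
    rw [mul_one_div, le_div_iff₀ hmax]
    rcases le_total μ 1 with h | h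
    · rw [min_eq_left h, max_eq_left h, mul_one]
    · rw [min_eq_right h, max_eq_right h, one_mul]
  rw [h3] at h2
  have h4 : cavg A M (fun C => u (C m) * min (others b m C * (1 / max 1 μ)) 1) ≤
      cavg A M (fun C => (u (C m) * if max 1 μ / 4 < others b m C then 1 else 0) +
        1 / 4 * (u (C m) * min (others b m C) 1)) := by
    refine mean_mono fun C => ?_
    have : min (others b m C * (1 / max 1 μ)) 1 ≤
        (if max 1 μ / 4 < others b m C then 1 else 0) + 1 / 4 * min (others b m C) 1 := by
      have hN := others_nonneg hb m C
      split_ifs with h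
      · have : 0 ≤ min (others b m C) 1 := le_min hN zero_le_one
        linarith [min_le_right (others b m C * (1 / max 1 μ)) 1]
      · rcases others_eq_zero_or_one_le hb m C with h0 | h0
        · simp [h0]
        · rw [min_eq_right h0]
          have : others b m C * (1 / max 1 μ) ≤ 1 / 4 := by
            rw [mul_one_div, div_le_iff₀ hmax]; linarith [not_lt.1 h]
          linarith [min_le_left (others b m C * (1 / max 1 μ)) 1]
    have := mul_le_mul_of_nonneg_left this (hu (C m))
    linarith
  rw [cavg, cavg, mean_add, mean_const_mul, ← cavg, ← cavg, ← cavg] at h4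
  linarith

/-- Markov's inequality for `2 ^ N`. -/
lemma cavg_ite_le (hA : A.Nonempty) (hu : ∀ x, 0 ≤ u x) (hb : ∀ x, b x = 0 ∨ b x = 1)
    (m : Fin M) (k : ℝ) :
    cavg A M (fun C => u (C m) * if k ≤ others b m C then 1 else 0) ≤
      mean A u * Real.exp (((M : ℝ) - 1) * mean A b - k * Real.log 2) := by
  have hlog : 0 < Real.log 2 := Real.log_pos one_lt_two
  calc cavg A M (fun C => u (C m) * if k ≤ others b m C then 1 else 0)
      ≤ cavg A M (fun C => Real.exp (-(k * Real.log 2)) *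
          (u (C m) * Real.exp (others b m C * Real.log 2))) := by
        refine mean_mono fun C => ?_
        have : (if k ≤ others b m C then (1 : ℝ) else 0) ≤
            Real.exp (-(k * Real.log 2)) * Real.exp (others b m C * Real.log 2) := by
          split_ifs with h
          · rw [← Real.exp_add]
            refine Real.one_le_exp ?_
            nlinarith
          · positivity
        have := mul_le_mul_of_nonneg_left this (hu (C m))
        linarith
    _ = Real.exp (-(k * Real.log 2)) *
          cavg A M (fun C => u (C m) * Real.exp (others b m C * Real.log 2)) := by
        rw [cavg, mean_const_mul, ← cavg]
    _ ≤ Real.exp (-(k * Real.log 2)) * (mean A u * Real.exp (((M : ℝ) - 1) * mean A b)) :=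
        mul_le_mul_of_nonneg_left (cavg_mul_exp_others_le hu hb hA m) (Real.exp_pos _).le
    _ = _ := by rw [sub_eq_add_neg (((M : ℝ) - 1) * mean A b), Real.exp_add]; ring

end Indicator

end Codebooks

/-! ### Random codes and joint types -/

section RandomCoding

open Finset

variable {X Y : Type*} [Fintype X] [DecidableEq X] [Fintype Y] [DecidableEq Y] {n : ℕ}
  {P : X → ℝ} {R T : ℝ}

/-- The product `∏ W(y|x) ^ q(x, y)`. -/
noncomputable def prodW (W : X → Y → ℝ) (q : X × Y → ℕ) : ℝ := ∏ p, W p.1 p.2 ^ q p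

lemma channelN_eq_prodW (W : X → Y → ℝ) (x : Fin n → X) (y : Fin n → Y) :
    channelN W x y = prodW W (jcnt x y) := by
  rw [channelN, prodW]
  exact (prod_comp (fun p : X × Y => W p.1 p.2) fun i => (x i, y i)).trans
    (prod_subset (subset_univ _) fun p _ hp => by
      have : jcnt x y p = 0 := by
        rw [jcnt, cnt, card_eq_zero, filter_eq_empty_iff]
        intro i _ hi
        exact hp (mem_image.2 ⟨i, mem_univ _, hi⟩)
      exact (congrArg (fun k => W p.1 p.2 ^ k) this).trans (pow_zero _))

lemma prodW_nonneg {W : X → Y → ℝ} (hW : ∀ x, W x ∈ stdSimplex ℝ Y) (q : X × Y → ℕ) :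
    0 ≤ prodW W q := prod_nonneg fun _ _ => pow_nonneg ((hW _).1 _) _

lemma prodW_le_one {W : X → Y → ℝ} (hW : ∀ x, W x ∈ stdSimplex ℝ Y) (q : X × Y → ℕ) :
    prodW W q ≤ 1 := prod_le_one (fun _ _ => pow_nonneg ((hW _).1 _) _) fun p _ =>
      pow_le_one₀ ((hW _).1 _) (mem_Icc_of_mem_stdSimplex (hW p.1) p.2).2

lemma prodW_eq_exp {W : X → Y → ℝ} (hW : ∀ x, W x ∈ stdSimplex ℝ Y) (hn : n ≠ 0)
    {q : X × Y → ℕ} (h : SuppIn (frac n q) W) :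
    prodW W q = Real.exp (n * linLog (frac n q) W) := by
  rw [prodW, linLog, mul_sum, Real.exp_sum]
  refine prod_congr rfl fun p _ => ?_
  have hn' : (n : ℝ) ≠ 0 := Nat.cast_ne_zero.2 hn
  rcases ((hW p.1).1 p.2).eq_or_lt with h0 | h0
  · have h1 := h p h0.symm
    have h2 : q p = 0 := by
      simp only [frac, div_eq_zero_iff, Nat.cast_eq_zero, hn, or_false] at h1
      exact h1
    simp [h2, frac]
  · have : n * (frac n q p * Real.log (W p.1 p.2)) = q p * Real.log (W p.1 p.2) := by
      rw [frac]; field_simp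
    rw [this, mul_comm, Real.exp_mul, Real.exp_log h0, Real.rpow_natCast]

lemma suppIn_of_prodW_pos {W : X → Y → ℝ} {q : X × Y → ℕ} (h : 0 < prodW W q) :
    SuppIn (frac n q) W := by
  intro p hp
  by_contra h0
  have h1 : q p ≠ 0 := fun h2 => h0 (by simp [frac, h2])
  exact h.ne' (prod_eq_zero (mem_univ p) (by rw [hp, zero_pow h1]))

/-- The finite set in which all joint types of blocklength `n` are contained. -/
def typeVecs (X Y : Type*) [Fintype X] [DecidableEq X] [Fintype Y] [DecidableEq Y] (n : ℕ) :
    Finset (X × Y → ℕ) := Fintype.piFinset fun _ => range (n + 1)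

lemma jcnt_mem_typeVecs (x : Fin n → X) (y : Fin n → Y) : jcnt x y ∈ typeVecs X Y n :=
  Fintype.mem_piFinset.2 fun p => mem_range.2 (Nat.lt_succ_of_le (cnt_le _ p))

lemma card_typeVecs : (#(typeVecs X Y n) : ℝ) = ((n : ℝ) + 1) ^ Fintype.card (X × Y) := by
  simp [typeVecs]

/-- The indicator function of the vectors that have joint type `q` with `y`. -/
def tind (y : Fin n → Y) (q : X × Y → ℕ) (x : Fin n → X) : ℝ := if jcnt x y = q then 1 else 0

lemma tind_nonneg (y : Fin n → Y) (q : X × Y → ℕ) (x : Fin n → X) : 0 ≤ tind y q x := by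
  unfold tind; split_ifs <;> norm_num

lemma tind_eq (y : Fin n → Y) (q : X × Y → ℕ) (x : Fin n → X) :
    tind y q x = 0 ∨ tind y q x = 1 := by
  unfold tind; split_ifs <;> simp

lemma mean_tind (y : Fin n → Y) (q : X × Y → ℕ) :
    mean (typeClass P n) (tind y q) = typeProb P y q := by
  simp [mean, tind, typeProb]

lemma sum_tind_mul (y : Fin n → Y) (x : Fin n → X) (f : (X × Y → ℕ) → ℝ) :
    ∑ q ∈ typeVecs X Y n, tind y q x * f q = f (jcnt x y) := by
  simp only [tind, ite_mul, one_mul, zero_mul]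
  rw [sum_ite_eq, if_pos (jcnt_mem_typeVecs x y)]

lemma sum_others_tind_mul {M : ℕ} (y : Fin n → Y) (C : Fin M → Fin n → X) (m : Fin M)
    (f : (X × Y → ℕ) → ℝ) :
    ∑ q ∈ typeVecs X Y n, others (tind y q) m C * f q =
      ∑ j ∈ univ.erase m, f (jcnt (C j) y) := by
  simp only [others, sum_mul]
  rw [sum_comm]
  exact sum_congr rfl fun j _ => sum_tind_mul y (C j) f

lemma exists_of_typeProb_pos {y : Fin n → Y} {q : X × Y → ℕ} (h : 0 < typeProb P y q) :
    ∃ x ∈ typeClass P n, jcnt x y = q := by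
  by_contra hcon
  push Not at hcon
  have : ({x ∈ typeClass P n | jcnt x y = q} : Finset (Fin n → X)) = ∅ :=
    filter_eq_empty_iff.2 fun x hx => hcon x hx
  simp [typeProb, this] at h

lemma frac_jcnt_mem (hn : n ≠ 0) (x : Fin n → X) (y : Fin n → Y) :
    frac n (jcnt x y) ∈ stdSimplex ℝ (X × Y) := frac_mem_stdSimplex hn (sum_cnt _)

/-- Joint types with the same `y` are in `pairs P`. -/
lemma pairs_of_typeProb_pos (hn : n ≠ 0) {y : Fin n → Y} {q q' : X × Y → ℕ}
    (h : 0 < typeProb P y q) (h' : 0 < typeProb P y q') : (frac n q, frac n q') ∈ pairs P := by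
  obtain ⟨x, hx, rfl⟩ := exists_of_typeProb_pos h
  obtain ⟨x', hx', rfl⟩ := exists_of_typeProb_pos h'
  refine ⟨frac_jcnt_mem hn x y, frac_jcnt_mem hn x' y, ?_, ?_, ?_⟩
  · exact (margX_frac_jcnt x y).trans (mem_typeClass.1 hx)
  · exact (margX_frac_jcnt x' y).trans (mem_typeClass.1 hx')
  · exact (margY_frac_jcnt x y).trans (margY_frac_jcnt x' y).symm

lemma margY_eq_of_mem_seqs {q q' : X × Y → ℕ} {y : Fin n → Y}
    (h : margY (frac n q) = margY (frac n q')) (hy : y ∈ seqs n fun b => ∑ a, q' (a, b)) :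
    margY (frac n q) = frac n (cnt y) := by
  rw [h, margY_frac, mem_seqs.1 hy]

/-- The joint type determines the type of `y`. -/
lemma sum_univ_typeProb (q : X × Y → ℕ) : ∑ y : Fin n → Y, typeProb P y q =
    ∑ y ∈ seqs n (fun b => ∑ a, q (a, b)), typeProb P y q := by
  refine (sum_subset (subset_univ _) fun y _ hy => ?_).symm
  by_contra hcon
  obtain ⟨x, -, rfl⟩ :=
    exists_of_typeProb_pos (lt_of_le_of_ne (typeProb_nonneg P y q) (Ne.symm hcon))
  exact hy (mem_seqs.2 (funext fun b => (sum_jcnt_snd x y b).symm))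

/-- The error term in the exponential estimates for random codes. -/
noncomputable def codeErr (X Y : Type*) [Fintype X] [Fintype Y] (n : ℕ) : ℝ := typeErr X Y n + 1

lemma typeErr_nonneg (n : ℕ) : 0 ≤ typeErr X Y n :=
  mul_nonneg (by positivity) (one_add_log_nonneg n)

lemma numMsg_bounds (hR : 0 < R) (hn : n ≠ 0) :
    Real.exp (n * R) / 2 ≤ (numMsg R n : ℝ) - 1 ∧ (numMsg R n : ℝ) - 1 ≤ Real.exp (n * R) ∧
      0 < numMsg R n := by
  have h1 : 1 < Real.exp (n * R) :=
    Real.one_lt_exp_iff.2 (mul_pos (by exact_mod_cast Nat.pos_of_ne_zero hn) hR)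
  have h2 : Real.exp (n * R) ≤ numMsg R n := Nat.le_ceil _
  have h3 : (numMsg R n : ℝ) < Real.exp (n * R) + 1 := Nat.ceil_lt_add_one (Real.exp_pos _).le
  have h4 : 2 ≤ numMsg R n := by
    have : (1 : ℝ) < numMsg R n := h1.trans_le h2
    have : 1 < numMsg R n := by exact_mod_cast this
    omega
  have h5 : (2 : ℝ) ≤ numMsg R n := by exact_mod_cast h4
  exact ⟨by linarith, by linarith, by omega⟩

/-- The expected number of wrong codewords that have joint type `q` with `y` is about
`exp (n (R - I))`. -/
lemma expected_number_bounds (hR : 0 < R) (hn : n ≠ 0) {q : X × Y → ℕ}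
    (hq : frac n q ∈ stdSimplex ℝ (X × Y)) (hqX : margX (frac n q) = P) {y : Fin n → Y}
    (hy : margY (frac n q) = frac n (cnt y)) :
    Real.exp (n * (R - mutualInfo (frac n q))) ≤
      Real.exp (codeErr X Y n) * (((numMsg R n : ℝ) - 1) * typeProb P y q) ∧
    ((numMsg R n : ℝ) - 1) * typeProb P y q ≤
      Real.exp (codeErr X Y n) * Real.exp (n * (R - mutualInfo (frac n q))) := by
  obtain ⟨h0, h1⟩ := abs_log_typeProb_add_le hn hq hqX y hy
  obtain ⟨h2, h3, -⟩ := numMsg_bounds hR hn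
  rw [abs_le] at h1
  set p := typeProb P y q
  set I := mutualInfo (frac n q)
  have hp : p = Real.exp (Real.log p) := (Real.exp_log h0).symm
  have h21 : (2 : ℝ) ≤ Real.exp 1 := by linarith [Real.add_one_le_exp (1 : ℝ)]
  constructor
  · calc Real.exp (n * (R - I))
        ≤ Real.exp (typeErr X Y n) * (Real.exp (n * R) * p) := by
          rw [hp, ← Real.exp_add, ← Real.exp_add]
          exact Real.exp_le_exp.2 (by linarith)
      _ ≤ Real.exp (typeErr X Y n) * (Real.exp 1 * ((numMsg R n : ℝ) - 1) * p) := by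
          refine mul_le_mul_of_nonneg_left (mul_le_mul_of_nonneg_right ?_ h0.le)
            (Real.exp_pos _).le
          nlinarith [Real.exp_pos (n * R)]
      _ = Real.exp (codeErr X Y n) * (((numMsg R n : ℝ) - 1) * p) := by
          rw [codeErr, Real.exp_add]; ring
  · calc ((numMsg R n : ℝ) - 1) * p ≤ Real.exp (n * R) * p :=
          mul_le_mul_of_nonneg_right h3 h0.le
      _ ≤ Real.exp (codeErr X Y n) * Real.exp (n * (R - I)) := by
          rw [hp, ← Real.exp_add, ← Real.exp_add, codeErr]
          exact Real.exp_le_exp.2 (by linarith)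

lemma sum_typeProb_bounds (hn : n ≠ 0) {q : X × Y → ℕ} (hq : frac n q ∈ stdSimplex ℝ (X × Y))
    (hqX : margX (frac n q) = P) :
    Real.exp (n * (ent (frac n q) - ent P)) ≤ Real.exp (codeErr X Y n) *
      ∑ y ∈ seqs n (fun b => ∑ a, q (a, b)), typeProb P y q ∧
    ∑ y ∈ seqs n (fun b => ∑ a, q (a, b)), typeProb P y q ≤
      Real.exp (codeErr X Y n) * Real.exp (n * (ent (frac n q) - ent P)) := by
  obtain ⟨h0, h1, h2⟩ := sum_typeProb hn hq hqX
  rw [← h1] at h0 h2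
  rw [abs_le] at h2
  rw [← Real.exp_log h0, ← Real.exp_add, ← Real.exp_add, codeErr]
  exact ⟨Real.exp_le_exp.2 (by linarith), Real.exp_le_exp.2 (by linarith)⟩

lemma sum_typeProb_mul_le (hn : n ≠ 0) (q : X × Y → ℕ) :
    (∑ y : Fin n → Y, typeProb P y q) *
      (Real.exp (codeErr X Y n) * Real.exp (-(n * (ent (frac n q) - ent P)))) ≤
    Real.exp (codeErr X Y n) * Real.exp (codeErr X Y n) := by
  by_cases hex : ∃ y : Fin n → Y, 0 < typeProb P y q
  · obtain ⟨y, hy⟩ := hex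
    have hp := pairs_of_typeProb_pos hn hy hy
    have h1 := (sum_typeProb_bounds hn hp.1 hp.2.2.1).2
    rw [← sum_univ_typeProb] at h1
    refine (mul_le_mul_of_nonneg_right h1 (by positivity)).trans_eq ?_
    rw [Real.exp_neg]
    field_simp
  · push Not at hex
    rw [sum_eq_zero fun y _ => le_antisymm (hex y) (typeProb_nonneg P y q), zero_mul]
    positivity

/-- The average of `min (N a) c` for a binomial number `N` with mean `μ`, up to the factor 2; see
`cavg_mul_min_le` and `le_cavg_mul_min`. -/
noncomputable def meanMin (μ a c : ℝ) : ℝ := min (μ * a) (min (μ * c) c)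

lemma meanMin_le_mul {μ ν k a c : ℝ} (hk : 1 ≤ k) (h : μ ≤ k * ν) (ha : 0 ≤ a) (hc : 0 ≤ c) :
    meanMin μ a c ≤ k * meanMin ν a c := by
  have hk0 : 0 ≤ k := by linarith
  rw [meanMin, meanMin, mul_min_of_nonneg _ _ hk0, mul_min_of_nonneg _ _ hk0, ← mul_assoc,
    ← mul_assoc]
  exact min_le_min (mul_le_mul_of_nonneg_right h ha) (min_le_min (mul_le_mul_of_nonneg_right h hc)
    (le_mul_of_one_le_left hc hk))

lemma meanMin_nonneg {μ a c : ℝ} (hμ : 0 ≤ μ) (ha : 0 ≤ a) (hc : 0 ≤ c) : 0 ≤ meanMin μ a c :=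
  le_min (mul_nonneg hμ ha) (le_min (mul_nonneg hμ hc) hc)

/-- The value of the Lagrangian at the best list decoder, if the channel `W(y|x)` is replaced by an
arbitrary function `F` of the joint type. -/
noncomputable def bestLagrangian (F : (X × Y → ℕ) → ℝ) (T : ℝ) {M : ℕ} (C : Fin M → Fin n → X) :
    ℝ :=
  (1 / (M : ℝ)) * ∑ m, ∑ y : Fin n → Y, min (∑ j ∈ univ.erase m, F (jcnt (C j) y))
    (Real.exp (-(n * T)) * F (jcnt (C m) y))

lemma cavg_bestLagrangian (F : (X × Y → ℕ) → ℝ) (A : Finset (Fin n → X)) (M : ℕ) :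
    cavg A M (bestLagrangian F T) = (1 / (M : ℝ)) * ∑ m, ∑ y : Fin n → Y,
      cavg A M (fun C => min (∑ j ∈ univ.erase m, F (jcnt (C j) y))
        (Real.exp (-(n * T)) * F (jcnt (C m) y))) := by
  unfold bestLagrangian
  rw [cavg, mean_const_mul, mean_sum]
  simp only [mean_sum, cavg]

lemma one_le_exp_codeErr : 1 ≤ Real.exp (codeErr X Y n) := by
  refine Real.one_le_exp ?_
  have := typeErr_nonneg (X := X) (Y := Y) n
  unfold codeErr
  linarith

/-- If each pair of joint types contributes at most `1` to the average of the best Lagrangian, to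
first order in the exponent, then this average is subexponential. -/
theorem cavg_bestLagrangian_le (hR : 0 < R) (hn : n ≠ 0) (hne : (typeClass P n).Nonempty)
    {F : (X × Y → ℕ) → ℝ} (hF : ∀ q, 0 ≤ F q)
    (H : ∀ q q' : X × Y → ℕ, (frac n q, frac n q') ∈ pairs P →
      Real.exp (n * (ent (frac n q') - ent P)) * meanMin
        (Real.exp (n * (R - mutualInfo (frac n q)))) (F q) (Real.exp (-(n * T)) * F q') ≤ 1) :
    cavg (typeClass P n) (numMsg R n) (bestLagrangian F T) ≤
      ((n : ℝ) + 1) ^ (2 * Fintype.card (X × Y)) * Real.exp (2 * codeErr X Y n) := by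
  obtain ⟨hM1, hM2, hM⟩ := numMsg_bounds hR hn
  have hMr : (0 : ℝ) < numMsg R n := by exact_mod_cast hM
  set K := Real.exp (codeErr X Y n) with hK
  have hK1 : 1 ≤ K := one_le_exp_codeErr
  have hK0 : 0 < K := Real.exp_pos _
  have hc0 : ∀ q, 0 ≤ Real.exp (-(n * T)) * F q := fun q => mul_nonneg (Real.exp_pos _).le (hF q)
  have hone : ∀ m : Fin (numMsg R n), ∑ y : Fin n → Y, cavg (typeClass P n) (numMsg R n)
      (fun C => min (∑ j ∈ univ.erase m, F (jcnt (C j) y))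
        (Real.exp (-(n * T)) * F (jcnt (C m) y))) ≤
      ((n : ℝ) + 1) ^ (2 * Fintype.card (X × Y)) * Real.exp (2 * codeErr X Y n) := by
    intro m
    have hpt : ∀ (y : Fin n → Y) (C : Fin (numMsg R n) → Fin n → X),
        min (∑ j ∈ univ.erase m, F (jcnt (C j) y)) (Real.exp (-(n * T)) * F (jcnt (C m) y)) ≤
        ∑ q' ∈ typeVecs X Y n, ∑ q ∈ typeVecs X Y n, tind y q' (C m) *
          min (others (tind y q) m C * F q) (Real.exp (-(n * T)) * F q') := by
      intro y C
      simp only [← mul_sum]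
      rw [sum_tind_mul y (C m) fun q' => ∑ q ∈ typeVecs X Y n,
        min (others (tind y q) m C * F q) (Real.exp (-(n * T)) * F q')]
      rw [← sum_others_tind_mul]
      set c := Real.exp (-(n * T)) * F (jcnt (C m) y) with hc
      have hcc : 0 ≤ c := hc0 _
      have hterm : ∀ q, 0 ≤ others (tind y q) m C * F q := fun q =>
        mul_nonneg (others_nonneg (tind_eq y q) m C) (hF q)
      -- The truncation at `c` is subadditive.
      by_cases hex : ∃ q ∈ typeVecs X Y n, c ≤ others (tind y q) m C * F q
      · obtain ⟨q, hq, hle⟩ := hex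
        refine (min_le_right _ _).trans ?_
        calc c = min (others (tind y q) m C * F q) c := (min_eq_right hle).symm
          _ ≤ _ := single_le_sum (f := fun q => min (others (tind y q) m C * F q) c)
            (fun q _ => le_min (hterm q) hcc) hq
      · push Not at hex
        refine (min_le_left _ _).trans (sum_le_sum fun q hq => ?_)
        rw [min_eq_left (hex q hq).le]
    have havg : ∀ y : Fin n → Y, cavg (typeClass P n) (numMsg R n)
        (fun C => min (∑ j ∈ univ.erase m, F (jcnt (C j) y))
          (Real.exp (-(n * T)) * F (jcnt (C m) y))) ≤
        ∑ q' ∈ typeVecs X Y n, ∑ q ∈ typeVecs X Y n, typeProb P y q' *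
          meanMin (((numMsg R n : ℝ) - 1) * typeProb P y q) (F q)
            (Real.exp (-(n * T)) * F q') := by
      intro y
      refine (mean_mono (hpt y)).trans ?_
      simp only [mean_sum]
      refine sum_le_sum fun q' _ => sum_le_sum fun q _ => ?_
      have := cavg_mul_min_le (A := typeClass P n) hne (tind_nonneg y q') (tind_eq y q) m
        (a := F q) (hc0 q')
      rwa [mean_tind, mean_tind] at this
    have hbound : ∀ (y : Fin n → Y) (q q' : X × Y → ℕ), typeProb P y q' *
        meanMin (((numMsg R n : ℝ) - 1) * typeProb P y q) (F q) (Real.exp (-(n * T)) * F q') ≤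
        typeProb P y q' * (K * Real.exp (-(n * (ent (frac n q') - ent P)))) := by
      intro y q q'
      rcases (typeProb_nonneg P y q').eq_or_lt with h' | h'
      · simp [← h']
      refine mul_le_mul_of_nonneg_left ?_ h'.le
      rcases (typeProb_nonneg P y q).eq_or_lt with h | h
      · rw [← h, mul_zero]
        refine (min_le_left _ _).trans ?_
        rw [zero_mul]
        positivity
      have hp := pairs_of_typeProb_pos hn h h'
      have hy : margY (frac n q) = frac n (cnt y) := by
        obtain ⟨x, -, rfl⟩ := exists_of_typeProb_pos h
        exact margY_frac_jcnt x y
      have h1 := (expected_number_bounds hR hn hp.1 hp.2.2.1 hy).2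
      refine (meanMin_le_mul hK1 h1 (hF q) (hc0 q')).trans
        (mul_le_mul_of_nonneg_left ?_ hK0.le)
      rw [Real.exp_neg (n * (ent (frac n q') - ent P)), ← one_div, le_div_iff₀' (Real.exp_pos _)]
      exact H q q' hp
    have hsum : ∀ q' : X × Y → ℕ, (∑ y : Fin n → Y, typeProb P y q') *
        (K * Real.exp (-(n * (ent (frac n q') - ent P)))) ≤ K * K :=
      fun q' => sum_typeProb_mul_le hn q'
    calc _ ≤ ∑ y : Fin n → Y, ∑ q' ∈ typeVecs X Y n, ∑ q ∈ typeVecs X Y n, typeProb P y q' *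
            (K * Real.exp (-(n * (ent (frac n q') - ent P)))) :=
          sum_le_sum fun y _ => (havg y).trans
            (sum_le_sum fun q' _ => sum_le_sum fun q _ => hbound y q q')
      _ = ∑ q' ∈ typeVecs X Y n, ∑ q ∈ typeVecs X Y n, (∑ y : Fin n → Y, typeProb P y q') *
            (K * Real.exp (-(n * (ent (frac n q') - ent P)))) := by
          rw [sum_comm]
          refine sum_congr rfl fun q' _ => ?_
          rw [sum_comm]
          exact sum_congr rfl fun q _ => (sum_mul _ _ _).symm
      _ ≤ ∑ q' ∈ typeVecs X Y n, ∑ q ∈ typeVecs X Y n, K * K :=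
          sum_le_sum fun q' _ => sum_le_sum fun q _ => hsum q'
      _ = _ := by
          rw [sum_const, sum_const, nsmul_eq_mul, nsmul_eq_mul, card_typeVecs, hK,
            ← Real.exp_add, ← two_mul, ← mul_assoc, ← pow_add, ← two_mul]
  rw [cavg_bestLagrangian]
  calc _ ≤ (1 / (numMsg R n : ℝ)) * ∑ _m : Fin (numMsg R n),
        ((n : ℝ) + 1) ^ (2 * Fintype.card (X × Y)) * Real.exp (2 * codeErr X Y n) :=
        mul_le_mul_of_nonneg_left (sum_le_sum fun m _ => hone m) (by positivity)
    _ = _ := by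
        rw [sum_const, card_univ, Fintype.card_fin, nsmul_eq_mul]
        field_simp

/-- The contribution of each pair of joint types is a lower bound on the average of the best
Lagrangian. -/
theorem le_cavg_bestLagrangian (hR : 0 < R) (hn : n ≠ 0) (hne : (typeClass P n).Nonempty)
    {F : (X × Y → ℕ) → ℝ} (hF : ∀ q, 0 ≤ F q) {q q' : X × Y → ℕ}
    (hp : (frac n q, frac n q') ∈ pairs P) :
    Real.exp (-(2 * codeErr X Y n)) / 2 * (Real.exp (n * (ent (frac n q') - ent P)) * meanMin
        (Real.exp (n * (R - mutualInfo (frac n q)))) (F q) (Real.exp (-(n * T)) * F q')) ≤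
      cavg (typeClass P n) (numMsg R n) (bestLagrangian F T) := by
  obtain ⟨hM1, hM2, hM⟩ := numMsg_bounds hR hn
  have hMr : (0 : ℝ) < numMsg R n := by exact_mod_cast hM
  set K := Real.exp (codeErr X Y n) with hK
  have hK1 : 1 ≤ K := one_le_exp_codeErr
  have hK0 : 0 < K := Real.exp_pos _
  have hc0 : ∀ q, 0 ≤ Real.exp (-(n * T)) * F q := fun q => mul_nonneg (Real.exp_pos _).le (hF q)
  set ν := Real.exp (n * (R - mutualInfo (frac n q))) with hν
  have hmm : 0 ≤ meanMin ν (F q) (Real.exp (-(n * T)) * F q') :=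
    meanMin_nonneg (Real.exp_pos _).le (hF q) (hc0 q')
  have hone : ∀ m : Fin (numMsg R n), Real.exp (-(2 * codeErr X Y n)) / 2 *
      (Real.exp (n * (ent (frac n q') - ent P)) *
        meanMin ν (F q) (Real.exp (-(n * T)) * F q')) ≤
      ∑ y : Fin n → Y, cavg (typeClass P n) (numMsg R n)
        (fun C => min (∑ j ∈ univ.erase m, F (jcnt (C j) y))
          (Real.exp (-(n * T)) * F (jcnt (C m) y))) := by
    intro m
    have hpt : ∀ (y : Fin n → Y) (C : Fin (numMsg R n) → Fin n → X),
        tind y q' (C m) * min (others (tind y q) m C * F q) (Real.exp (-(n * T)) * F q') ≤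
        min (∑ j ∈ univ.erase m, F (jcnt (C j) y)) (Real.exp (-(n * T)) * F (jcnt (C m) y)) := by
      intro y C
      have hsum0 : 0 ≤ ∑ j ∈ univ.erase m, F (jcnt (C j) y) := sum_nonneg fun j _ => hF _
      by_cases h : jcnt (C m) y = q'
      · rw [tind, if_pos h, one_mul, h]
        refine min_le_min ?_ le_rfl
        rw [others, sum_mul]
        refine sum_le_sum fun j _ => ?_
        unfold tind
        split_ifs with h1
        · rw [h1, one_mul]
        · rw [zero_mul]; exact hF _
      · rw [tind, if_neg h, zero_mul]
        exact le_min hsum0 (hc0 _)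
    have havg : ∀ y ∈ seqs n (fun b => ∑ a, q' (a, b)),
        typeProb P y q' * (meanMin ν (F q) (Real.exp (-(n * T)) * F q') / K / 2) ≤
        cavg (typeClass P n) (numMsg R n)
          (fun C => min (∑ j ∈ univ.erase m, F (jcnt (C j) y))
            (Real.exp (-(n * T)) * F (jcnt (C m) y))) := by
      intro y hy
      refine le_trans ?_ (mean_mono (hpt y))
      have h1 := le_cavg_mul_min (A := typeClass P n) hne (tind_nonneg y q') (tind_eq y q) m
        (hF q) (hc0 q')
      rw [mean_tind, mean_tind] at h1
      refine le_trans (mul_le_mul_of_nonneg_left ?_ (typeProb_nonneg P y q')) h1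
      have h2 := (expected_number_bounds hR hn hp.1 hp.2.2.1
        (margY_eq_of_mem_seqs hp.2.2.2.2 hy)).1
      have h3 := meanMin_le_mul hK1 h2 (hF q) (hc0 q')
      rw [← hν] at h3
      have h4 := (div_le_iff₀' hK0).2 h3
      unfold meanMin at h4 ⊢
      linarith
    have hcn : ∀ y : Fin n → Y, 0 ≤ cavg (typeClass P n) (numMsg R n)
        (fun C => min (∑ j ∈ univ.erase m, F (jcnt (C j) y))
          (Real.exp (-(n * T)) * F (jcnt (C m) y))) := fun y =>
      mean_nonneg fun C => le_min (sum_nonneg fun j _ => hF _) (hc0 _)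
    refine le_trans ?_ (sum_le_sum_of_subset_of_nonneg
      (subset_univ (seqs n fun b => ∑ a, q' (a, b))) fun y _ _ => hcn y)
    refine le_trans ?_ (sum_le_sum havg)
    rw [← sum_mul]
    have h1 := (sum_typeProb_bounds hn hp.2.1 hp.2.2.2.1).1
    rw [← hK] at h1
    have h2 : Real.exp (-(2 * codeErr X Y n)) = 1 / (K * K) := by
      rw [Real.exp_neg, two_mul, Real.exp_add, one_div]
    rw [h2]
    calc 1 / (K * K) / 2 * (Real.exp (n * (ent (frac n q') - ent P)) *
          meanMin ν (F q) (Real.exp (-(n * T)) * F q'))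
        ≤ 1 / (K * K) / 2 * (K * (∑ y ∈ seqs n (fun b => ∑ a, q' (a, b)), typeProb P y q') *
          meanMin ν (F q) (Real.exp (-(n * T)) * F q')) := by
          refine mul_le_mul_of_nonneg_left (mul_le_mul_of_nonneg_right h1 hmm) (by positivity)
      _ = _ := by field_simp
  rw [cavg_bestLagrangian]
  calc _ = (1 / (numMsg R n : ℝ)) * ∑ _m : Fin (numMsg R n),
        Real.exp (-(2 * codeErr X Y n)) / 2 * (Real.exp (n * (ent (frac n q') - ent P)) *
          meanMin ν (F q) (Real.exp (-(n * T)) * F q')) := by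
        rw [sum_const, card_univ, Fintype.card_fin, nsmul_eq_mul]
        field_simp
    _ ≤ _ := mul_le_mul_of_nonneg_left (sum_le_sum fun m _ => hone m) (by positivity)

end RandomCoding

/-! ### The minimax decoder -/

section Minimax

open Finset

variable {X Y Θ : Type*} [Fintype X] [DecidableEq X] [Fintype Y] [DecidableEq Y] {n M : ℕ}
  {T : ℝ}

/-- The Lagrangian of the decoder `D`, if the channel `W(y|x)` is replaced by an arbitrary function
`F` of the joint type. -/
noncomputable def genLagrangian (F : (X × Y → ℕ) → ℝ) (T : ℝ) (C : Fin M → Fin n → X)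
    (D : Decoder Y n M) : ℝ :=
  (1 / (M : ℝ)) * ∑ m, (∑ y ∈ D m, ∑ j ∈ univ.erase m, F (jcnt (C j) y) +
    ∑ y ∈ (D m)ᶜ, Real.exp (-(n * T)) * F (jcnt (C m) y))

lemma lagrangian_eq (W : X → Y → ℝ) (C : Fin M → Fin n → X) (D : Decoder Y n M) :
    lagrangian W T C D = genLagrangian (prodW W) T C D := by
  simp only [lagrangian, probE1, probE2, genLagrangian, channelN_eq_prodW, ← mul_sum,
    sum_add_distrib]
  ring

lemma genLagrangian_mono {F G : (X × Y → ℕ) → ℝ} (h : ∀ q, F q ≤ G q) (C : Fin M → Fin n → X)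
    (D : Decoder Y n M) : genLagrangian F T C D ≤ genLagrangian G T C D := by
  unfold genLagrangian
  gcongr <;> exact h _

lemma genLagrangian_nonneg {F : (X × Y → ℕ) → ℝ} (h : ∀ q, 0 ≤ F q) (C : Fin M → Fin n → X)
    (D : Decoder Y n M) : 0 ≤ genLagrangian F T C D :=
  mul_nonneg (by positivity) (sum_nonneg fun m _ => add_nonneg
    (sum_nonneg fun y _ => sum_nonneg fun j _ => h _)
    (sum_nonneg fun y _ => mul_nonneg (Real.exp_pos _).le (h _)))

lemma genLagrangian_mul (c : ℝ) (F : (X × Y → ℕ) → ℝ) (C : Fin M → Fin n → X)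
    (D : Decoder Y n M) : genLagrangian (fun q => c * F q) T C D = c * genLagrangian F T C D := by
  unfold genLagrangian
  simp only [mul_left_comm _ c, ← mul_sum, ← mul_add]

lemma genLagrangian_eq_sum (F : (X × Y → ℕ) → ℝ) (C : Fin M → Fin n → X) (D : Decoder Y n M) :
    genLagrangian F T C D = ∑ q ∈ typeVecs X Y n,
      F q * genLagrangian (fun q' => if q' = q then 1 else 0) T C D := by
  have hF : ∀ (x : Fin n → X) (y : Fin n → Y), F (jcnt x y) =
      ∑ q ∈ typeVecs X Y n, F q * if jcnt x y = q then 1 else 0 := fun x y => by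
    simp only [mul_ite, mul_one, mul_zero]
    rw [sum_ite_eq, if_pos (jcnt_mem_typeVecs x y)]
  have h1 : ∀ m : Fin M, ∑ y ∈ D m, ∑ j ∈ univ.erase m, F (jcnt (C j) y) =
      ∑ q ∈ typeVecs X Y n, F q * ∑ y ∈ D m, ∑ j ∈ univ.erase m,
        if jcnt (C j) y = q then 1 else 0 := fun m => by
    simp only [mul_sum]
    rw [sum_comm (s := typeVecs X Y n)]
    refine sum_congr rfl fun y _ => ?_
    rw [sum_comm (s := typeVecs X Y n)]
    exact sum_congr rfl fun j _ => hF _ _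
  have h2 : ∀ m : Fin M, ∑ y ∈ (D m)ᶜ, Real.exp (-(n * T)) * F (jcnt (C m) y) =
      ∑ q ∈ typeVecs X Y n, F q * ∑ y ∈ (D m)ᶜ, Real.exp (-(n * T)) *
        if jcnt (C m) y = q then 1 else 0 := fun m => by
    simp only [mul_sum]
    rw [sum_comm (s := typeVecs X Y n)]
    refine sum_congr rfl fun y _ => ?_
    rw [hF, mul_sum]
    exact sum_congr rfl fun q _ => mul_left_comm _ _ _
  unfold genLagrangian
  simp only [h1, h2, ← sum_add_distrib, ← mul_add]
  rw [sum_comm, mul_sum]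
  refine sum_congr rfl fun q _ => ?_
  rw [← mul_sum, mul_left_comm]

lemma bestLagrangian_le (F : (X × Y → ℕ) → ℝ) (C : Fin M → Fin n → X) (D : Decoder Y n M) :
    bestLagrangian F T C ≤ genLagrangian F T C D := by
  unfold bestLagrangian genLagrangian
  refine mul_le_mul_of_nonneg_left (sum_le_sum fun m _ => ?_) (by positivity)
  rw [← sum_add_sum_compl (D m)]
  exact add_le_add (sum_le_sum fun y _ => min_le_left _ _) (sum_le_sum fun y _ => min_le_right _ _)

/-- The decoder that compares, for each message, the two terms of the Lagrangian. -/
noncomputable def bestDecoder (F : (X × Y → ℕ) → ℝ) (T : ℝ) (C : Fin M → Fin n → X) :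
    Decoder Y n M := fun m => {y | ∑ j ∈ univ.erase m, F (jcnt (C j) y) <
      Real.exp (-(n * T)) * F (jcnt (C m) y)}

lemma genLagrangian_bestDecoder (F : (X × Y → ℕ) → ℝ) (C : Fin M → Fin n → X) :
    genLagrangian F T C (bestDecoder F T C) = bestLagrangian F T C := by
  unfold bestLagrangian genLagrangian
  congr 1
  refine sum_congr rfl fun m _ => ?_
  rw [← sum_add_sum_compl (bestDecoder F T C m)]
  congr 1
  · refine sum_congr rfl fun y hy => ?_
    simp only [bestDecoder, mem_filter, mem_univ, true_and] at hy
    rw [min_eq_left hy.le]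
  · refine sum_congr rfl fun y hy => ?_
    simp only [bestDecoder, mem_compl, mem_filter, mem_univ, true_and, not_lt] at hy
    rw [min_eq_right hy]

/-- For `T ≥ 0` the regions of the best list decoder are disjoint: two messages cannot both
outweigh the sum of all the other ones. Hence the two modes have the same optimum. -/
lemma bestDecoder_admits {F : (X × Y → ℕ) → ℝ} (hF : ∀ q, 0 ≤ F q) (C : Fin M → Fin n → X)
    {mode : Mode} (hmode : mode = Mode.erasure → 0 ≤ T) : mode.Admits (bestDecoder F T C) := by
  cases mode
  · have hT := hmode rfl
    intro m m' hmm
    refine disjoint_left.2 fun y hy hy' => ?_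
    simp only [bestDecoder, mem_filter, mem_univ, true_and] at hy hy'
    have hexp : Real.exp (-(n * T)) ≤ 1 := Real.exp_le_one_iff.2 (by
      have : 0 ≤ (n : ℝ) * T := by positivity
      linarith)
    have h1 : F (jcnt (C m) y) ≤ ∑ j ∈ univ.erase m', F (jcnt (C j) y) :=
      single_le_sum (f := fun j => F (jcnt (C j) y)) (fun j _ => hF _)
        (mem_erase.2 ⟨hmm, mem_univ _⟩)
    have h2 : F (jcnt (C m') y) ≤ ∑ j ∈ univ.erase m, F (jcnt (C j) y) :=
      single_le_sum (f := fun j => F (jcnt (C j) y)) (fun j _ => hF _)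
        (mem_erase.2 ⟨hmm.symm, mem_univ _⟩)
    have h3 := mul_le_of_le_one_left (hF (jcnt (C m) y)) hexp
    have h4 := mul_le_of_le_one_left (hF (jcnt (C m') y)) hexp
    linarith
  · trivial

variable {W : Θ → X → Y → ℝ} {e : Θ → ℝ} {ξ B : ℝ}

/-- The supremum over `θ` of the channels, weighted as in the regret, as a function of the joint
type. -/
noncomputable def envelope (W : Θ → X → Y → ℝ) (e : Θ → ℝ) (T ξ : ℝ) (n : ℕ) (q : X × Y → ℕ) : ℝ :=
  ⨆ θ, Real.exp (n * (ξ * e θ + T)) * prodW (W θ) q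

lemma weight_le (hW : ∀ θ x, W θ x ∈ stdSimplex ℝ Y) (hξ : 0 ≤ ξ) (hB : ∀ θ, e θ ≤ B)
    (q : X × Y → ℕ) (θ : Θ) :
    Real.exp (n * (ξ * e θ + T)) * prodW (W θ) q ≤ Real.exp (n * (ξ * B + T)) := by
  calc _ ≤ Real.exp (n * (ξ * e θ + T)) * 1 :=
        mul_le_mul_of_nonneg_left (prodW_le_one (hW θ) q) (Real.exp_pos _).le
    _ ≤ _ := by
        rw [mul_one]
        have := hB θ
        gcongr

lemma le_envelope (hW : ∀ θ x, W θ x ∈ stdSimplex ℝ Y) (hξ : 0 ≤ ξ) (hB : ∀ θ, e θ ≤ B)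
    (q : X × Y → ℕ) (θ : Θ) :
    Real.exp (n * (ξ * e θ + T)) * prodW (W θ) q ≤ envelope W e T ξ n q :=
  le_ciSup (f := fun θ => Real.exp (n * (ξ * e θ + T)) * prodW (W θ) q)
    ⟨_, by rintro _ ⟨θ, rfl⟩; exact weight_le hW hξ hB q θ⟩ θ

lemma envelope_nonneg (hW : ∀ θ x, W θ x ∈ stdSimplex ℝ Y) (q : X × Y → ℕ) :
    0 ≤ envelope W e T ξ n q :=
  Real.iSup_nonneg fun θ => mul_nonneg (Real.exp_pos _).le (prodW_nonneg (hW θ) q)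

lemma regret_eq (C : Fin M → Fin n → X) (D : Decoder Y n M) :
    regret W (fun θ => (e θ : EReal)) T ξ C D = ⨆ θ, ENNReal.ofReal
      (genLagrangian (fun q => Real.exp (n * (ξ * e θ + T)) * prodW (W θ) q) T C D) := by
  unfold regret
  refine iSup_congr fun θ => ?_
  have h1 : -((n : EReal) * ((ξ : EReal) * (e θ : EReal) + (T : EReal))) =
      ((-(n * (ξ * e θ + T)) : ℝ) : EReal) := by
    push_cast
    rfl
  rw [h1, EReal.exp_coe, ← ENNReal.ofReal_div_of_pos (Real.exp_pos _), lagrangian_eq,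
    genLagrangian_mul, Real.exp_neg, div_inv_eq_mul, mul_comm]

lemma minimaxRegret_le (hW : ∀ θ x, W θ x ∈ stdSimplex ℝ Y) (hξ : 0 ≤ ξ) (hB : ∀ θ, e θ ≤ B)
    (C : Fin M → Fin n → X) {mode : Mode} (hmode : mode = Mode.erasure → 0 ≤ T) :
    minimaxRegret W (fun θ => (e θ : EReal)) T ξ mode C ≤
      ENNReal.ofReal (bestLagrangian (envelope W e T ξ n) T C) := by
  refine (iInf₂_le (bestDecoder (envelope W e T ξ n) T C)
    (bestDecoder_admits (envelope_nonneg hW) C hmode)).trans ?_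
  rw [regret_eq]
  refine iSup_le fun θ => ENNReal.ofReal_le_ofReal ?_
  rw [← genLagrangian_bestDecoder]
  exact genLagrangian_mono (fun q => le_envelope hW hξ hB q θ) _ _

/-- Since there are only polynomially many joint types, the supremum over `θ` may be taken for each
joint type separately. -/
lemma bestLagrangian_le_minimaxRegret [Nonempty Θ] (hW : ∀ θ x, W θ x ∈ stdSimplex ℝ Y)
    (C : Fin M → Fin n → X) (mode : Mode) :
    ENNReal.ofReal (bestLagrangian (envelope W e T ξ n) T C) ≤
      ENNReal.ofReal (#(typeVecs X Y n)) *
        minimaxRegret W (fun θ => (e θ : EReal)) T ξ mode C := by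
  have hL : (0 : ℝ) < #(typeVecs X Y n) := by rw [card_typeVecs]; positivity
  have hL0 : ENNReal.ofReal (#(typeVecs X Y n)) ≠ 0 := (ENNReal.ofReal_pos.2 hL).ne'
  rw [mul_comm, ← ENNReal.div_le_iff_le_mul (Or.inl hL0) (Or.inl ENNReal.ofReal_ne_top)]
  refine le_iInf₂ fun D _ => ?_
  rw [ENNReal.div_le_iff_le_mul (Or.inl hL0) (Or.inl ENNReal.ofReal_ne_top), mul_comm]
  by_cases htop : regret W (fun θ => (e θ : EReal)) T ξ C D = ⊤
  · rw [htop, ENNReal.mul_top hL0]; exact le_top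
  set r := (regret W (fun θ => (e θ : EReal)) T ξ C D).toReal with hr
  have hr' : regret W (fun θ => (e θ : EReal)) T ξ C D = ENNReal.ofReal r :=
    (ENNReal.ofReal_toReal htop).symm
  have hr0 : 0 ≤ r := ENNReal.toReal_nonneg
  have hw0 : ∀ θ q, 0 ≤ Real.exp (n * (ξ * e θ + T)) * prodW (W θ) q := fun θ q =>
    mul_nonneg (Real.exp_pos _).le (prodW_nonneg (hW θ) q)
  have hν0 : ∀ q, 0 ≤ genLagrangian (fun q' => if q' = q then 1 else 0) T C D := fun q =>
    genLagrangian_nonneg (fun q' => by split_ifs <;> norm_num) C D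
  have hle : ∀ θ, genLagrangian (fun q => Real.exp (n * (ξ * e θ + T)) * prodW (W θ) q) T C D ≤
      r := by
    intro θ
    rw [← ENNReal.ofReal_le_ofReal_iff hr0, ← hr', regret_eq]
    exact le_iSup (fun θ => ENNReal.ofReal (genLagrangian
      (fun q => Real.exp (n * (ξ * e θ + T)) * prodW (W θ) q) T C D)) θ
  have hq : ∀ q ∈ typeVecs X Y n, envelope W e T ξ n q *
      genLagrangian (fun q' => if q' = q then 1 else 0) T C D ≤ r := by
    intro q hq
    rw [envelope, Real.iSup_mul_of_nonneg (hν0 q)]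
    refine ciSup_le fun θ => le_trans ?_ (hle θ)
    rw [genLagrangian_eq_sum fun q => Real.exp (n * (ξ * e θ + T)) * prodW (W θ) q]
    exact single_le_sum (f := fun q => (Real.exp (n * (ξ * e θ + T)) * prodW (W θ) q) *
      genLagrangian (fun q' => if q' = q then 1 else 0) T C D)
      (fun q _ => mul_nonneg (hw0 θ q) (hν0 q)) hq
  rw [hr', ← ENNReal.ofReal_mul hL.le]
  refine ENNReal.ofReal_le_ofReal ((bestLagrangian_le _ C D).trans ?_)
  rw [genLagrangian_eq_sum]
  refine (sum_le_sum hq).trans ?_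
  rw [sum_const, nsmul_eq_mul]

variable {P : X → ℝ} {R : ℝ} {mode : Mode}

lemma bestLagrangian_nonneg {F : (X × Y → ℕ) → ℝ} (hF : ∀ q, 0 ≤ F q) (C : Fin M → Fin n → X) :
    0 ≤ bestLagrangian F T C := by
  rw [← genLagrangian_bestDecoder]
  exact genLagrangian_nonneg hF _ _

lemma ofReal_cavg {F : (Fin (numMsg R n) → Fin n → X) → ℝ} (hF : ∀ C, 0 ≤ F C)
    (hne : (typeClass P n).Nonempty) :
    ENNReal.ofReal (cavg (typeClass P n) (numMsg R n) F) =
      (∑ C ∈ codebooks P R n, ENNReal.ofReal (F C)) / (#(codebooks P R n) : ℝ≥0∞) := by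
  have hc : 0 < #(codebooks P R n) :=
    card_pos.2 (Fintype.piFinset_nonempty.2 fun _ => hne)
  rw [← ENNReal.ofReal_sum_of_nonneg fun C _ => hF C, ← ENNReal.ofReal_natCast,
    ← ENNReal.ofReal_div_of_pos (by exact_mod_cast hc)]
  rfl

lemma avgRegret_le (hW : ∀ θ x, W θ x ∈ stdSimplex ℝ Y) (hξ : 0 ≤ ξ) (hB : ∀ θ, e θ ≤ B)
    (hmode : mode = Mode.erasure → 0 ≤ T) (hne : (typeClass P n).Nonempty) :
    avgRegret P W (fun θ => (e θ : EReal)) R T ξ mode n ≤ ENNReal.ofReal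
      (cavg (typeClass P n) (numMsg R n) (bestLagrangian (envelope W e T ξ n) T)) := by
  rw [ofReal_cavg (bestLagrangian_nonneg (envelope_nonneg hW)) hne, avgRegret]
  exact ENNReal.div_le_div_right (sum_le_sum fun C _ => minimaxRegret_le hW hξ hB C hmode) _

lemma le_avgRegret [Nonempty Θ] (hW : ∀ θ x, W θ x ∈ stdSimplex ℝ Y)
    (hne : (typeClass P n).Nonempty) :
    ENNReal.ofReal
      (cavg (typeClass P n) (numMsg R n) (bestLagrangian (envelope W e T ξ n) T)) ≤
    ENNReal.ofReal (#(typeVecs X Y n)) *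
      avgRegret P W (fun θ => (e θ : EReal)) R T ξ mode n := by
  rw [ofReal_cavg (bestLagrangian_nonneg (envelope_nonneg hW)) hne, avgRegret, ← mul_div_assoc,
    mul_sum]
  exact ENNReal.div_le_div_right
    (sum_le_sum fun C _ => bestLagrangian_le_minimaxRegret hW C mode) _

end Minimax

/-! ### The achievable fractions -/

section Achievability

open Finset Filter Topology

variable {X Y Θ : Type*} [Fintype X] [DecidableEq X] [Fintype Y] [DecidableEq Y]
  {W : Θ → X → Y → ℝ} {e : Θ → ℝ} {P : X → ℝ} {R T ξ B : ℝ} {mode : Mode}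

lemma tendsto_one_add_log_div :
    Tendsto (fun n : ℕ => (1 + Real.log (n + 1)) / (n : ℝ)) atTop (𝓝 0) := by
  have h1 : Tendsto (fun x : ℝ => Real.log x / x) atTop (𝓝 0) :=
    Real.isLittleO_log_id_atTop.tendsto_div_nhds_zero
  have h2 : Tendsto (fun n : ℕ => Real.log n / (n : ℝ)) atTop (𝓝 0) :=
    h1.comp tendsto_natCast_atTop_atTop
  have h3 : Tendsto (fun n : ℕ => (1 + Real.log 2) * (n : ℝ)⁻¹ + Real.log n / (n : ℝ)) atTop
      (𝓝 0) := by
    simpa using (tendsto_natCast_atTop_atTop.inv_tendsto_atTop.const_mul (1 + Real.log 2)).add h2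
  refine tendsto_of_tendsto_of_tendsto_of_le_of_le' tendsto_const_nhds h3
    (Eventually.of_forall fun n => _root_.div_nonneg (one_add_log_nonneg n) (Nat.cast_nonneg n)) ?_
  filter_upwards [eventually_ge_atTop 1] with n hn
  have hn' : (1 : ℝ) ≤ n := by exact_mod_cast hn
  rw [← div_eq_mul_inv, ← add_div]
  refine div_le_div_of_nonneg_right ?_ (by linarith)
  rw [add_assoc, ← Real.log_mul two_ne_zero (by positivity)]
  have := Real.log_le_log (by linarith) (by linarith : (n : ℝ) + 1 ≤ 2 * n)
  linarith

lemma tendsto_codeErr_div : Tendsto (fun n : ℕ => codeErr X Y n / (n : ℝ)) atTop (𝓝 0) := by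
  have h1 := tendsto_one_add_log_div.const_mul
    ((Fintype.card (X × Y) + Fintype.card X + Fintype.card Y + 3 : ℝ))
  have h2 : Tendsto (fun n : ℕ => ((n : ℝ))⁻¹) atTop (𝓝 0) :=
    tendsto_natCast_atTop_atTop.inv_tendsto_atTop
  have := h1.add h2
  simp only [mul_zero, add_zero] at this
  refine this.congr fun n => ?_
  simp only [codeErr, typeErr]
  ring

lemma log_ofReal_exp_div (c : ℝ) (n : ℕ) :
    ENNReal.log (ENNReal.ofReal (Real.exp c)) / (n : EReal) = ((c / n : ℝ) : EReal) := by
  rw [ENNReal.log_ofReal_of_pos (Real.exp_pos c), Real.log_exp, EReal.coe_div, EReal.coe_natCast]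

lemma log_div_le {a : ℝ≥0∞} {c : ℝ} (h : a ≤ ENNReal.ofReal (Real.exp c)) (n : ℕ) :
    ENNReal.log a / (n : EReal) ≤ ((c / n : ℝ) : EReal) := by
  rw [← log_ofReal_exp_div]
  exact EReal.div_le_div_right_of_nonneg (by exact_mod_cast Nat.zero_le n) (ENNReal.log_le_log h)

lemma le_log_div {a : ℝ≥0∞} {c : ℝ} (h : ENNReal.ofReal (Real.exp c) ≤ a) (n : ℕ) :
    ((c / n : ℝ) : EReal) ≤ ENNReal.log a / (n : EReal) := by
  rw [← log_ofReal_exp_div]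
  exact EReal.div_le_div_right_of_nonneg (by exact_mod_cast Nat.zero_le n) (ENNReal.log_le_log h)

lemma typeClass_ne_zero (hP : P ∈ stdSimplex ℝ X) {n : ℕ} (h : (typeClass P n).Nonempty) :
    n ≠ 0 := by
  rintro rfl
  obtain ⟨x, hx⟩ := h
  have h1 := hP.2
  rw [← mem_typeClass.1 hx] at h1
  simp [empirical] at h1

lemma exists_mul_eq_natCast (hP : P ∈ stdSimplex ℝ X) {n : ℕ} (hne : (typeClass P n).Nonempty) :
    ∃ k : X → ℕ, ∀ x, n * P x = k x := by
  have hn : (n : ℝ) ≠ 0 := Nat.cast_ne_zero.2 (typeClass_ne_zero hP hne)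
  obtain ⟨x, hx⟩ := hne
  refine ⟨cnt x, fun a => ?_⟩
  rw [← mem_typeClass.1 hx]
  exact mul_div_cancel₀ _ hn

lemma eventually_blocklengths_nonempty : ∀ᶠ n in blocklengths P, (typeClass P n).Nonempty :=
  mem_inf_of_right (mem_principal_self _)

lemma typeClass_nonempty_of_margX {N : ℕ} (hN : N ≠ 0) {q : X × Y → ℕ}
    (hq : frac N q ∈ stdSimplex ℝ (X × Y)) (hqX : margX (frac N q) = P) :
    (typeClass P N).Nonempty := by
  rw [← hqX, margX_frac, typeClass_eq_seqs hN]
  refine seqs_nonempty ?_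
  rw [← sum_eq_of_frac_mem hN hq, Fintype.sum_prod_type]

lemma frac_mul {A : Type*} {N k : ℕ} (hk : k ≠ 0) (q : A → ℕ) :
    frac (k * N) (fun p => k * q p) = frac N q := by
  funext p
  have : (k : ℝ) ≠ 0 := Nat.cast_ne_zero.2 hk
  simp only [frac, Nat.cast_mul]
  rw [mul_div_mul_left _ _ this]

lemma typeClass_mul_nonempty {N k : ℕ} (hP : P ∈ stdSimplex ℝ X) (hk : k ≠ 0)
    (h : (typeClass P N).Nonempty) : (typeClass P (k * N)).Nonempty := by
  have hN := typeClass_ne_zero hP h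
  obtain ⟨x, hx⟩ := h
  have hx' : frac N (cnt x) = P := mem_typeClass.1 hx
  rw [← hx', ← frac_mul hk, typeClass_eq_seqs (Nat.mul_ne_zero hk hN)]
  refine seqs_nonempty ?_
  rw [← mul_sum, sum_cnt]

/-- Multiples of a blocklength with a nonempty type class are blocklengths. -/
lemma frequently_blocklengths (hP : P ∈ stdSimplex ℝ X) {N : ℕ} (h : (typeClass P N).Nonempty)
    {p : ℕ → Prop} (hp : ∀ᶠ k in atTop, p (k * N)) : ∃ᶠ n in blocklengths P, p n := by
  rw [blocklengths, frequently_inf_principal, frequently_atTop]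
  intro a
  have hN := Nat.pos_of_ne_zero (typeClass_ne_zero hP h)
  obtain ⟨k, hk, hka⟩ := (hp.and (eventually_ge_atTop (a + 1))).exists
  exact ⟨k * N, by nlinarith, typeClass_mul_nonempty hP (by omega) h, hk⟩

lemma blocklengths_neBot (hP : P ∈ stdSimplex ℝ X) {N : ℕ} (h : (typeClass P N).Nonempty) :
    (blocklengths P).NeBot := by
  have := frequently_blocklengths hP h (p := fun _ => True) (by simp)
  exact ⟨fun hbot => by simp [hbot] at this⟩

lemma weight_eq_exp (hW : ∀ θ x, W θ x ∈ stdSimplex ℝ Y) {n : ℕ} (hn : n ≠ 0) {q : X × Y → ℕ}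
    {θ : Θ} (h : SuppIn (frac n q) (W θ)) :
    Real.exp (n * (ξ * e θ + T)) * prodW (W θ) q =
      Real.exp (n * score W e T ξ θ (frac n q)) := by
  rw [prodW_eq_exp (hW θ) hn h, ← Real.exp_add, score]
  ring_nf

/-- The pointwise form of the conditions bounds every contribution to the average regret. -/
lemma exp_mul_meanMin_envelope_le [Nonempty Θ] (hW : ∀ θ x, W θ x ∈ stdSimplex ℝ Y)
    (h : PairCond P W e R T ξ) {n : ℕ} (hn : n ≠ 0) {q q' : X × Y → ℕ}
    (hp : (frac n q, frac n q') ∈ pairs P) :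
    Real.exp (n * (ent (frac n q') - ent P)) * meanMin
        (Real.exp (n * (R - mutualInfo (frac n q)))) (envelope W e T ξ n q)
        (Real.exp (-(n * T)) * envelope W e T ξ n q') ≤ 1 := by
  by_contra hcon
  push Not at hcon
  have hn' : (0 : ℝ) < n := by exact_mod_cast Nat.pos_of_ne_zero hn
  set a := ent (frac n q') - ent P with ha
  set I := mutualInfo (frac n q) with hI
  have h0 : Real.exp (-(n * a)) < meanMin (Real.exp (n * (R - I))) (envelope W e T ξ n q)
        (Real.exp (-(n * T)) * envelope W e T ξ n q') := by
    rw [Real.exp_neg, ← one_div, div_lt_iff₀' (Real.exp_pos _)]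
    exact hcon
  rw [meanMin, lt_min_iff, lt_min_iff] at h0
  obtain ⟨h1, h2, h3⟩ := h0
  have hex : ∀ {s : ℝ} {q : X × Y → ℕ}, Real.exp s < envelope W e T ξ n q →
      ∃ θ, SuppIn (frac n q) (W θ) ∧ s < n * score W e T ξ θ (frac n q) := by
    intro s q hs
    obtain ⟨θ, hθ⟩ := exists_lt_of_lt_ciSup hs
    have hpos : 0 < prodW (W θ) q :=
      pos_of_mul_pos_right ((Real.exp_pos s).trans hθ) (Real.exp_pos _).le
    have hsupp := suppIn_of_prodW_pos (n := n) hpos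
    rw [weight_eq_exp hW hn hsupp] at hθ
    exact ⟨θ, hsupp, Real.exp_lt_exp.1 hθ⟩
  have h1' : Real.exp (-(n * a) - n * (R - I)) < envelope W e T ξ n q := by
    rw [Real.exp_sub, div_lt_iff₀' (Real.exp_pos _)]; exact h1
  have h23 : Real.exp (-(n * a) + n * T + n * max (I - R) 0) < envelope W e T ξ n q' := by
    rcases le_total (I - R) 0 with hIR | hIR
    · rw [max_eq_right hIR, mul_zero, add_zero, ← sub_neg_eq_add, Real.exp_sub,
        div_lt_iff₀' (Real.exp_pos _)]
      exact h3
    · rw [max_eq_left hIR, show -(n * a) + n * T + n * (I - R) =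
        -(n * a) - (n * (R - I) + -(n * T)) by ring, Real.exp_sub,
        div_lt_iff₀' (Real.exp_pos _), Real.exp_add, mul_assoc]
      exact h2
  obtain ⟨θ₁, hs₁, hl₁⟩ := hex h1'
  obtain ⟨θ₂, hs₂, hl₂⟩ := hex h23
  have hmain := h _ _ hp θ₁ θ₂ hs₁ hs₂
  rw [← ha, ← hI] at hmain
  have h4 : -a < min (R - I + score W e T ξ θ₁ (frac n q))
      (score W e T ξ θ₂ (frac n q') - T - max (I - R) 0) := by
    refine lt_min ?_ ?_
    · have : (n : ℝ) * -a < n * (R - I + score W e T ξ θ₁ (frac n q)) := by linarith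
      exact lt_of_mul_lt_mul_left this hn'.le
    · have : (n : ℝ) * -a < n * (score W e T ξ θ₂ (frac n q') - T - max (I - R) 0) := by linarith
      exact lt_of_mul_lt_mul_left this hn'.le
  linarith

lemma le_meanMin_envelope (hW : ∀ θ x, W θ x ∈ stdSimplex ℝ Y) (hξ : 0 ≤ ξ) (hB : ∀ θ, e θ ≤ B)
    {n : ℕ} (hn : n ≠ 0) {q q' : X × Y → ℕ} {θ₁ θ₂ : Θ} (h₁ : SuppIn (frac n q) (W θ₁))
    (h₂ : SuppIn (frac n q') (W θ₂)) :
    Real.exp (n * min (R - mutualInfo (frac n q) + score W e T ξ θ₁ (frac n q))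
      (score W e T ξ θ₂ (frac n q') - T - max (mutualInfo (frac n q) - R) 0)) ≤
    meanMin (Real.exp (n * (R - mutualInfo (frac n q)))) (envelope W e T ξ n q)
        (Real.exp (-(n * T)) * envelope W e T ξ n q') := by
  have e1 := le_envelope (n := n) (T := T) hW hξ hB q θ₁
  have e2 := le_envelope (n := n) (T := T) hW hξ hB q' θ₂
  rw [weight_eq_exp hW hn h₁] at e1
  rw [weight_eq_exp hW hn h₂] at e2
  set I := mutualInfo (frac n q)
  set s₁ := score W e T ξ θ₁ (frac n q)
  set s₂ := score W e T ξ θ₂ (frac n q')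
  have hn' : (0 : ℝ) ≤ n := Nat.cast_nonneg n
  have m1 := mul_le_mul_of_nonneg_left (min_le_left (R - I + s₁) (s₂ - T - max (I - R) 0)) hn'
  have m2 := mul_le_mul_of_nonneg_left (min_le_right (R - I + s₁) (s₂ - T - max (I - R) 0)) hn'
  have m3 := mul_le_mul_of_nonneg_left (le_max_left (I - R) 0) hn'
  have m4 := mul_le_mul_of_nonneg_left (le_max_right (I - R) 0) hn'
  refine le_min ?_ (le_min ?_ ?_)
  · calc _ ≤ Real.exp (n * (R - I) + n * s₁) := Real.exp_le_exp.2 (by linarith)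
      _ ≤ _ := by rw [Real.exp_add]; exact mul_le_mul_of_nonneg_left e1 (Real.exp_pos _).le
  · calc _ ≤ Real.exp (n * (R - I) + (-(n * T) + n * s₂)) := Real.exp_le_exp.2 (by linarith)
      _ ≤ _ := by
        rw [Real.exp_add, Real.exp_add]
        gcongr
  · calc _ ≤ Real.exp (-(n * T) + n * s₂) := Real.exp_le_exp.2 (by linarith)
      _ ≤ _ := by rw [Real.exp_add]; exact mul_le_mul_of_nonneg_left e2 (Real.exp_pos _).le

/-- The decoder `bestDecoder` for the envelope of the family attains every `ξ` that satisfies the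
pointwise condition. -/
theorem achievable_of_pairCond [Nonempty Θ] (hP : P ∈ stdSimplex ℝ X)
    (hPtype : ∃ n, (typeClass P n).Nonempty) (hW : ∀ θ x, W θ x ∈ stdSimplex ℝ Y) (hR : 0 < R)
    (hξ : 0 ≤ ξ) (hB : ∀ θ, e θ ≤ B) (hmode : mode = Mode.erasure → 0 ≤ T)
    (h : PairCond P W e R T ξ) : Achievable P W (fun θ => (e θ : EReal)) R T mode ξ := by
  obtain ⟨N, hN⟩ := hPtype
  have := blocklengths_neBot hP hN
  set c : ℕ → ℝ := fun n => 2 * Fintype.card (X × Y) * (1 + Real.log (n + 1)) +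
    2 * codeErr X Y n with hc
  have hlim : Tendsto (fun n : ℕ => ((c n / n : ℝ) : EReal)) (blocklengths P) (𝓝 0) := by
    have h1 := (tendsto_one_add_log_div.const_mul (2 * (Fintype.card (X × Y) : ℝ))).add
      ((tendsto_codeErr_div (X := X) (Y := Y)).const_mul 2)
    simp only [mul_zero, add_zero] at h1
    have h2 : Tendsto (fun n : ℕ => c n / n) atTop (𝓝 0) := h1.congr fun n => by
      rw [hc]; ring
    exact (EReal.tendsto_coe.2 h2).mono_left inf_le_left
  refine le_trans (limsup_le_limsup ?_) hlim.limsup_eq.le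
  filter_upwards [eventually_blocklengths_nonempty] with n hne
  have hn := typeClass_ne_zero hP hne
  refine log_div_le ((avgRegret_le hW hξ hB hmode hne).trans (ENNReal.ofReal_le_ofReal ?_)) n
  refine (cavg_bestLagrangian_le hR hn hne (envelope_nonneg hW) fun q q' hp =>
    exp_mul_meanMin_envelope_le hW h hn hp).trans ?_
  rw [hc, Real.exp_add]
  refine mul_le_mul_of_nonneg_right ?_ (Real.exp_pos _).le
  have hn1 : (0 : ℝ) < (n : ℝ) + 1 := by positivity
  rw [← Real.exp_log (pow_pos hn1 _), Real.log_pow]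
  refine Real.exp_le_exp.2 ?_
  push_cast
  have : (0 : ℝ) ≤ 2 * Fintype.card (X × Y) := by positivity
  linarith

/-- A pair of joint distributions that violates the pointwise condition is approximated by a pair
of types, and these make the average regret grow exponentially along the multiples of their
blocklength. -/
theorem pairCond_of_achievable [Nonempty Θ] (hP : P ∈ stdSimplex ℝ X)
    (hPtype : ∃ n, (typeClass P n).Nonempty) (hW : ∀ θ x, W θ x ∈ stdSimplex ℝ Y) (hR : 0 < R)
    (hξ : 0 ≤ ξ) (hB : ∀ θ, e θ ≤ B)
    (h : Achievable P W (fun θ => (e θ : EReal)) R T mode ξ) : PairCond P W e R T ξ := by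
  intro Q Q' hp θ₁ θ₂ h₁ h₂
  by_contra hcon
  push Not at hcon
  set V : (X × Y → ℝ) × (X × Y → ℝ) → ℝ := fun z => ent z.2 - ent P +
    min (R - mutualInfo z.1 + score W e T ξ θ₁ z.1)
      (score W e T ξ θ₂ z.2 - T - max (mutualInfo z.1 - R) 0) with hV
  have hcont : ContinuousOn V {z | ∀ p, 0 ≤ z.1 p} := by
    have c1 := continuousOn_mutualInfo_fst (X := X) (Y := Y)
    have c2 : Continuous fun z : (X × Y → ℝ) × (X × Y → ℝ) => score W e T ξ θ₁ z.1 :=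
      continuous_const.add ((continuous_linLog _).comp continuous_fst)
    have c3 : Continuous fun z : (X × Y → ℝ) × (X × Y → ℝ) => score W e T ξ θ₂ z.2 :=
      continuous_const.add ((continuous_linLog _).comp continuous_snd)
    have c4 : Continuous fun z : (X × Y → ℝ) × (X × Y → ℝ) => ent z.2 - ent P :=
      (continuous_ent.comp continuous_snd).sub continuous_const
    exact c4.continuousOn.add (((continuousOn_const.sub c1).add c2.continuousOn).inf
      ((c3.continuousOn.sub continuousOn_const).sub
        ((c1.sub continuousOn_const).sup continuousOn_const)))
  set v := V (Q, Q') with hv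
  have hv0 : 0 < v := hcon
  obtain ⟨δ, hδ, hnear⟩ := Metric.continuousOn_iff.1 hcont (Q, Q') hp.1.1 (v / 2) (half_pos hv0)
  obtain ⟨N₀, hN₀⟩ := hPtype
  have hN₀0 := typeClass_ne_zero hP hN₀
  obtain ⟨k, hk⟩ := exists_mul_eq_natCast hP hN₀
  obtain ⟨N, hN, q, q', hpq, hs, hs', hd, hd'⟩ :=
    exists_types_near (Nat.pos_of_ne_zero hN₀0) hk hp hδ
  have hVq : v / 2 < V (frac N q, frac N q') := by
    have h1 : dist (frac N q, frac N q') (Q, Q') < δ :=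
      max_lt ((dist_pi_lt_iff hδ).2 hd) ((dist_pi_lt_iff hδ).2 hd')
    have h2 := hnear _ hpq.1.1 h1
    rw [Real.dist_eq] at h2
    have := (abs_lt.1 h2).1
    linarith
  have hNne := typeClass_nonempty_of_margX hN.ne' hpq.1 hpq.2.2.1
  have hsupp : SuppIn (frac N q) (W θ₁) := fun p h0 => by simp [frac, hs p (h₁ p h0)]
  have hsupp' : SuppIn (frac N q') (W θ₂) := fun p h0 => by simp [frac, hs' p (h₂ p h0)]
  set d : ℕ → ℝ := fun n => 2 * codeErr X Y n + Real.log 2 +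
    Fintype.card (X × Y) * Real.log (n + 1) with hd
  have hdlim : ∀ᶠ n : ℕ in atTop, d n / n < v / 4 := by
    have h1 := (((tendsto_codeErr_div (X := X) (Y := Y)).const_mul 2).add
      (tendsto_one_add_log_div.const_mul (Fintype.card (X × Y) + 1 : ℝ)))
    simp only [mul_zero, add_zero] at h1
    filter_upwards [h1.eventually_lt_const (by linarith : (0 : ℝ) < v / 4)] with n hn
    refine lt_of_le_of_lt ?_ hn
    rw [← mul_div_assoc, ← mul_div_assoc, ← add_div]
    refine div_le_div_of_nonneg_right ?_ (Nat.cast_nonneg n)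
    have h2 : Real.log 2 ≤ 1 := by linarith [Real.log_le_sub_one_of_pos two_pos]
    have h3 := one_add_log_nonneg n
    have h4 : (0 : ℝ) ≤ Fintype.card (X × Y) := Nat.cast_nonneg _
    have h5 : 0 ≤ Real.log ((n : ℝ) + 1) := Real.log_nonneg (by
      have : (0 : ℝ) ≤ n := Nat.cast_nonneg n
      linarith)
    rw [hd]
    nlinarith
  have hfreq : ∃ᶠ n in blocklengths P, ((v / 4 : ℝ) : EReal) ≤
      ENNReal.log (avgRegret P W (fun θ => (e θ : EReal)) R T ξ mode n) / (n : EReal) := by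
    refine frequently_blocklengths hP hNne ?_
    have htend : Tendsto (fun k : ℕ => k * N) atTop atTop := tendsto_id.atTop_mul_const' hN
    filter_upwards [htend.eventually hdlim, eventually_gt_atTop 0] with k hkd hk0
    set n := k * N with hn
    have hn0 : n ≠ 0 := Nat.mul_ne_zero hk0.ne' hN.ne'
    have hn' : (0 : ℝ) < n := by exact_mod_cast Nat.pos_of_ne_zero hn0
    have hfq : frac n (fun p => k * q p) = frac N q := frac_mul hk0.ne' q
    have hfq' : frac n (fun p => k * q' p) = frac N q' := frac_mul hk0.ne' q'
    have hne : (typeClass P n).Nonempty := typeClass_mul_nonempty hP hk0.ne' hNne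
    have l1 := le_avgRegret (e := e) (T := T) (ξ := ξ) (R := R) (mode := mode) hW hne
    have l2 := le_cavg_bestLagrangian (T := T) (q := fun p => k * q p) (q' := fun p => k * q' p)
      hR hn0 hne (envelope_nonneg (e := e) (T := T) (ξ := ξ) (n := n) hW) (by rwa [hfq, hfq'])
    have l3 := le_meanMin_envelope (R := R) (T := T) hW hξ hB hn0
      (q := fun p => k * q p) (q' := fun p => k * q' p) (θ₁ := θ₁) (θ₂ := θ₂)
      (by rwa [hfq]) (by rwa [hfq'])
    rw [hfq, hfq'] at l2 l3
    have hL : (0 : ℝ) < #(typeVecs X Y n) := by rw [card_typeVecs]; positivity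
    have hL0 : ENNReal.ofReal (#(typeVecs X Y n)) ≠ 0 := (ENNReal.ofReal_pos.2 hL).ne'
    have l4 : ENNReal.ofReal (Real.exp (n * (v / 2) - d n)) ≤
        avgRegret P W (fun θ => (e θ : EReal)) R T ξ mode n := by
      have l5 := (ENNReal.div_le_iff_le_mul (Or.inl hL0) (Or.inl ENNReal.ofReal_ne_top)).2
        (l1.trans_eq (mul_comm _ _))
      refine le_trans ?_ l5
      rw [← ENNReal.ofReal_div_of_pos hL]
      refine ENNReal.ofReal_le_ofReal ?_
      rw [le_div_iff₀ hL]
      refine le_trans ?_ l2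
      calc Real.exp (n * (v / 2) - d n) * (#(typeVecs X Y n) : ℝ)
          = Real.exp (-(2 * codeErr X Y n)) / 2 * Real.exp (n * (v / 2)) := by
            have hn1 : (0 : ℝ) < (n : ℝ) + 1 := by positivity
            have e1 : (#(typeVecs X Y n) : ℝ) =
                Real.exp (Fintype.card (X × Y) * Real.log (n + 1)) := by
              rw [card_typeVecs, ← Real.log_pow, Real.exp_log (pow_pos hn1 _)]
            have e2 : Real.exp (-(2 * codeErr X Y n)) / 2 =
                Real.exp (-(2 * codeErr X Y n) - Real.log 2) := by
              rw [Real.exp_sub, Real.exp_log two_pos]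
            rw [e1, e2, ← Real.exp_add, ← Real.exp_add, hd]
            congr 1
            ring
        _ ≤ _ := by
            refine mul_le_mul_of_nonneg_left ?_ (by positivity)
            refine le_trans ?_ (mul_le_mul_of_nonneg_left l3 (Real.exp_pos _).le)
            rw [← Real.exp_add, ← mul_add]
            exact Real.exp_le_exp.2 (mul_le_mul_of_nonneg_left hVq.le hn'.le)
    refine le_trans (EReal.coe_le_coe_iff.2 ?_) (le_log_div l4 n)
    rw [sub_div, mul_div_cancel_left₀ _ hn'.ne']
    linarith
  have := (le_limsup_of_frequently_le hfreq).trans h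
  have h0 : v / 4 ≤ 0 := by exact_mod_cast this
  linarith

end Achievability

/-! ### The error probability of Forney's decoder -/

section Forney

open Finset Filter Topology

variable {X Y : Type*} [Fintype X] [DecidableEq X] [Fintype Y] [DecidableEq Y] {n : ℕ}
  {W : X → Y → ℝ} {P : X → ℝ} {R T : ℝ}

lemma avgForneyE1_eq : avgForneyE1 P W R T n = (1 / (numMsg R n : ℝ)) *
    ∑ m : Fin (numMsg R n), ∑ y : Fin n → Y, cavg (typeClass P n) (numMsg R n) (fun C =>
      if prodW W (jcnt (C m) y) < Real.exp (n * T) * ∑ j ∈ univ.erase m, prodW W (jcnt (C j) y)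
      then prodW W (jcnt (C m) y) else 0) := by
  have h1 : ∀ C : Fin (numMsg R n) → Fin n → X, probE1 W C (forneyDecoder W T C) =
      (1 / (numMsg R n : ℝ)) * ∑ m : Fin (numMsg R n), ∑ y : Fin n → Y,
      if prodW W (jcnt (C m) y) < Real.exp (n * T) * ∑ j ∈ univ.erase m, prodW W (jcnt (C j) y)
      then prodW W (jcnt (C m) y) else 0 := by
    intro C
    unfold probE1
    congr 1
    refine sum_congr rfl fun m _ => ?_
    rw [← sum_filter]
    refine sum_congr ?_ fun y _ => channelN_eq_prodW W (C m) y
    ext y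
    simp [forneyDecoder, channelN_eq_prodW]
  rw [show avgForneyE1 P W R T n = cavg (typeClass P n) (numMsg R n)
    fun C => probE1 W C (forneyDecoder W T C) from rfl]
  simp only [h1]
  rw [cavg, mean_const_mul, mean_sum]
  simp only [mean_sum, cavg]

lemma suppPairs_of (hn : n ≠ 0) {y : Fin n → Y} {q q' : X × Y → ℕ}
    (h : 0 < typeProb P y q) (h' : 0 < typeProb P y q') (hq : 0 < prodW W q)
    (hq' : 0 < prodW W q') : (frac n q, frac n q') ∈ suppPairs P W :=
  ⟨pairs_of_typeProb_pos hn h h', suppIn_of_prodW_pos hq, suppIn_of_prodW_pos hq'⟩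

/-- For a joint type `q` of the wrong codewords whose threshold is well below `T`, there is an
error whenever the number of such codewords is at least of the order of its mean, or positive in
case that the mean is less than one. -/
theorem le_avgForneyE1 (hW : ∀ x, W x ∈ stdSimplex ℝ Y) (hR : 0 < R) (hn : n ≠ 0)
    (hne : (typeClass P n).Nonempty) {q q' : X × Y → ℕ}
    (hp : (frac n q, frac n q') ∈ suppPairs P W)
    (hT : n * thresh W R (frac n q, frac n q') + codeErr X Y n + Real.log 4 ≤ n * T) :
    Real.exp (-(n * cost P W R (frac n q, frac n q')) - 2 * codeErr X Y n) / 4 ≤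
      avgForneyE1 P W R T n := by
  obtain ⟨hM1, hM2, hM⟩ := numMsg_bounds hR hn
  have hMr : (0 : ℝ) < numMsg R n := by exact_mod_cast hM
  obtain ⟨hp, hs, hs'⟩ := hp
  have hw := prodW_eq_exp hW hn hs
  have hw' := prodW_eq_exp hW hn hs'
  simp only [thresh, cost] at hT ⊢
  set I := mutualInfo (frac n q) with hI
  set K := Real.exp (codeErr X Y n) with hK
  have hK1 : 1 ≤ K := one_le_exp_codeErr
  have hK0 : 0 < K := Real.exp_pos _
  have hn0 : (0 : ℝ) ≤ n := Nat.cast_nonneg n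
  have hone : ∀ m : Fin (numMsg R n),
      Real.exp (-(n * (div P W (frac n q') + max (I - R) 0)) - 2 * codeErr X Y n) / 4 ≤
      ∑ y : Fin n → Y, cavg (typeClass P n) (numMsg R n) (fun C =>
        if prodW W (jcnt (C m) y) < Real.exp (n * T) * ∑ j ∈ univ.erase m, prodW W (jcnt (C j) y)
        then prodW W (jcnt (C m) y) else 0) := by
    intro m
    have havg : ∀ y ∈ seqs n (fun b => ∑ a, q' (a, b)),
        typeProb P y q' * (prodW W q' * (Real.exp (-(n * max (I - R) 0)) / K / 4)) ≤
        cavg (typeClass P n) (numMsg R n) (fun C =>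
          if prodW W (jcnt (C m) y) < Real.exp (n * T) *
            ∑ j ∈ univ.erase m, prodW W (jcnt (C j) y)
          then prodW W (jcnt (C m) y) else 0) := by
      intro y hy
      obtain ⟨b1, b2⟩ := expected_number_bounds hR hn hp.1 hp.2.2.1
        (margY_eq_of_mem_seqs hp.2.2.2.2 hy)
      rw [← hI, ← hK] at b1 b2
      have h1 := le_cavg_ite_lt (A := typeClass P n) hne (tind_nonneg y q') (tind_eq y q) m
      rw [mean_tind, mean_tind] at h1
      set μ := ((numMsg R n : ℝ) - 1) * typeProb P y q with hμ
      have hμ1 : Real.exp (n * max (R - I) 0) ≤ K * max 1 μ := by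
        rcases le_total (R - I) 0 with h | h
        · rw [max_eq_right h, mul_zero, Real.exp_zero]
          nlinarith [le_max_left 1 μ]
        · rw [max_eq_left h]
          exact b1.trans (mul_le_mul_of_nonneg_left (le_max_right _ _) hK0.le)
      have hμ2 : Real.exp (-(n * max (I - R) 0)) / K ≤ min μ 1 := by
        rw [div_le_iff₀' hK0, mul_min_of_nonneg _ _ hK0.le, mul_one]
        refine le_min (le_trans ?_ b1) (le_trans ?_ hK1)
        · have := mul_le_mul_of_nonneg_left (le_max_left (I - R) 0) hn0
          exact Real.exp_le_exp.2 (by linarith)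
        · have := mul_nonneg hn0 (le_max_right (I - R) 0)
          exact Real.exp_le_one_iff.2 (by linarith)
      have hpt : ∀ C : Fin (numMsg R n) → Fin n → X,
          prodW W q' * (tind y q' (C m) *
            if max 1 μ / 4 < others (tind y q) m C then 1 else 0) ≤
          if prodW W (jcnt (C m) y) < Real.exp (n * T) *
            ∑ j ∈ univ.erase m, prodW W (jcnt (C j) y)
          then prodW W (jcnt (C m) y) else 0 := by
        intro C
        have hnn : 0 ≤ if prodW W (jcnt (C m) y) < Real.exp (n * T) *
            ∑ j ∈ univ.erase m, prodW W (jcnt (C j) y)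
          then prodW W (jcnt (C m) y) else 0 := by
          split_ifs
          exacts [prodW_nonneg hW _, le_rfl]
        by_cases hC : jcnt (C m) y = q'
        · by_cases hN : max 1 μ / 4 < others (tind y q) m C
          · rw [tind, if_pos hC, if_pos hN, mul_one, mul_one, hC, if_pos]
            have h2 : others (tind y q) m C * prodW W q ≤
                ∑ j ∈ univ.erase m, prodW W (jcnt (C j) y) := by
              rw [others, sum_mul]
              refine sum_le_sum fun j _ => ?_
              unfold tind
              split_ifs with h3
              · rw [h3, one_mul]
              · rw [zero_mul]; exact prodW_nonneg hW _
            have hw0 : 0 < prodW W q := by rw [hw]; exact Real.exp_pos _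
            calc prodW W q'
                ≤ Real.exp (n * T + n * linLog (frac n q) W + n * max (R - I) 0 -
                  codeErr X Y n - Real.log 4) := by
                  rw [hw']
                  exact Real.exp_le_exp.2 (by linarith)
              _ = Real.exp (n * T) * (Real.exp (n * max (R - I) 0) / K / 4 * prodW W q) := by
                  rw [Real.exp_sub, Real.exp_sub, Real.exp_add, Real.exp_add,
                    Real.exp_log (by norm_num), ← hw]
                  ring
              _ ≤ Real.exp (n * T) * (max 1 μ / 4 * prodW W q) := by
                  have := (div_le_iff₀' hK0).2 hμ1
                  gcongr
              _ < Real.exp (n * T) * (others (tind y q) m C * prodW W q) := by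
                  gcongr
              _ ≤ _ := mul_le_mul_of_nonneg_left h2 (Real.exp_pos _).le
          · rw [if_neg hN, mul_zero, mul_zero]; exact hnn
        · rw [tind, if_neg hC, zero_mul, mul_zero]; exact hnn
      refine le_trans ?_ (mean_mono hpt)
      rw [mean_const_mul]
      calc _ = prodW W q' * (typeProb P y q' * (Real.exp (-(n * max (I - R) 0)) / K / 4)) := by
            ring
        _ ≤ prodW W q' * (typeProb P y q' * (min μ 1 / 4)) := by
            have := prodW_nonneg hW q'
            have := typeProb_nonneg P y q'
            gcongr
        _ ≤ _ := mul_le_mul_of_nonneg_left h1 (prodW_nonneg hW q')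
    refine le_trans ?_ (sum_le_sum_of_subset_of_nonneg
      (subset_univ (seqs n fun b => ∑ a, q' (a, b))) fun y _ _ => mean_nonneg fun C => by
        split_ifs
        exacts [prodW_nonneg hW _, le_rfl])
    refine le_trans ?_ (sum_le_sum havg)
    rw [← sum_mul]
    have h1 := (sum_typeProb_bounds hn hp.2.1 hp.2.2.2.1).1
    rw [← hK] at h1
    have h3 := (div_le_iff₀' hK0).2 h1
    refine le_trans (le_of_eq ?_) (mul_le_mul_of_nonneg_right h3
      (mul_nonneg (prodW_nonneg hW q') (by positivity)))
    rw [hw', hK, div]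
    have : Real.exp (-(n * (ent P - ent (frac n q') - linLog (frac n q') W + max (I - R) 0)) -
        2 * codeErr X Y n) = Real.exp (n * (ent (frac n q') - ent P)) / Real.exp (codeErr X Y n) *
        (Real.exp (n * linLog (frac n q') W) *
          (Real.exp (-(n * max (I - R) 0)) / Real.exp (codeErr X Y n))) := by
      rw [← Real.exp_sub, ← Real.exp_sub, ← Real.exp_add, ← Real.exp_add]
      congr 1
      ring
    rw [this]
    ring
  rw [avgForneyE1_eq]
  calc _ = (1 / (numMsg R n : ℝ)) * ∑ _m : Fin (numMsg R n),
        Real.exp (-(n * (div P W (frac n q') + max (I - R) 0)) - 2 * codeErr X Y n) / 4 := by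
        rw [sum_const, card_univ, Fintype.card_fin, nsmul_eq_mul]
        field_simp
    _ ≤ _ := mul_le_mul_of_nonneg_left (sum_le_sum fun m _ => hone m) (by positivity)

/-- The joint types of threshold at most `T + δ` contribute at most `exp (-n c)` each, up to
polynomial factors. For the other ones, an error requires `exp (n δ)` times the expected number of
codewords, up to such factors, and this has a doubly exponentially small probability. -/
theorem avgForneyE1_le (hW : ∀ x, W x ∈ stdSimplex ℝ Y) (hR : 0 < R) (hn : n ≠ 0)
    (hne : (typeClass P n).Nonempty) {c δ : ℝ}
    (hc : ∀ q ∈ suppPairs P W, thresh W R q ≤ T + δ → c < cost P W R q)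
    (hlarge : Real.exp (codeErr X Y n) + n * |c| ≤
      Real.exp (n * δ) / (#(typeVecs X Y n) : ℝ) * Real.log 2) :
    avgForneyE1 P W R T n ≤ ((n : ℝ) + 1) ^ (2 * Fintype.card (X × Y)) *
      Real.exp (2 * codeErr X Y n) * Real.exp (-(n * c)) := by
  obtain ⟨hM1, hM2, hM⟩ := numMsg_bounds hR hn
  have hMr : (0 : ℝ) < numMsg R n := by exact_mod_cast hM
  set K := Real.exp (codeErr X Y n) with hK
  have hK1 : 1 ≤ K := one_le_exp_codeErr
  have hK0 : 0 < K := Real.exp_pos _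
  have hn0 : (0 : ℝ) ≤ n := Nat.cast_nonneg n
  set L : ℝ := (#(typeVecs X Y n) : ℝ) with hL
  have hL0 : 0 < L := by rw [hL, card_typeVecs]; positivity
  have hone : ∀ m : Fin (numMsg R n), ∑ y : Fin n → Y, cavg (typeClass P n) (numMsg R n)
      (fun C => if prodW W (jcnt (C m) y) < Real.exp (n * T) *
          ∑ j ∈ univ.erase m, prodW W (jcnt (C j) y) then prodW W (jcnt (C m) y) else 0) ≤
      ((n : ℝ) + 1) ^ (2 * Fintype.card (X × Y)) * Real.exp (2 * codeErr X Y n) *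
        Real.exp (-(n * c)) := by
    intro m
    have hpt : ∀ (y : Fin n → Y) (C : Fin (numMsg R n) → Fin n → X),
        (if prodW W (jcnt (C m) y) < Real.exp (n * T) *
          ∑ j ∈ univ.erase m, prodW W (jcnt (C j) y) then prodW W (jcnt (C m) y) else 0) ≤
        ∑ q' ∈ typeVecs X Y n, ∑ q ∈ typeVecs X Y n, prodW W q' * (tind y q' (C m) *
          if prodW W q' < Real.exp (n * T) * (L * (others (tind y q) m C * prodW W q))
          then 1 else 0) := by
      intro y C
      have h1 : ∀ q', ∑ q ∈ typeVecs X Y n, prodW W q' * (tind y q' (C m) *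
          if prodW W q' < Real.exp (n * T) * (L * (others (tind y q) m C * prodW W q))
          then 1 else 0) = tind y q' (C m) * ∑ q ∈ typeVecs X Y n, prodW W q' *
          if prodW W q' < Real.exp (n * T) * (L * (others (tind y q) m C * prodW W q))
          then 1 else 0 := fun q' => by
        rw [mul_sum]
        exact sum_congr rfl fun q _ => mul_left_comm _ _ _
      simp only [h1]
      rw [sum_tind_mul y (C m) fun q' => ∑ q ∈ typeVecs X Y n, prodW W q' *
          if prodW W q' < Real.exp (n * T) * (L * (others (tind y q) m C * prodW W q))
          then 1 else 0]
      have hterm : ∀ q, 0 ≤ prodW W (jcnt (C m) y) * if prodW W (jcnt (C m) y) <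
          Real.exp (n * T) * (L * (others (tind y q) m C * prodW W q)) then (1 : ℝ) else 0 :=
        fun q => mul_nonneg (prodW_nonneg hW _) (by split_ifs <;> norm_num)
      split_ifs with hlt
      · rw [← sum_others_tind_mul] at hlt
        obtain ⟨q, hq, hmax⟩ := exists_max_image (typeVecs X Y n)
          (fun q => others (tind y q) m C * prodW W q) ⟨_, jcnt_mem_typeVecs (C m) y⟩
        have h2 : ∑ q ∈ typeVecs X Y n, others (tind y q) m C * prodW W q ≤
            L * (others (tind y q) m C * prodW W q) := by
          rw [hL, ← nsmul_eq_mul]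
          exact sum_le_card_nsmul _ _ _ hmax
        have h3 := hlt.trans_le (mul_le_mul_of_nonneg_left h2 (Real.exp_pos _).le)
        refine le_trans (le_of_eq ?_) (single_le_sum (fun q _ => hterm q) hq)
        rw [if_pos h3, mul_one]
      · exact sum_nonneg fun q _ => hterm q
    have hbound : ∀ (y : Fin n → Y) (q q' : X × Y → ℕ),
        cavg (typeClass P n) (numMsg R n) (fun C => prodW W q' * (tind y q' (C m) *
          if prodW W q' < Real.exp (n * T) * (L * (others (tind y q) m C * prodW W q))
          then 1 else 0)) ≤
        typeProb P y q' * (K * Real.exp (-(n * (ent (frac n q') - ent P)))) *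
          Real.exp (-(n * c)) := by
      intro y q q'
      have hrhs : 0 ≤ typeProb P y q' * (K * Real.exp (-(n * (ent (frac n q') - ent P)))) *
          Real.exp (-(n * c)) := by
        have := typeProb_nonneg P y q'
        positivity
      rw [cavg, mean_const_mul, ← cavg]
      rcases (prodW_nonneg hW q').eq_or_lt with hq' | hq'
      · rw [← hq', zero_mul]; exact hrhs
      rcases (prodW_nonneg hW q).eq_or_lt with hq | hq
      · simp only [← hq, mul_zero, if_neg hq'.not_gt, mul_zero]
        simp only [cavg, mean, sum_const_zero, zero_div, mul_zero]
        exact hrhs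
      -- An error needs at least one wrong codeword of joint type `q`.
      have hle1 : cavg (typeClass P n) (numMsg R n) (fun C => tind y q' (C m) *
          if prodW W q' < Real.exp (n * T) * (L * (others (tind y q) m C * prodW W q))
          then 1 else 0) ≤ typeProb P y q' *
          min (((numMsg R n : ℝ) - 1) * typeProb P y q) 1 := by
        have := cavg_ite_one_le (A := typeClass P n) hne (tind_nonneg y q') (tind_eq y q) m
        rw [mean_tind, mean_tind] at this
        refine le_trans (mean_mono fun C => mul_le_mul_of_nonneg_left ?_ (tind_nonneg _ _ _)) this
        split_ifs with h1 h2 h2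
        · exact le_rfl
        · rcases others_eq_zero_or_one_le (tind_eq y q) m C with h0 | h0
          · rw [h0, zero_mul, mul_zero, mul_zero] at h1
            exact absurd h1 hq'.not_gt
          · exact absurd h0 h2
        · exact zero_le_one
        · exact le_rfl
      rcases (typeProb_nonneg P y q').eq_or_lt with ht' | ht'
      · rw [← ht', zero_mul] at hle1
        exact (mul_nonpos_of_nonneg_of_nonpos hq'.le hle1).trans hrhs
      rcases (typeProb_nonneg P y q).eq_or_lt with ht | ht
      · rw [← ht, mul_zero, min_eq_left zero_le_one, mul_zero] at hle1
        exact (mul_nonpos_of_nonneg_of_nonpos hq'.le hle1).trans hrhs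
      have hmem := suppPairs_of hn ht ht' hq hq'
      obtain ⟨hp, hs, hs'⟩ := hmem
      have hw := prodW_eq_exp hW hn hs
      have hw' := prodW_eq_exp hW hn hs'
      have hy : margY (frac n q) = frac n (cnt y) := by
        obtain ⟨x, -, rfl⟩ := exists_of_typeProb_pos ht
        exact margY_frac_jcnt x y
      have b2 := (expected_number_bounds hR hn hp.1 hp.2.2.1 hy).2
      rw [← hK] at b2
      have hdiv := div_nonneg hp.2.1 hW hp.2.2.2.1 hs'
      set I := mutualInfo (frac n q) with hI
      set μ := ((numMsg R n : ℝ) - 1) * typeProb P y q with hμ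
      have hkey : ∀ {β : ℝ}, n * c ≤ n * div P W (frac n q') + β →
          prodW W q' * (K * Real.exp (-β)) ≤
          K * Real.exp (-(n * (ent (frac n q') - ent P))) * Real.exp (-(n * c)) := by
        intro β h
        rw [hw', mul_left_comm, mul_assoc]
        refine mul_le_mul_of_nonneg_left ?_ hK0.le
        rw [← Real.exp_add, ← Real.exp_add]
        refine Real.exp_le_exp.2 ?_
        unfold div at h
        linarith
      by_cases hth : thresh W R (frac n q, frac n q') ≤ T + δ
      · have hcost := hc _ ⟨hp, hs, hs'⟩ hth
        unfold cost at hcost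
        have hmin : min μ 1 ≤ K * Real.exp (-(n * max (I - R) 0)) := by
          rcases le_total (I - R) 0 with h | h
          · rw [max_eq_right h, mul_zero, neg_zero, Real.exp_zero, mul_one]
            exact (min_le_right _ _).trans hK1
          · rw [max_eq_left h, show -(n * (I - R)) = n * (R - I) by ring]
            exact (min_le_left _ _).trans b2
        calc _ ≤ prodW W q' * (typeProb P y q' * (K * Real.exp (-(n * max (I - R) 0)))) := by
              refine mul_le_mul_of_nonneg_left (hle1.trans ?_) hq'.le
              exact mul_le_mul_of_nonneg_left hmin ht'.le
          _ = typeProb P y q' * (prodW W q' * (K * Real.exp (-(n * max (I - R) 0)))) := by ring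
          _ ≤ typeProb P y q' * (K * Real.exp (-(n * (ent (frac n q') - ent P))) *
                Real.exp (-(n * c))) := by
              refine mul_le_mul_of_nonneg_left (hkey ?_) ht'.le
              have := mul_le_mul_of_nonneg_left hcost.le hn0
              rw [mul_add] at this
              exact this
          _ = _ := by ring
      -- An error needs at least `k` wrong codewords of joint type `q`, while `K * J` bounds their
      -- expected number.
      · have hth' := not_le.1 hth
        simp only [thresh, ← hI] at hth'
        set J := Real.exp (n * max (R - I) 0) with hJ
        have hJ1 : 1 ≤ J := Real.one_le_exp (mul_nonneg hn0 (le_max_right _ _))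
        set k := Real.exp (n * δ) * J / L with hk
        have hle2 : cavg (typeClass P n) (numMsg R n) (fun C => tind y q' (C m) *
            if prodW W q' < Real.exp (n * T) * (L * (others (tind y q) m C * prodW W q))
            then 1 else 0) ≤ typeProb P y q' * Real.exp (μ - k * Real.log 2) := by
          have := cavg_ite_le (A := typeClass P n) hne (tind_nonneg y q') (tind_eq y q) m k
          rw [mean_tind, mean_tind] at this
          refine le_trans (mean_mono fun C => mul_le_mul_of_nonneg_left ?_ (tind_nonneg _ _ _))
            this
          split_ifs with h1 h2 h2
          · exact le_rfl
          · exfalso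
            refine h2 ?_
            rw [hk, div_le_iff₀ hL0, hJ, ← Real.exp_add]
            have h3 : Real.exp (n * T) * prodW W q *
                Real.exp (n * δ + n * max (R - I) 0) ≤ prodW W q' := by
              rw [hw, hw', ← Real.exp_add, ← Real.exp_add]
              refine Real.exp_le_exp.2 ?_
              have := mul_le_mul_of_nonneg_left hth'.le hn0
              linarith
            have h4 : Real.exp (n * T) * prodW W q * Real.exp (n * δ + n * max (R - I) 0) ≤
                Real.exp (n * T) * prodW W q * (others (tind y q) m C * L) := by
              linarith
            exact le_of_mul_le_mul_left h4 (by positivity)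
          · exact zero_le_one
          · exact le_rfl
        have hexp : Real.exp (μ - k * Real.log 2) ≤ K * Real.exp (-(n * |c|)) := by
          have hμJ : μ ≤ K * J := by
            refine b2.trans (mul_le_mul_of_nonneg_left (Real.exp_le_exp.2 ?_) hK0.le)
            exact mul_le_mul_of_nonneg_left (le_max_left _ _) hn0
          have h5 : μ - k * Real.log 2 ≤ -(n * |c|) := by
            have h6 : k * Real.log 2 = J * (Real.exp (n * δ) / L * Real.log 2) := by
              rw [hk]; ring
            have h7 := mul_le_mul_of_nonneg_left hlarge (by linarith : 0 ≤ J)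
            have h8 : n * |c| ≤ J * (n * |c|) :=
              le_mul_of_one_le_left (mul_nonneg hn0 (abs_nonneg c)) hJ1
            rw [h6]
            linarith
          calc Real.exp (μ - k * Real.log 2) ≤ Real.exp (-(n * |c|)) := Real.exp_le_exp.2 h5
            _ ≤ _ := le_mul_of_one_le_left (Real.exp_pos _).le hK1
        calc _ ≤ prodW W q' * (typeProb P y q' * (K * Real.exp (-(n * |c|)))) := by
              refine mul_le_mul_of_nonneg_left (hle2.trans ?_) hq'.le
              exact mul_le_mul_of_nonneg_left hexp ht'.le
          _ = typeProb P y q' * (prodW W q' * (K * Real.exp (-(n * |c|)))) := by ring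
          _ ≤ typeProb P y q' * (K * Real.exp (-(n * (ent (frac n q') - ent P))) *
                Real.exp (-(n * c))) := by
              refine mul_le_mul_of_nonneg_left (hkey ?_) ht'.le
              have := mul_le_mul_of_nonneg_left (le_abs_self c) hn0
              have := mul_nonneg hn0 hdiv
              linarith
          _ = _ := by ring
    calc _ ≤ ∑ y : Fin n → Y, ∑ q' ∈ typeVecs X Y n, ∑ q ∈ typeVecs X Y n, typeProb P y q' *
            (K * Real.exp (-(n * (ent (frac n q') - ent P)))) * Real.exp (-(n * c)) := by
          refine sum_le_sum fun y _ => (mean_mono (hpt y)).trans ?_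
          simp only [mean_sum]
          exact sum_le_sum fun q' _ => sum_le_sum fun q _ => hbound y q q'
      _ = ∑ q' ∈ typeVecs X Y n, ∑ q ∈ typeVecs X Y n, (∑ y : Fin n → Y, typeProb P y q') *
            (K * Real.exp (-(n * (ent (frac n q') - ent P)))) * Real.exp (-(n * c)) := by
          rw [sum_comm]
          refine sum_congr rfl fun q' _ => ?_
          rw [sum_comm]
          refine sum_congr rfl fun q _ => ?_
          rw [sum_mul, sum_mul]
      _ ≤ ∑ q' ∈ typeVecs X Y n, ∑ q ∈ typeVecs X Y n, K * K * Real.exp (-(n * c)) :=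
          sum_le_sum fun q' _ => sum_le_sum fun q _ =>
            mul_le_mul_of_nonneg_right (sum_typeProb_mul_le hn q') (Real.exp_pos _).le
      _ = _ := by
          rw [sum_const, sum_const, nsmul_eq_mul, nsmul_eq_mul, card_typeVecs, hK,
            ← Real.exp_add, ← two_mul, ← mul_assoc, ← mul_assoc, ← pow_add, ← two_mul]
  rw [avgForneyE1_eq]
  calc _ ≤ (1 / (numMsg R n : ℝ)) * ∑ _m : Fin (numMsg R n),
        ((n : ℝ) + 1) ^ (2 * Fintype.card (X × Y)) * Real.exp (2 * codeErr X Y n) *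
          Real.exp (-(n * c)) :=
        mul_le_mul_of_nonneg_left (sum_le_sum fun m _ => hone m) (by positivity)
    _ = _ := by
        rw [sum_const, card_univ, Fintype.card_fin, nsmul_eq_mul]
        field_simp

end Forney

/-! ### Approximation by types of all large blocklengths -/

section Padding

open Finset Filter Topology

variable {X Y : Type*} [Fintype X] [DecidableEq X] [Fintype Y] [DecidableEq Y] {n N : ℕ}
  {W : X → Y → ℝ} {P : X → ℝ}

/-- The joint type that arises from `k` copies of `q` and `ρ x` further occurrences of each
letter `x` together with the output letter `f x`. -/
def padType (k : ℕ) (ρ : X → ℕ) (f : X → Y) (q : X × Y → ℕ) (p : X × Y) : ℕ :=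
  k * q p + if p.2 = f p.1 then ρ p.1 else 0

lemma sum_padType_fst (k : ℕ) (ρ : X → ℕ) (f : X → Y) (q : X × Y → ℕ) (x : X) :
    ∑ y, padType k ρ f q (x, y) = k * ∑ y, q (x, y) + ρ x := by
  simp [padType, sum_add_distrib, mul_sum]

lemma sum_padType_snd (k : ℕ) (ρ : X → ℕ) (f : X → Y) (q : X × Y → ℕ) (y : Y) :
    ∑ x, padType k ρ f q (x, y) = k * ∑ x, q (x, y) + ∑ x, if y = f x then ρ x else 0 := by
  simp [padType, sum_add_distrib, mul_sum]

lemma exists_pos_of_mem_stdSimplex {w : Y → ℝ} (hw : w ∈ stdSimplex ℝ Y) : ∃ y, 0 < w y := by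
  by_contra! h
  have := sum_nonpos fun y (_ : y ∈ univ) => h y
  linarith [hw.2]

/-- A pair of types of blocklength `N` is approximated by pairs of types of every blocklength
`n` that admits the composition `P`; the remaining `n % N` letters go to outputs of positive
probability. -/
lemma exists_types_of_blocklength (hW : ∀ x, W x ∈ stdSimplex ℝ Y) (hP : P ∈ stdSimplex ℝ X)
    (hN : N ≠ 0) {q q' : X × Y → ℕ} (h : (frac N q, frac N q') ∈ suppPairs P W)
    (hne : (typeClass P n).Nonempty) :
    ∃ r r' : X × Y → ℕ, (frac n r, frac n r') ∈ suppPairs P W ∧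
      (∀ p, |frac n r p - frac N q p| ≤ N / n) ∧ ∀ p, |frac n r' p - frac N q' p| ≤ N / n := by
  have hn := typeClass_ne_zero hP hne
  obtain ⟨⟨hq, hq', hX, hX', hY⟩, hs, hs'⟩ := h
  obtain ⟨x₀, hx₀⟩ := hne
  have hP0 : frac n (cnt x₀) = P := mem_typeClass.1 hx₀
  choose f hf using fun x => exists_pos_of_mem_stdSimplex (hW x)
  have hn' : (0 : ℝ) < n := by exact_mod_cast Nat.pos_of_ne_zero hn
  have hN' : (0 : ℝ) < N := by exact_mod_cast Nat.pos_of_ne_zero hN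
  set k := n / N with hk
  have hkN : ((n % N : ℕ) : ℝ) = n - k * N := by
    have h1 : (N : ℝ) * k + (n % N : ℕ) = n := by exact_mod_cast Nat.div_add_mod n N
    linarith
  have hcnt : ∀ x, (cnt x₀ x : ℝ) = n * P x := fun x => by
    rw [← hP0, frac]; field_simp
  have hsum : ∀ {q : X × Y → ℕ}, margX (frac N q) = P → ∀ x,
      ((∑ y, q (x, y) : ℕ) : ℝ) = N * P x := by
    intro q hX x
    rw [← hX, margX_frac, frac]; field_simp
  set ρ : X → ℕ := fun x => cnt x₀ x - k * ∑ y, q (x, y) with hρ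
  have hmod0 : (0 : ℝ) ≤ ((n % N : ℕ) : ℝ) := Nat.cast_nonneg _
  have hle : ∀ x, k * ∑ y, q (x, y) ≤ cnt x₀ x := fun x => by
    have : (k : ℝ) * ((∑ y, q (x, y) : ℕ) : ℝ) ≤ cnt x₀ x := by
      rw [hcnt, hsum hX]
      have := mul_nonneg hmod0 (hP.1 x)
      rw [hkN] at this
      linarith
    exact_mod_cast this
  have hρr : ∀ x, (ρ x : ℝ) = ((n % N : ℕ) : ℝ) * P x := fun x => by
    rw [hρ, Nat.cast_sub (hle x), hcnt, Nat.cast_mul, hsum hX, hkN]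
    ring
  have hmarg : ∀ {q : X × Y → ℕ}, margX (frac N q) = P →
      margX (frac n (padType k ρ f q)) = P := by
    intro q hX
    funext x
    rw [margX_frac, frac, sum_padType_fst, Nat.cast_add, Nat.cast_mul, hsum hX, hρr, hkN]
    field_simp
    ring
  have hmem : ∀ {q : X × Y → ℕ}, margX (frac N q) = P →
      frac n (padType k ρ f q) ∈ stdSimplex ℝ (X × Y) := fun hX =>
    ⟨fun p => by unfold frac; positivity, by rw [← sum_margX, hmarg hX, hP.2]⟩
  have hsupp : ∀ {q : X × Y → ℕ}, SuppIn (frac N q) W →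
      SuppIn (frac n (padType k ρ f q)) W := by
    intro q hs p hp
    have h1 : q p = 0 := by
      have := hs p hp
      rw [frac, div_eq_zero_iff] at this
      exact_mod_cast this.resolve_right hN'.ne'
    have h2 : p.2 ≠ f p.1 := fun h2 => (hf p.1).ne' (h2 ▸ hp)
    simp [frac, padType, h1, h2]
  have hnear : ∀ {q : X × Y → ℕ}, frac N q ∈ stdSimplex ℝ (X × Y) → ∀ p,
      |frac n (padType k ρ f q) p - frac N q p| ≤ N / n := by
    intro q hq p
    have ha := mem_Icc_of_mem_stdSimplex hq p
    have hPx := mem_Icc_of_mem_stdSimplex hP p.1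
    set a := frac N q p with hadef
    have hqa : (q p : ℝ) = N * a := by rw [hadef, frac]; field_simp
    obtain ⟨b, hb0, hb1, hb⟩ : ∃ b : ℝ, 0 ≤ b ∧ b ≤ 1 ∧
        frac n (padType k ρ f q) p - a = ((n % N : ℕ) : ℝ) * (b - a) / n := by
      by_cases h2 : p.2 = f p.1
      · refine ⟨P p.1, hPx.1, hPx.2, ?_⟩
        rw [frac, padType, if_pos h2, Nat.cast_add, Nat.cast_mul, hqa, hρr, hkN]
        field_simp
        ring
      · refine ⟨0, le_rfl, zero_le_one, ?_⟩
        rw [frac, padType, if_neg h2, Nat.cast_add, Nat.cast_mul, hqa, hkN]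
        field_simp
        push_cast
        ring
    rw [hb, abs_div, abs_of_pos hn', abs_mul, abs_of_nonneg hmod0]
    refine div_le_div_of_nonneg_right ?_ hn'.le
    have h3 : ((n % N : ℕ) : ℝ) ≤ N := by exact_mod_cast (Nat.mod_lt n (Nat.pos_of_ne_zero hN)).le
    have h4 : |b - a| ≤ 1 := abs_le.2 ⟨by linarith [ha.2], by linarith [ha.1]⟩
    calc ((n % N : ℕ) : ℝ) * |b - a| ≤ N * 1 := mul_le_mul h3 h4 (abs_nonneg _) hN'.le
      _ = N := mul_one _
  refine ⟨padType k ρ f q, padType k ρ f q', ⟨⟨hmem hX, hmem hX', hmarg hX, hmarg hX', ?_⟩,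
    hsupp hs, hsupp hs'⟩, hnear hq, hnear hq'⟩
  have hYn : ∀ y, ∑ x, q (x, y) = ∑ x, q' (x, y) := fun y => by
    rw [margY_frac, margY_frac] at hY
    exact congrFun (frac_injective hN hY) y
  rw [margY_frac, margY_frac]
  simp only [sum_padType_snd, hYn]

/-- The pairs of types are asymptotically dense, along all blocklengths, in the pairs of joint
distributions that are supported where the channel is positive. -/
lemma eventually_exists_types_near (hW : ∀ x, W x ∈ stdSimplex ℝ Y) (hP : P ∈ stdSimplex ℝ X)
    (hPtype : ∃ n, (typeClass P n).Nonempty) {z : (X × Y → ℝ) × (X × Y → ℝ)}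
    (hz : z ∈ suppPairs P W) {δ : ℝ} (hδ : 0 < δ) :
    ∀ᶠ n in blocklengths P, ∃ r r' : X × Y → ℕ, (frac n r, frac n r') ∈ suppPairs P W ∧
      dist (frac n r, frac n r') z < δ := by
  obtain ⟨N₀, hN₀⟩ := hPtype
  obtain ⟨k, hk⟩ := exists_mul_eq_natCast hP hN₀
  obtain ⟨N, hN, q, q', hpq, hs, hs', hd, hd'⟩ := exists_types_near
    (Nat.pos_of_ne_zero (typeClass_ne_zero hP hN₀)) hk hz.1 (half_pos hδ)
  have hmem : (frac N q, frac N q') ∈ suppPairs P W :=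
    ⟨hpq, fun p h0 => by simp [frac, hs p (hz.2.1 p h0)],
      fun p h0 => by simp [frac, hs' p (hz.2.2 p h0)]⟩
  have hlim : ∀ᶠ n : ℕ in blocklengths P, (N : ℝ) / n < δ / 2 :=
    ((tendsto_const_div_atTop_nhds_zero_nat (N : ℝ)).eventually_lt_const (half_pos hδ)).filter_mono
      inf_le_left
  filter_upwards [hlim, eventually_blocklengths_nonempty] with n h1 h2
  obtain ⟨r, r', hr, hrd, hrd'⟩ := exists_types_of_blocklength hW hP hN.ne' hmem h2
  refine ⟨r, r', hr, max_lt ((dist_pi_lt_iff hδ).2 fun p => ?_)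
    ((dist_pi_lt_iff hδ).2 fun p => ?_)⟩
  · have h3 := dist_triangle (frac n r p) (frac N q p) (z.1 p)
    rw [Real.dist_eq, Real.dist_eq, Real.dist_eq] at h3
    exact h3.trans_lt (by linarith [hrd p, hd p])
  · have h3 := dist_triangle (frac n r' p) (frac N q' p) (z.2 p)
    rw [Real.dist_eq, Real.dist_eq, Real.dist_eq] at h3
    exact h3.trans_lt (by linarith [hrd' p, hd' p])

end Padding

/-! ### The exponent of Forney's decoder -/

section ForneyExponent

open Finset Filter Topology

variable {X Y : Type*} [Fintype X] [DecidableEq X] [Fintype Y] [DecidableEq Y]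
  {W : X → Y → ℝ} {P : X → ℝ} {R T : ℝ}

lemma tendsto_mul_log_add_codeErr_div (a b d : ℝ) :
    Tendsto (fun n : ℕ => (a * Real.log (n + 1) + b * codeErr X Y n + d) / n) atTop (𝓝 0) := by
  have h0 := tendsto_const_div_atTop_nhds_zero_nat (1 : ℝ)
  have h1 := ((tendsto_one_add_log_div.sub h0).const_mul a).add
    (((tendsto_codeErr_div (X := X) (Y := Y)).const_mul b).add (h0.const_mul d))
  simp only [sub_zero, mul_zero, add_zero] at h1
  exact h1.congr fun n => by ring

lemma eventually_exp_codeErr_add_le {δ : ℝ} (hδ : 0 < δ) (c : ℝ) :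
    ∀ᶠ n : ℕ in atTop, Real.exp (codeErr X Y n) + n * |c| ≤
      Real.exp (n * δ) / (#(typeVecs X Y n) : ℝ) * Real.log 2 := by
  have hlog : 0 < Real.log 2 := Real.log_pos one_lt_two
  have h4 : 0 < δ / 4 := by linarith
  have h1 := (tendsto_mul_log_add_codeErr_div (X := X) (Y := Y) 0 1 0).eventually_lt_const h4
  have h2 := (tendsto_mul_log_add_codeErr_div (X := X) (Y := Y)
    (Fintype.card (X × Y)) 0 0).eventually_lt_const h4
  have h3 : Tendsto (fun n : ℕ => Real.exp (n * (δ / 4)) * Real.log 2) atTop atTop :=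
    (Real.tendsto_exp_atTop.comp
      (tendsto_natCast_atTop_atTop.atTop_mul_const h4)).atTop_mul_const hlog
  filter_upwards [h1, h2, h3.eventually_ge_atTop (1 + |c| / (δ / 4)), eventually_gt_atTop 0]
    with n h1 h2 h3 hn
  have hn' : (0 : ℝ) < n := by exact_mod_cast hn
  rw [div_lt_iff₀ hn'] at h1 h2
  simp only [zero_mul, one_mul, zero_add, add_zero] at h1 h2
  have hL : (#(typeVecs X Y n) : ℝ) ≤ Real.exp (n * (δ / 4)) := by
    rw [card_typeVecs, ← Real.exp_log (pow_pos (by positivity : (0 : ℝ) < n + 1) _), Real.log_pow]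
    exact Real.exp_le_exp.2 (by linarith)
  have hL0 : (0 : ℝ) < #(typeVecs X Y n) := by rw [card_typeVecs]; positivity
  set s := Real.exp (n * (δ / 4)) with hs
  have hs0 : 0 < s := Real.exp_pos _
  have hs1 : 1 ≤ s := Real.one_le_exp (by positivity)
  have e1 : Real.exp (codeErr X Y n) ≤ s := Real.exp_le_exp.2 (by linarith)
  have e2 : n * |c| ≤ |c| / (δ / 4) * s := by
    have h5 : (n : ℝ) * (δ / 4) ≤ s := by linarith [Real.add_one_le_exp ((n : ℝ) * (δ / 4))]
    calc (n : ℝ) * |c| = |c| / (δ / 4) * (n * (δ / 4)) := by field_simp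
      _ ≤ _ := mul_le_mul_of_nonneg_left h5 (by positivity)
  have e3 : s ^ 3 ≤ Real.exp (n * δ) / (#(typeVecs X Y n) : ℝ) := by
    rw [le_div_iff₀ hL0]
    calc s ^ 3 * (#(typeVecs X Y n) : ℝ) ≤ s ^ 3 * s :=
          mul_le_mul_of_nonneg_left hL (by positivity)
      _ = Real.exp (n * δ) := by
          rw [← pow_succ, hs, ← Real.exp_nat_mul]
          congr 1
          push_cast
          ring
  calc Real.exp (codeErr X Y n) + n * |c| ≤ (1 + |c| / (δ / 4)) * s := by linarith
    _ ≤ s * Real.log 2 * s := mul_le_mul_of_nonneg_right h3 hs0.le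
    _ = s ^ 2 * Real.log 2 := by ring
    _ ≤ s ^ 3 * Real.log 2 :=
        mul_le_mul_of_nonneg_right (pow_le_pow_right₀ hs1 (by norm_num)) hlog.le
    _ ≤ _ := mul_le_mul_of_nonneg_right e3 hlog.le

/-- The right-continuity of the constrained minimum, which always holds, is enough for the bound in
this direction. -/
theorem le_forneyExponent (hP : P ∈ stdSimplex ℝ X) (hPtype : ∃ n, (typeClass P n).Nonempty)
    (hW : ∀ x, W x ∈ stdSimplex ℝ Y) (hR : 0 < R) {c : ℝ}
    (h : (c : EReal) < exponent P W R T) : (c : EReal) ≤ forneyExponent P W R T := by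
  obtain ⟨N, hN⟩ := hPtype
  have := blocklengths_neBot hP hN
  obtain ⟨δ, hδ, hc⟩ := exists_forall_lt_cost hW h
  have hlim : Tendsto (fun n : ℕ => (((((2 * Fintype.card (X × Y) : ℕ) : ℝ) * Real.log (n + 1) +
      2 * codeErr X Y n + 0) / n + -c : ℝ) : EReal)) (blocklengths P) (𝓝 ((-c : ℝ) : EReal)) := by
    have h1 := (tendsto_mul_log_add_codeErr_div (X := X) (Y := Y)
      ((2 * Fintype.card (X × Y) : ℕ) : ℝ) 2 0).add_const (-c)
    rw [zero_add] at h1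
    exact (EReal.tendsto_coe.2 h1).mono_left inf_le_left
  rw [forneyExponent, EReal.le_neg, ← EReal.coe_neg, ← hlim.liminf_eq]
  refine liminf_le_liminf ?_
  filter_upwards [(eventually_exp_codeErr_add_le (X := X) (Y := Y) hδ c).filter_mono inf_le_left,
    eventually_blocklengths_nonempty] with n hlarge hne
  have hn := typeClass_ne_zero hP hne
  have hn' : (n : ℝ) ≠ 0 := Nat.cast_ne_zero.2 hn
  have h1 := avgForneyE1_le hW hR hn hne hc hlarge
  rw [← Real.exp_log (pow_pos (by positivity : (0 : ℝ) < n + 1) (2 * Fintype.card (X × Y))),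
    Real.log_pow, ← Real.exp_add, ← Real.exp_add] at h1
  refine (log_div_le (ENNReal.ofReal_le_ofReal h1) n).trans_eq ?_
  congr 1
  field_simp
  ring

/-- By the left-continuity, the constrained minimum is approached by pairs with a threshold
strictly below `T`, where an error is certain for a typical number of competitors. -/
theorem forneyExponent_le (hP : P ∈ stdSimplex ℝ X) (hPtype : ∃ n, (typeClass P n).Nonempty)
    (hW : ∀ x, W x ∈ stdSimplex ℝ Y) (hR : 0 < R)
    (hcont : ContinuousWithinAt (fun t : ℝ => exponent P W R t) (Set.Iic T) T) {c : ℝ}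
    (h : exponent P W R T < (c : EReal)) : forneyExponent P W R T ≤ (c : EReal) := by
  obtain ⟨z, hz, hzT, hzc⟩ := exists_cost_lt_of_continuousWithinAt hW hcont h
  have hz0 : z ∈ {q : (X × Y → ℝ) × (X × Y → ℝ) | ∀ p, 0 ≤ q.1 p} := hz.1.1.1
  set γ := (T - thresh W R z) / 2 with hγ
  have hγ0 : 0 < γ := half_pos (sub_pos.2 hzT)
  obtain ⟨δ₁, hδ₁, hnear₁⟩ := Metric.continuousOn_iff.1 (continuousOn_thresh (W := W) (R := R))
    z hz0 γ hγ0
  obtain ⟨δ₂, hδ₂, hnear₂⟩ := Metric.continuousOn_iff.1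
    (continuousOn_cost (P := P) (W := W) (R := R)) z hz0 _ (sub_pos.2 hzc)
  have := blocklengths_neBot hP hPtype.choose_spec
  have hlim : Tendsto (fun n : ℕ => (((0 * Real.log (n + 1) +
      -2 * codeErr X Y n + -Real.log 4) / n + -c : ℝ) : EReal)) (blocklengths P)
      (𝓝 ((-c : ℝ) : EReal)) := by
    have h1 := (tendsto_mul_log_add_codeErr_div (X := X) (Y := Y) 0 (-2)
      (-Real.log 4)).add_const (-c)
    rw [zero_add] at h1
    exact (EReal.tendsto_coe.2 h1).mono_left inf_le_left
  rw [forneyExponent, EReal.neg_le, ← EReal.coe_neg, ← hlim.liminf_eq]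
  refine liminf_le_liminf ?_
  filter_upwards [eventually_exists_types_near hW hP hPtype hz (lt_min hδ₁ hδ₂),
    ((tendsto_mul_log_add_codeErr_div (X := X) (Y := Y) 0 1
      (Real.log 4)).eventually_lt_const hγ0).filter_mono inf_le_left,
    eventually_blocklengths_nonempty] with n ⟨r, r', hr, hd⟩ herr hne
  have hn := typeClass_ne_zero hP hne
  have hn' : (0 : ℝ) < n := by exact_mod_cast Nat.pos_of_ne_zero hn
  have h1 := hnear₁ _ hr.1.1.1 (hd.trans_le (min_le_left _ _))
  have h2 := hnear₂ _ hr.1.1.1 (hd.trans_le (min_le_right _ _))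
  rw [Real.dist_eq] at h1 h2
  have h1' := (abs_lt.1 h1).2
  have h2' := (abs_lt.1 h2).2
  rw [div_lt_iff₀ hn'] at herr
  have h3 := le_avgForneyE1 (T := T) hW hR hn hne hr (by
    have h4 : (n : ℝ) * thresh W R (frac n r, frac n r') ≤ n * (T - γ) :=
      mul_le_mul_of_nonneg_left (by linarith) hn'.le
    linarith)
  have h5 : Real.exp (-(n * c) - 2 * codeErr X Y n - Real.log 4) ≤ avgForneyE1 P W R T n := by
    refine le_trans ?_ h3
    rw [Real.exp_sub _ (Real.log 4), Real.exp_log (by norm_num)]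
    refine div_le_div_of_nonneg_right (Real.exp_le_exp.2 ?_) (by norm_num)
    have h4 : (n : ℝ) * cost P W R (frac n r, frac n r') ≤ n * c :=
      mul_le_mul_of_nonneg_left (by linarith) hn'.le
    linarith
  refine le_trans (le_of_eq ?_) (le_log_div (ENNReal.ofReal_le_ofReal h5) n)
  congr 1
  field_simp
  ring

theorem forneyExponent_eq (hP : P ∈ stdSimplex ℝ X) (hPtype : ∃ n, (typeClass P n).Nonempty)
    (hW : ∀ x, W x ∈ stdSimplex ℝ Y) (hR : 0 < R)
    (hcont : ContinuousWithinAt (fun t : ℝ => exponent P W R t) (Set.Iic T) T) :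
    forneyExponent P W R T = exponent P W R T := by
  refine le_antisymm (le_of_forall_gt fun b hb => ?_) (le_of_forall_lt fun b hb => ?_)
  · obtain ⟨c, h1, h2⟩ := EReal.lt_iff_exists_real_btwn.1 hb
    exact (forneyExponent_le hP hPtype hW hR hcont h1).trans_lt h2
  · obtain ⟨c, h1, h2⟩ := EReal.lt_iff_exists_real_btwn.1 hb
    exact h1.trans_le (le_forneyExponent hP hPtype hW hR h2)

end ForneyExponent

end ErasureList

theorem theorem1 {X Y Θ : Type*} [Fintype X] [DecidableEq X] [Fintype Y] [DecidableEq Y]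
    [Nonempty Θ]
    (P : X → ℝ) (hP : P ∈ stdSimplex ℝ X) (hPtype : ∃ n, (typeClass P n).Nonempty)
    (W : Θ → X → Y → ℝ) (hW : ∀ θ x, W θ x ∈ stdSimplex ℝ Y)
    (R T : ℝ) (hR : 0 < R)
    (hT : 0 ≤ T ∨ (-R ≤ T ∧ ∃ θ, ∀ x y, 0 < W θ x y))
    (E : Θ → EReal) (hE : ∀ θ, E θ = exponent P (W θ) R T)
    (hbdd : ∃ B : ℝ, ∀ θ, E θ ≤ (B : EReal))
    (hsupp : ∀ θ, ∀ ε : ℝ, 0 < ε → ∃ θ',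
      (∀ x y, W θ' x y = 0 → ∀ θ'', W θ'' x y = 0) ∧
      (∀ x y, |W θ' x y - W θ x y| < ε) ∧ E θ ≤ E θ' + (ε : EReal))
    (mode : Mode) (hmode : mode = Mode.erasure → 0 ≤ T) :
    (∀ θ, ContinuousWithinAt (fun t : ℝ => exponent P (W θ) R t) (Set.Iic T) T →
      forneyExponent P (W θ) R T = E θ) ∧
    IsGreatest {ξ | ξ ∈ Set.Icc (0 : ℝ) 1 ∧ Achievable P W E R T mode ξ}
      (xiStar P W E R T mode) ∧
    IsGreatest {ξ | ξ ∈ Set.Icc (0 : ℝ) 1 ∧ condQ P W E R T ξ ∧ condL P W E R T ξ}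
      (xiStar P W E R T mode) := by
  refine ⟨fun θ hcont => (hE θ).symm ▸ forneyExponent_eq hP hPtype (hW θ) hR hcont, ?_⟩
  obtain ⟨B, hB⟩ := hbdd
  obtain ⟨e, rfl⟩ : ∃ e : Θ → ℝ, E = fun θ => (e θ : EReal) := by
    refine ⟨fun θ => (E θ).toReal, funext fun θ => (EReal.coe_toReal ?_ ?_).symm⟩
    · exact ((hB θ).trans_lt (EReal.coe_lt_top B)).ne
    · exact (EReal.bot_lt_zero.trans_le ((exponent_nonneg hP (hW θ)).trans_eq (hE θ).symm)).ne'
  have hB' : ∀ θ, e θ ≤ B := fun θ => EReal.coe_le_coe_iff.1 (hB θ)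
  have hsupp' : ∀ θ, ∀ ε : ℝ, 0 < ε → ∃ θ', (∀ x y, W θ' x y = 0 → ∀ θ'', W θ'' x y = 0) ∧
      (∀ x y, |W θ' x y - W θ x y| < ε) ∧ e θ ≤ e θ' + ε := fun θ ε hε => by
    obtain ⟨θ', h1, h2, h3⟩ := hsupp θ ε hε
    have h3 : (e θ : EReal) ≤ e θ' + ε := h3
    exact ⟨θ', h1, h2, by exact_mod_cast h3⟩
  have hach : {ξ | ξ ∈ Set.Icc (0 : ℝ) 1 ∧
      Achievable P W (fun θ => (e θ : EReal)) R T mode ξ} =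
      Set.Icc 0 1 ∩ {ξ | PairCond P W e R T ξ} := by
    ext ξ
    exact and_congr_right fun hξ => ⟨pairCond_of_achievable hP hPtype hW hR hξ.1 hB',
      achievable_of_pairCond hP hPtype hW hR hξ.1 hB' hmode⟩
  have hcond : {ξ | ξ ∈ Set.Icc (0 : ℝ) 1 ∧ condQ P W (fun θ => (e θ : EReal)) R T ξ ∧
      condL P W (fun θ => (e θ : EReal)) R T ξ} =
      Set.Icc 0 1 ∩ {ξ | PairCond P W e R T ξ} := by
    ext ξ
    exact and_congr_right fun hξ =>
      ⟨fun h => pairCond_of_cond hW hT hsupp' hξ.1 hB' hR h.1 h.2, cond_of_pairCond hW⟩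
  rw [xiStar, hach, hcond, and_self]
  exact (isCompact_Icc.inter_right isClosed_pairCond).isGreatest_sSup
    ⟨0, ⟨le_rfl, zero_le_one⟩, pairCond_zero hW⟩
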